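/- **Setting.** Let $d\ge 1$, let $\Omega\subset\mathbb R^d$ be an open bounded Lipschitz polytope, $T>0$, $c>0$, and let $\partial\Omega=\Gamma_D\cup\Gamma_N$ with $\Gamma_D,\Gamma_N$ Borel and $\Gamma_D\cap\Gamma_N$ of surface measure zero; $\mathbf n_\Omega$ is the outward unit normal. Let $A$ be a symmetric positive definite $d\times d$ matrix, $A=P^T\Lambda P$ with $P$ orthogonal and $\Lambda=\mathrm{diag}(\lambda_1,\dots,\lambda_d)$; $A^s:=P^T\Lambda^sP$ for $s\in\mathbb R$. **Mesh.** Let $\{K_i\}$ be a finite partition of $\Omega$ into pairwise disjoint open polytopes ($\bigcup_i\overline{K_i}=\overline\Omega$), let $0=t_0<t_1<\dots<t_N=T$ ($N\ge1$), $I_n=(t_{n-1},t_n)$, and let $\mathcal T_h=\{K_i\times I_n\}$. Let $\mathcal F^{\rm space}$ be the union of the faces $K_i\times\{t_n\}$, $1\le n\le N-1$; $\mathcal F^{\rm time}$ the union of the faces $(\partial K_i\cap\partial K_j)\times I_n$, $i\ne j$; $\mathcal F^0=\Omega\times\{0\}$, $\mathcal F^T=\Omega\times\{T\}$, $\mathcal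 F^D=\Gamma_D\times[0,T]$, $\mathcal F^N=\Gamma_N\times[0,T]$. On a space-like face $w^-,w^+$ are the traces from below and from above in time, and $[\![w]\!]_t=w^--w^+$, $[\![\tau]\!]_t=\tau^--\tau^+$. On a time-like face between elements $1$ and $2$ (outward space normals $\mathbf n_1,\mathbf n_2$), $\{\!\{\cdot\}\!\}$ is the mean of the two traces, $[\![w]\!]_{\mathbf N}=w_1\mathbf n_1+w_2\mathbf n_2$ and $[\![\tau]\!]_{\mathbf N}=\tau_1\cdot\mathbf n_1+\tau_2\cdot\mathbf n_2$. Let $\alpha,\beta,\delta$ be bounded measurable functions on the time-like part of the skeleton, with $\alpha,\beta$ bounded below by a positive constant (for example, constant on each time-like face, and $\alpha,\beta>0$). The data are $v_0\in L^2(\Omega)$, $\sigma_0\in L^2(\Omega)^d$, $g_D\in L^2(\mathcal F^D)$, $g_N\in L^2(\mathcal F^N)$. **Trefftz space.** For an integer $p\ge0$ let $\hat{\mathbb U}^{p+1}$ be the space of real polynomials $b(\hat{\mathbf x},t)$ of total degree at most $p+1$ with $-\Delta b+c^{-2}\partial_t^2b=0$. Let $\mathbb W^p(K)$ be the span of the fields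 $(\mathbf x,t)\mapsto\big(\partial_tb(S\mathbf x,t),\,-P^T\hat\nabla b(S\mathbf x,t)\big)$ on $K$, with $S=\Lambda^{-1/2}P$ and $b\in\hat{\mathbb U}^{p+1}$, and let $\mathbf V_h=\prod_{K\in\mathcal T_h}\mathbb W^p(K)$. **Forms.** $$\begin{aligned}\mathcal A(v,\sigma;w,\tau)=&\int_{\mathcal F^{\rm space}}\big(c^{-2}v^-[\![w]\!]_t+\sigma^-\cdot[\![\tau]\!]_t\big)d\mathbf x+\int_{\mathcal F^{\rm time}}\big(\{\!\{v\}\!\}[\![A^{1/2}\tau]\!]_{\mathbf N}+\{\!\{\sigma\}\!\}\cdot A^{1/2}[\![w]\!]_{\mathbf N}\\&+\alpha A^\delta[\![v]\!]_{\mathbf N}\cdot A^{1/2}[\![w]\!]_{\mathbf N}+\beta[\![A^{1/2}\sigma]\!]_{\mathbf N}[\![A^{1/2}\tau]\!]_{\mathbf N}\big)dS+\int_{\mathcal F^T}\big(c^{-2}vw+\sigma\cdot\tau\big)d\mathbf x\\&+\int_{\mathcal F^D}\big(\sigma\cdot wA^{1/2}\mathbf n_\Omega+\alpha vw\,A^\delta\mathbf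 n_\Omega\cdot A^{1/2}\mathbf n_\Omega\big)dS\\&+\int_{\mathcal F^N}\big(v\,(A^{1/2}\tau\cdot\mathbf n_\Omega)+\beta(A^{1/2}\sigma\cdot\mathbf n_\Omega)(A^{1/2}\tau\cdot\mathbf n_\Omega)\big)dS,\end{aligned}$$ $$\begin{aligned}\ell(w,\tau)=&\int_{\mathcal F^0}\big(c^{-2}v_0w+\sigma_0\cdot\tau\big)d\mathbf x+\int_{\mathcal F^N}g_N\big(\beta A^{1/2}\tau\cdot\mathbf n_\Omega-w\big)dS\\&+\int_{\mathcal F^D}\alpha g_Dw\,A^\delta\mathbf n_\Omega\cdot A^{1/2}\mathbf n_\Omega\,dS-\int_{\mathcal F^D}g_DA^{1/2}\tau\cdot\mathbf n_\Omega\,dS.\end{aligned}$$ **Norms.** With $L^2$ norms over the indicated sets, $$\begin{aligned}|(w,\tau)|_{\rm DG}^2=&\tfrac12\|c^{-1}[\![w]\!]_t\|^2_{\mathcal F^{\rm space}}+\tfrac12\|[\![\tau]\!]_t\|^2_{\mathcal F^{\rm space}}+\tfrac12\|c^{-1}w\|^2_{\mathcal F^0\cup\mathcal F^T}+\tfrac12\|\tau\|^2_{\mathcal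 F^0\cup\mathcal F^T}+\|\alpha^{1/2}A^{\frac14+\frac\delta2}[\![w]\!]_{\mathbf N}\|^2_{\mathcal F^{\rm time}}\\&+\|\beta^{1/2}[\![A^{1/2}\tau]\!]_{\mathbf N}\|^2_{\mathcal F^{\rm time}}+\|\alpha^{1/2}wA^{\frac14+\frac\delta2}\mathbf n_\Omega\|^2_{\mathcal F^D}+\|\beta^{1/2}A^{1/2}\tau\cdot\mathbf n_\Omega\|^2_{\mathcal F^N},\\|(w,\tau)|_{\rm DG^+}^2=&|(w,\tau)|_{\rm DG}^2+2\|c^{-1}w^-\|^2_{\mathcal F^{\rm space}}+2\|\tau^-\|^2_{\mathcal F^{\rm space}}+\|\alpha^{-1/2}A^{\frac14-\frac\delta2}\{\!\{\tau\}\!\}\|^2_{\mathcal F^{\rm time}}\\&+\|\alpha^{-1/2}A^{\frac14-\frac\delta2}\tau\|^2_{\mathcal F^D}+\|\beta^{-1/2}\{\!\{w\}\!\}\|^2_{\mathcal F^{\rm time}}+\|\beta^{-1/2}w\|^2_{\mathcal F^N}.\end{aligned}$$ **Lemma.** There is a unique $(v_h,\sigma_h)\in\mathbf V_h$ such that $\mathcal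 A(v_h,\sigma_h;w,\tau)=\ell(w,\tau)$ for all $(w,\tau)\in\mathbf V_h$. Moreover, for all $(v,\sigma),(w,\tau)\in\mathbf V_h$, $$|(w,\tau)|_{\rm DG}^2=\mathcal A(w,\tau;w,\tau),$$ $$|\mathcal A(v,\sigma;w,\tau)|\le2\,|(v,\sigma)|_{\rm DG^+}\,|(w,\tau)|_{\rm DG},\qquad|\mathcal A(v,\sigma;w,\tau)|\le2\,|(v,\sigma)|_{\rm DG}\,|(w,\tau)|_{\rm DG^+}.$$ -/

import Mathlib

open MeasureTheory Set Topology

namespace TrefftzDG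

/-- The Euclidean space `ℝ^d`. -/
abbrev Space (d : ℕ) := EuclideanSpace ℝ (Fin d)

/-! ### Polytopes and outward normals -/

/-- A (not necessarily convex) open polytope: a nonempty bounded open set without slits whose
boundary is contained in finitely many hyperplanes. -/
structure IsPolytope {d : ℕ} (K : Set (Space d)) : Prop where
  isOpen : IsOpen K
  nonempty : K.Nonempty
  isBounded : Bornology.IsBounded K
  regular : interior (closure K) = K
  hyperplanes : ∃ H : Finset (Space d × ℝ), (∀ h ∈ H, h.1 ≠ 0) ∧
    ∀ x ∈ frontier K, ∃ h ∈ H, inner ℝ h.1 x = h.2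

/-- Near each of its boundary points the set is, in suitable Cartesian coordinates, the set of
points strictly above the graph of a Lipschitz function. The function `φ` does not vary in the
vertical direction `e`, so it is a function of the other `d - 1` coordinates. -/
def HasLipschitzBoundary {d : ℕ} (Ω : Set (Space d)) : Prop :=
  ∀ x ∈ frontier Ω, ∃ (e : Space d) (φ : Space d → ℝ) (L : NNReal) (r : ℝ),
    ‖e‖ = 1 ∧ LipschitzWith L φ ∧ (∀ (y : Space d) (s : ℝ), φ (y + s • e) = φ y) ∧ 0 < r ∧
      ∀ y ∈ Metric.ball x r, (y ∈ Ω ↔ φ y < inner ℝ y e)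

/-- `ν` is the outward unit normal at `x` of a set which coincides near `x` with an open
half-space having `x` on its boundary. -/
def IsOutwardNormal {d : ℕ} (K : Set (Space d)) (x ν : Space d) : Prop :=
  ‖ν‖ = 1 ∧ ∀ᶠ y in 𝓝 x, (y ∈ K ↔ inner ℝ (y - x) ν < 0)

open Classical in
/-- The outward unit normal of `K` at `x`. For a polytope it exists (and is unique) at all
boundary points up to a set of surface measure zero; elsewhere the value is `0`. -/
noncomputable def outwardNormal {d : ℕ} (K : Set (Space d)) (x : Space d) : Space d :=
  if h : ∃ ν, IsOutwardNormal K x ν then h.choose else 0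

/-! ### The model, the mesh, the parameters and the data -/

/-- The space-time cylinder `Ω × (0,T)`, the splitting of the boundary of `Ω`, the wave speed,
and the anisotropy matrix `A` with a spectral decomposition `A = Pᵀ Λ P`, `Λ = diag lam`. -/
structure Model (d : ℕ) where
  Ω : Set (Space d)
  polytope : IsPolytope Ω
  lipschitz : HasLipschitzBoundary Ω
  ΓD : Set (Space d)
  ΓN : Set (Space d)
  measurable_ΓD : MeasurableSet ΓD
  measurable_ΓN : MeasurableSet ΓN
  boundary_eq : ΓD ∪ ΓN = frontier Ω
  boundary_disjoint : μHE[d - 1] (ΓD ∩ ΓN) = 0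
  T : ℝ
  T_pos : 0 < T
  c : ℝ
  c_pos : 0 < c
  A : Matrix (Fin d) (Fin d) ℝ
  posDef : A.PosDef
  P : Matrix (Fin d) (Fin d) ℝ
  lam : Fin d → ℝ
  orthogonal : P ∈ Matrix.orthogonalGroup (Fin d) ℝ
  diagonalization : A = P.transpose * Matrix.diagonal lam * P

/-- The real power `A ^ s = Pᵀ Λ ^ s P`, as an operator on `ℝ^d`. -/
noncomputable def Model.pow {d : ℕ} (S : Model d) (s : ℝ) : Space d →L[ℝ] Space d :=
  Matrix.toEuclideanCLM (n := Fin d) (𝕜 := ℝ)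
    (S.P.transpose * Matrix.diagonal (fun i => S.lam i ^ s) * S.P)

/-- A tensor product mesh of `Ω × (0,T)`: a partition of `Ω` into finitely many polytopes
`K i`, and a partition of `(0,T)` into the `M + 1` intervals `(time n, time (n + 1))`. -/
structure Mesh {d : ℕ} (S : Model d) where
  m : ℕ
  K : Fin m → Set (Space d)
  polytope : ∀ i, IsPolytope (K i)
  disjoint : ∀ i j, i ≠ j → Disjoint (K i) (K j)
  cover : ⋃ i, closure (K i) = closure S.Ω
  M : ℕ
  time : Fin (M + 2) → ℝ
  time_strictMono : StrictMono time
  time_zero : time 0 = 0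
  time_last : time (Fin.last (M + 1)) = S.T

/-- The stabilization parameters, as functions on the time-like part of the skeleton (their
values elsewhere play no role). Functions that are constant on each of the finitely many
time-like faces, positive in the case of `α` and `β`, are instances. -/
structure Parameters (d : ℕ) where
  α : Space d × ℝ → ℝ
  β : Space d × ℝ → ℝ
  δ : Space d × ℝ → ℝ
  measurable_α : Measurable α
  measurable_β : Measurable β
  measurable_δ : Measurable δ
  lower : ∃ a : ℝ, 0 < a ∧ ∀ z, a ≤ α z ∧ a ≤ β z
  upper : ∃ b : ℝ, ∀ z, α z ≤ b ∧ β z ≤ b ∧ |δ z| ≤ b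

/-- The surface measure on the lateral piece `F × (a,b)`, for `F` of dimension `d - 1`. -/
noncomputable def lateral {d : ℕ} (F : Set (Space d)) (a b : ℝ) : Measure (Space d × ℝ) :=
  ((μHE[d - 1] : Measure (Space d)).restrict F).prod (volume.restrict (Ioo a b))

/-- Square integrable initial and boundary data. -/
structure Data {d : ℕ} (S : Model d) where
  v₀ : Space d → ℝ
  σ₀ : Space d → Space d
  gD : Space d × ℝ → ℝ
  gN : Space d × ℝ → ℝ
  memLp_v₀ : MemLp v₀ 2 (volume.restrict S.Ω)
  memLp_σ₀ : MemLp σ₀ 2 (volume.restrict S.Ω)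
  memLp_gD : MemLp gD 2 (lateral S.ΓD 0 S.T)
  memLp_gN : MemLp gN 2 (lateral S.ΓN 0 S.T)

/-! ### The polynomial Trefftz space -/

/-- Pairs of a scalar field and a vector field in the variables `(x, t)`. -/
abbrev Field (d : ℕ) := (Space d → ℝ → ℝ) × (Space d → ℝ → Space d)

/-- Value at `(x, t)` of a polynomial in `d + 1` variables; the variable `none` is the time. -/
noncomputable def polyEval {d : ℕ} (b : MvPolynomial (Option (Fin d)) ℝ) (x : Space d) (t : ℝ) :
    ℝ :=
  MvPolynomial.eval (fun o : Option (Fin d) => o.elim t (fun i => x i)) b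

/-- The polynomials `U` of total degree at most `q` with `- ΔU + c⁻² ∂²U/∂t² = 0`. -/
def IsWavePolynomial {d : ℕ} (c : ℝ) (q : ℕ) (U : MvPolynomial (Option (Fin d)) ℝ) : Prop :=
  U ∈ MvPolynomial.restrictTotalDegree (Option (Fin d)) ℝ q ∧
    -(∑ i : Fin d, MvPolynomial.pderiv (some i) (MvPolynomial.pderiv (some i) U)) +
      MvPolynomial.C ((c ^ 2)⁻¹) * MvPolynomial.pderiv none (MvPolynomial.pderiv none U) = 0

/-- The change of coordinates `x ↦ Λ^(-1/2) P x`. -/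
noncomputable def Model.toHat {d : ℕ} (S : Model d) : Space d →L[ℝ] Space d :=
  Matrix.toEuclideanCLM (n := Fin d) (𝕜 := ℝ)
    (Matrix.diagonal (fun i => S.lam i ^ (-(1 / 2) : ℝ)) * S.P)

/-- The pair `(∂b/∂t, - Pᵀ ∇b)`, with `b` a polynomial in the transformed coordinates. -/
noncomputable def Model.trefftzField {d : ℕ} (S : Model d)
    (b : MvPolynomial (Option (Fin d)) ℝ) : Field d :=
  (fun x t => polyEval (MvPolynomial.pderiv none b) (S.toHat x) t,
   fun x t => -(Matrix.toEuclideanCLM (n := Fin d) (𝕜 := ℝ) S.P.transpose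
      (WithLp.toLp 2 fun i => polyEval (MvPolynomial.pderiv (some i) b) (S.toHat x) t)))

/-- The local Trefftz space of degree `p`. Its members are polynomial fields; they are given
here by their polynomial expressions on `ℝ^d × ℝ`, which determine, and are determined by, their
restrictions to a (nonempty open) element, and which provide the traces on its boundary. -/
noncomputable def Model.localTrefftz {d : ℕ} (S : Model d) (p : ℕ) : Submodule ℝ (Field d) :=
  Submodule.span ℝ {u | ∃ b, IsWavePolynomial S.c (p + 1) b ∧ u = S.trefftzField b}

namespace Mesh

variable {d : ℕ} {S : Model d}

/-- Broken fields: one field on each element `K i × (time n, time (n + 1))`. -/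
abbrev Broken (h : Mesh S) := Fin h.m → Fin (h.M + 1) → Field d

/-- The global Trefftz space, the product of the local ones over all elements. -/
noncomputable def trefftzSpace (h : Mesh S) (p : ℕ) : Submodule ℝ h.Broken :=
  Submodule.pi univ fun _ => Submodule.pi univ fun _ => S.localTrefftz p

/-! ### Traces, jumps, averages, and the pieces of the skeleton -/

/-- The internal time levels. -/
def level (h : Mesh S) (k : Fin h.M) : ℝ := h.time k.succ.castSucc

/-- Trace of the scalar field on `K i × {level k}` from the slab below. -/
def below (h : Mesh S) (w : h.Broken) (i : Fin h.m) (k : Fin h.M) (x : Space d) : ℝ :=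
  (w i k.castSucc).1 x (h.level k)

/-- Trace of the vector field on `K i × {level k}` from the slab below. -/
def belowVec (h : Mesh S) (w : h.Broken) (i : Fin h.m) (k : Fin h.M) (x : Space d) : Space d :=
  (w i k.castSucc).2 x (h.level k)

/-- Time jump (value from below minus value from above) of the scalar field. -/
def tJump (h : Mesh S) (w : h.Broken) (i : Fin h.m) (k : Fin h.M) (x : Space d) : ℝ :=
  (w i k.castSucc).1 x (h.level k) - (w i k.succ).1 x (h.level k)

/-- Time jump of the vector field. -/
def tJumpVec (h : Mesh S) (w : h.Broken) (i : Fin h.m) (k : Fin h.M) (x : Space d) : Space d :=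
  (w i k.castSucc).2 x (h.level k) - (w i k.succ).2 x (h.level k)

/-- Average of the scalar field between the elements over `K i` and `K j`. -/
noncomputable def avg (h : Mesh S) (w : h.Broken) (i j : Fin h.m) (n : Fin (h.M + 1))
    (z : Space d × ℝ) : ℝ :=
  ((w i n).1 z.1 z.2 + (w j n).1 z.1 z.2) / 2

/-- Average of the vector field between the elements over `K i` and `K j`. -/
noncomputable def avgVec (h : Mesh S) (w : h.Broken) (i j : Fin h.m) (n : Fin (h.M + 1))
    (z : Space d × ℝ) : Space d :=
  (1 / 2 : ℝ) • ((w i n).2 z.1 z.2 + (w j n).2 z.1 z.2)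

/-- Space normal jump of the scalar field (a vector). -/
noncomputable def nJump (h : Mesh S) (w : h.Broken) (i j : Fin h.m) (n : Fin (h.M + 1))
    (z : Space d × ℝ) : Space d :=
  (w i n).1 z.1 z.2 • outwardNormal (h.K i) z.1 + (w j n).1 z.1 z.2 • outwardNormal (h.K j) z.1

/-- Space normal jump of `A^(1/2) τ`, for `τ` the vector field (a scalar). -/
noncomputable def nJumpVec (h : Mesh S) (w : h.Broken) (i j : Fin h.m) (n : Fin (h.M + 1))
    (z : Space d × ℝ) : ℝ :=
  inner ℝ (S.pow (1 / 2) ((w i n).2 z.1 z.2)) (outwardNormal (h.K i) z.1) +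
    inner ℝ (S.pow (1 / 2) ((w j n).2 z.1 z.2)) (outwardNormal (h.K j) z.1)

/-- Sum over the internal space-like faces `K i × {level k}` of the integrals of `f i k`. -/
noncomputable def intSpace (h : Mesh S) (f : Fin h.m → Fin h.M → Space d → ℝ) : ℝ :=
  ∑ i, ∑ k, ∫ x in h.K i, f i k x

/-- Sum over the internal time-like faces `(∂K i ∩ ∂K j) × (time n, time (n + 1))`, each taken
once, of the integrals of `f i j n`. -/
noncomputable def intTime (h : Mesh S)
    (f : Fin h.m → Fin h.m → Fin (h.M + 1) → Space d × ℝ → ℝ) : ℝ :=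
  ∑ i, ∑ j ∈ Finset.Ioi i, ∑ n, ∫ z, f i j n z
    ∂(lateral (frontier (h.K i) ∩ frontier (h.K j)) (h.time n.castSucc) (h.time n.succ))

/-- Sum over the elements of the integrals of `f i n` over the part of the lateral boundary of
the element which lies on `Γ × (0,T)`; used with `Γ = ΓD` and `Γ = ΓN`. -/
noncomputable def intBdry (h : Mesh S) (Γ : Set (Space d))
    (f : Fin h.m → Fin (h.M + 1) → Space d × ℝ → ℝ) : ℝ :=
  ∑ i, ∑ n, ∫ z, f i n z
    ∂(lateral (frontier (h.K i) ∩ Γ) (h.time n.castSucc) (h.time n.succ))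

/-- Integral over `Ω × {0}` or `Ω × {T}`, element by element. -/
noncomputable def intSlice (h : Mesh S) (f : Fin h.m → Space d → ℝ) : ℝ :=
  ∑ i, ∫ x in h.K i, f i x

/-! ### The Trefftz discontinuous Galerkin formulation -/

/-- The bilinear form `𝒜(v, σ; w, τ)`, with `V = (v, σ)` and `W = (w, τ)`. -/
noncomputable def form (h : Mesh S) (π : Parameters d) (V W : h.Broken) : ℝ :=
  h.intSpace (fun i k x =>
      (S.c ^ 2)⁻¹ * h.below V i k x * h.tJump W i k x
        + inner ℝ (h.belowVec V i k x) (h.tJumpVec W i k x))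
  + h.intTime (fun i j n z =>
      h.avg V i j n z * h.nJumpVec W i j n z
        + inner ℝ (h.avgVec V i j n z) (S.pow (1 / 2) (h.nJump W i j n z))
        + π.α z * inner ℝ (S.pow (π.δ z) (h.nJump V i j n z)) (S.pow (1 / 2) (h.nJump W i j n z))
        + π.β z * h.nJumpVec V i j n z * h.nJumpVec W i j n z)
  + h.intSlice (fun i x =>
      (S.c ^ 2)⁻¹ * (V i (Fin.last h.M)).1 x S.T * (W i (Fin.last h.M)).1 x S.T
        + inner ℝ ((V i (Fin.last h.M)).2 x S.T) ((W i (Fin.last h.M)).2 x S.T))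
  + h.intBdry S.ΓD (fun i n z =>
      inner ℝ ((V i n).2 z.1 z.2) ((W i n).1 z.1 z.2 • S.pow (1 / 2) (outwardNormal S.Ω z.1))
        + π.α z * (V i n).1 z.1 z.2 * (W i n).1 z.1 z.2 *
          inner ℝ (S.pow (π.δ z) (outwardNormal S.Ω z.1))
            (S.pow (1 / 2) (outwardNormal S.Ω z.1)))
  + h.intBdry S.ΓN (fun i n z =>
      (V i n).1 z.1 z.2 * inner ℝ (S.pow (1 / 2) ((W i n).2 z.1 z.2)) (outwardNormal S.Ω z.1)
        + π.β z * inner ℝ (S.pow (1 / 2) ((V i n).2 z.1 z.2)) (outwardNormal S.Ω z.1) *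
          inner ℝ (S.pow (1 / 2) ((W i n).2 z.1 z.2)) (outwardNormal S.Ω z.1))

/-- The linear functional `ℓ(w, τ)`, with `W = (w, τ)`. -/
noncomputable def load (h : Mesh S) (π : Parameters d) (g : Data S) (W : h.Broken) : ℝ :=
  h.intSlice (fun i x =>
      (S.c ^ 2)⁻¹ * g.v₀ x * (W i 0).1 x 0 + inner ℝ (g.σ₀ x) ((W i 0).2 x 0))
  + h.intBdry S.ΓN (fun i n z =>
      g.gN z * (π.β z * inner ℝ (S.pow (1 / 2) ((W i n).2 z.1 z.2)) (outwardNormal S.Ω z.1)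
        - (W i n).1 z.1 z.2))
  + h.intBdry S.ΓD (fun i n z =>
      π.α z * g.gD z * (W i n).1 z.1 z.2 *
        inner ℝ (S.pow (π.δ z) (outwardNormal S.Ω z.1)) (S.pow (1 / 2) (outwardNormal S.Ω z.1)))
  - h.intBdry S.ΓD (fun i n z =>
      g.gD z * inner ℝ (S.pow (1 / 2) ((W i n).2 z.1 z.2)) (outwardNormal S.Ω z.1))

/-- `U` solves the discrete Trefftz problem: `U` is in the Trefftz space, and
`𝒜(U; W) = ℓ(W)` for all `W` in the Trefftz space. -/
def IsDiscreteSolution (h : Mesh S) (π : Parameters d) (g : Data S) (p : ℕ) (U : h.Broken) :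
    Prop :=
  U ∈ h.trefftzSpace p ∧ ∀ W ∈ h.trefftzSpace p, h.form π U W = h.load π g W

/-- The square of the DG norm. -/
noncomputable def dgSq (h : Mesh S) (π : Parameters d) (W : h.Broken) : ℝ :=
  (1 / 2) * h.intSpace (fun i k x => (S.c⁻¹ * h.tJump W i k x) ^ 2)
  + (1 / 2) * h.intSpace (fun i k x => ‖h.tJumpVec W i k x‖ ^ 2)
  + (1 / 2) * (h.intSlice (fun i x => (S.c⁻¹ * (W i 0).1 x 0) ^ 2)
      + h.intSlice (fun i x => (S.c⁻¹ * (W i (Fin.last h.M)).1 x S.T) ^ 2))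
  + (1 / 2) * (h.intSlice (fun i x => ‖(W i 0).2 x 0‖ ^ 2)
      + h.intSlice (fun i x => ‖(W i (Fin.last h.M)).2 x S.T‖ ^ 2))
  + h.intTime (fun i j n z =>
      ‖π.α z ^ (1 / 2 : ℝ) • S.pow (1 / 4 + π.δ z / 2) (h.nJump W i j n z)‖ ^ 2)
  + h.intTime (fun i j n z => (π.β z ^ (1 / 2 : ℝ) * h.nJumpVec W i j n z) ^ 2)
  + h.intBdry S.ΓD (fun i n z =>
      ‖(π.α z ^ (1 / 2 : ℝ) * (W i n).1 z.1 z.2) •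
        S.pow (1 / 4 + π.δ z / 2) (outwardNormal S.Ω z.1)‖ ^ 2)
  + h.intBdry S.ΓN (fun i n z =>
      (π.β z ^ (1 / 2 : ℝ) *
        inner ℝ (S.pow (1 / 2) ((W i n).2 z.1 z.2)) (outwardNormal S.Ω z.1)) ^ 2)

/-- The square of the augmented DG norm. -/
noncomputable def dgPlusSq (h : Mesh S) (π : Parameters d) (W : h.Broken) : ℝ :=
  h.dgSq π W
  + 2 * h.intSpace (fun i k x => (S.c⁻¹ * h.below W i k x) ^ 2)
  + 2 * h.intSpace (fun i k x => ‖h.belowVec W i k x‖ ^ 2)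
  + h.intTime (fun i j n z =>
      ‖π.α z ^ (-(1 / 2) : ℝ) • S.pow (1 / 4 - π.δ z / 2) (h.avgVec W i j n z)‖ ^ 2)
  + h.intBdry S.ΓD (fun i n z =>
      ‖π.α z ^ (-(1 / 2) : ℝ) • S.pow (1 / 4 - π.δ z / 2) ((W i n).2 z.1 z.2)‖ ^ 2)
  + h.intTime (fun i j n z => (π.β z ^ (-(1 / 2) : ℝ) * h.avg W i j n z) ^ 2)
  + h.intBdry S.ΓN (fun i n z => (π.β z ^ (-(1 / 2) : ℝ) * (W i n).1 z.1 z.2) ^ 2)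

/-- The DG norm `|(w, τ)|_DG`. -/
noncomputable def dgNorm (h : Mesh S) (π : Parameters d) (W : h.Broken) : ℝ :=
  √(h.dgSq π W)

/-- The augmented DG norm `|(w, τ)|_DG⁺`. -/
noncomputable def dgPlusNorm (h : Mesh S) (π : Parameters d) (W : h.Broken) : ℝ :=
  √(h.dgPlusSq π W)

end Mesh

end TrefftzDG

/-! ### Surface measure on hyperplanes -/

namespace TrefftzDG

variable {d : ℕ}

/-! Everything rests on one energy identity. If two Trefftz fields come from wave potentials, the
time derivative of the energy density c⁻²vw + σ·τ equals minus the divergence of the flux v A^(1/2)τ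
+ w A^(1/2)σ. The divergence theorem on each element and summation over the mesh give
`total_fluxIntegrand`: the integral over the skeleton of a bilinear density `fluxIntegrand V W`
vanishes. On time-like faces this density consists of products of means and jumps.

Coercivity is then pointwise algebra: on every face the density of the squared DG norm is the
density of the form at (W, W) minus half of `fluxIntegrand W W` (`dgIntegrand_eq`).

For the two bounds, each product in the form is estimated by Young's inequality on its face. The
first bound is direct (`formIntegrand_le`). For the second, multiples of the flux densities of (V,
W) and (W, W) are subtracted, which exchanges traces of V for traces of W at no cost in the integral
(`formIntegrand_le_flux`). Replacing V by r V and optimizing over r turns the sums of squares into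
products of norms, with constant 2 (`abs_le_two_mul_sqrt_mul_sqrt`).

For unique solvability, the Trefftz space is finite-dimensional, so injectivity of the form, as a
map into the dual, is enough. By coercivity this means that the DG seminorm is definite. If it
vanishes, then the initial values and the jumps in time vanish, and uniqueness in the Cauchy problem
for polynomial waves propagates zero from slab to slab (`eq_zero_of_dgSq_eq_zero`).

Two geometric facts are proved from the weak notion of polytope used here. The divergence theorem
(`IsPolytope.integral_fderiv`) comes from difference quotients: ε⁻¹ times the difference of the
indicators of K + εv and K concentrates on the hyperplanes carrying the boundary, with density ν·v.
The structure of faces (`ae_facePoint_cases`) holds because, at almost every boundary point, all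
boundaries lie near that point on one common hyperplane, so that each element is locally everything,
nothing, or a half-space. -/

theorem finrank_orthogonal_span_singleton_space {n : Space d} (hn : n ≠ 0) :
    Module.finrank ℝ (Submodule.span ℝ {n})ᗮ = d - 1 := by
  have := (Submodule.span ℝ {n}).finrank_add_finrank_orthogonal
  simp only [finrank_span_singleton hn, finrank_euclideanSpace, Fintype.card_fin] at this
  omega

/-- The surface measure of a hyperplane is the image of the volume of its direction. -/
theorem measurePreserving_coe_add_smul {n : Space d} (hn : ‖n‖ = 1) (s : ℝ) :
    MeasurePreserving (fun a : (Submodule.span ℝ {n})ᗮ => (a : Space d) + s • n) volume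
      ((μHE[d - 1] : Measure (Space d)).restrict {x | inner ℝ n x = s}) := by
  have hn0 : n ≠ 0 := by
    rintro rfl
    simp at hn
  have hiso : Isometry (fun a : (Submodule.span ℝ {n})ᗮ => (a : Space d) + s • n) :=
    (isometry_add_right (s • n)).comp isometry_subtype_coe
  have hrange : range (fun a : (Submodule.span ℝ {n})ᗮ => (a : Space d) + s • n)
      = {x | inner ℝ n x = s} := by
    ext x
    constructor
    · rintro ⟨a, rfl⟩
      have h1 : inner ℝ n (a : Space d) = 0 :=
        (Submodule.mem_orthogonal_singleton_iff_inner_right).1 a.2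
      simp [inner_add_right, inner_smul_right, h1, hn]
    · intro hx
      refine ⟨⟨x - s • n, ?_⟩, by simp⟩
      rw [Submodule.mem_orthogonal_singleton_iff_inner_right]
      simp only [mem_ofPred_eq] at hx
      simp [inner_sub_right, inner_smul_right, hn, hx]
  refine ⟨hiso.continuous.measurable, ?_⟩
  -- An isometry carries Hausdorff measure to Hausdorff measure on its range; in the normal
  -- complement, of dimension d - 1, this measure is the volume.
  rw [← hrange, ← hiso.map_euclideanHausdorffMeasure,
    ← finrank_orthogonal_span_singleton_space hn0,
    InnerProductSpace.euclideanHausdorffMeasure_eq_volume]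

/-- Products and Fubini need s-finiteness, which is inherited from the volume of the direction
space. -/
theorem sFinite_restrict_hyperplane {n : Space d} (hn : ‖n‖ = 1) (s : ℝ) :
    SFinite ((μHE[d - 1] : Measure (Space d)).restrict {x | inner ℝ n x = s}) := by
  rw [← (measurePreserving_coe_add_smul hn s).map_eq]
  infer_instance

/-- Orthogonal coordinates with respect to a hyperplane: adding multiples of the unit normal to
the points of the hyperplane parametrizes the space in a measure preserving way. -/
theorem measurePreserving_add_smul_normal {n : Space d} (hn : ‖n‖ = 1) (s : ℝ) :
    MeasurePreserving (fun q : Space d × ℝ => q.1 + q.2 • n)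
      (((μHE[d - 1] : Measure (Space d)).restrict {x | inner ℝ n x = s}).prod volume) volume := by
  have hn0 : n ≠ 0 := by
    rintro rfl
    simp at hn
  have hsf := sFinite_restrict_hyperplane hn s
  set L : Submodule ℝ (Space d) := Submodule.span ℝ {n} with hL
  have h1 := measurePreserving_coe_add_smul hn s
  have h2 : MeasurePreserving (fun t : ℝ => t • (⟨n, Submodule.mem_span_singleton_self n⟩ : L))
      volume volume := by
    refine ⟨by fun_prop, ?_⟩
    rw [volume_eq_of_finrank_eq_one (finrank_span_singleton hn0 : Module.finrank ℝ L = 1)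
      (v := ⟨n, Submodule.mem_span_singleton_self n⟩) (by simpa using hn0)]
    have h3 : ‖(⟨n, Submodule.mem_span_singleton_self n⟩ : L)‖ₑ = 1 := by
      rw [← ofReal_norm]
      simp [hn]
    rw [h3, one_smul]
  -- The volume is the product of those of the normal line and of its orthogonal complement; the
  -- origin s • n places the complement on the hyperplane.
  have h3 := (L.measurePreserving_measurableEquivProd (P := Space d) (s • n)).symm
  rw [InnerProductSpace.euclideanHausdorffMeasure_eq_volume] at h3
  have h4 := h3.comp ((h2.prod (MeasurePreserving.id volume)).comp
    (Measure.measurePreserving_swap (μ := (volume : Measure Lᗮ)) (ν := (volume : Measure ℝ))))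
  have h5 := h1.prod (MeasurePreserving.id (volume : Measure ℝ))
  have hm : Measurable (fun q : Space d × ℝ => q.1 + q.2 • n) := by fun_prop
  refine ⟨hm, ?_⟩
  rw [← h5.map_eq, Measure.map_map hm h5.measurable]
  convert! h4.map_eq using 2
  ext q
  simp
  ring

/-- The hyperplanes of `ℝ^d`. -/
def IsHyperplane (P : Set (Space d)) : Prop :=
  ∃ (n : Space d) (s : ℝ), ‖n‖ = 1 ∧ P = {x | inner ℝ n x = s}

theorem measurableSet_setOf_inner_eq (a : Space d) (s : ℝ) :
    MeasurableSet {x : Space d | inner ℝ a x = s} := by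
  apply IsClosed.measurableSet
  exact isClosed_eq (by fun_prop) (by fun_prop)

/-- In normal coordinates each normal line meets the set in at most one point, so Fubini applies. -/
theorem volume_setOf_inner_eq {a : Space d} (ha : a ≠ 0) (s : ℝ) :
    volume {x : Space d | inner ℝ a x = s} = 0 := by
  have hn : ‖(‖a‖⁻¹ • a)‖ = 1 := norm_smul_inv_norm (𝕜 := ℝ) ha
  have hna : ‖a‖ ≠ 0 := norm_ne_zero_iff.2 ha
  have hsf := sFinite_restrict_hyperplane hn (‖a‖⁻¹ * s)
  have h1 := measurePreserving_add_smul_normal hn (‖a‖⁻¹ * s)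
  rw [← h1.measure_preimage (measurableSet_setOf_inner_eq a s).nullMeasurableSet,
    Measure.measure_prod_null (h1.measurable (measurableSet_setOf_inner_eq a s))]
  refine Filter.Eventually.of_forall fun y => ?_
  refine measure_mono_null (t := {(s - inner ℝ a y) / ‖a‖}) ?_ (by simp)
  intro t ht
  simp only [mem_preimage, mem_ofPred_eq, inner_add_right, inner_smul_right,
    real_inner_self_eq_norm_sq] at ht
  rw [mem_singleton_iff, eq_div_iff hna, ← ht]
  field_simp
  ring

theorem IsHyperplane.measurableSet {P : Set (Space d)} (hP : IsHyperplane P) :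
    MeasurableSet P := by
  obtain ⟨n, s, -, rfl⟩ := hP
  exact measurableSet_setOf_inner_eq n s

/-- Thickening the piece by a unit interval in the normal direction produces a subset of a ball, and
the volume of the thickening is the surface measure. -/
theorem IsHyperplane.measure_inter_lt_top {P B : Set (Space d)} (hP : IsHyperplane P)
    (hB : Bornology.IsBounded B) : (μHE[d - 1] : Measure (Space d)) (P ∩ B) < ⊤ := by
  obtain ⟨n, s, hn, rfl⟩ := hP
  have hsf := sFinite_restrict_hyperplane hn s
  obtain ⟨R, hR⟩ := hB.subset_closedBall 0
  have h1 := measurePreserving_add_smul_normal hn s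
  have h2 : ((μHE[d - 1] : Measure (Space d)).restrict {x | inner ℝ n x = s}).prod volume
      (B ×ˢ Icc (0 : ℝ) 1) < ⊤ := by
    refine lt_of_le_of_lt ?_ (measure_closedBall_lt_top (μ := (volume : Measure (Space d)))
      (x := 0) (r := R + 1))
    rw [← h1.measure_preimage measurableSet_closedBall.nullMeasurableSet]
    refine measure_mono ?_
    rintro ⟨y, t⟩ ⟨hy, ht⟩
    have h3 := hR hy
    simp only [mem_closedBall_zero_iff, mem_preimage] at h3 ⊢
    refine (norm_add_le _ _).trans (add_le_add h3 ?_)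
    rw [norm_smul, hn, mul_one, Real.norm_eq_abs, abs_of_nonneg ht.1]
    exact ht.2
  rw [Measure.prod_prod, Real.volume_Icc] at h2
  rw [inter_comm]
  refine lt_of_le_of_lt (Measure.le_restrict_apply _ _) ?_
  simpa using h2

/-- Parallel distinct hyperplanes are disjoint. Otherwise the intersection times the normal line
lies in a hyperplane whose normal is the part of m orthogonal to n. That set is null while the line
has infinite length, so the first factor is null. -/
theorem IsHyperplane.measure_inter_eq_zero {P Q : Set (Space d)} (hP : IsHyperplane P)
    (hQ : IsHyperplane Q) (h : P ≠ Q) : (μHE[d - 1] : Measure (Space d)) (P ∩ Q) = 0 := by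
  obtain ⟨n, s, hn, rfl⟩ := hP
  obtain ⟨m, r, hm, rfl⟩ := hQ
  have hsf := sFinite_restrict_hyperplane hn s
  have h1 := measurePreserving_add_smul_normal hn s
  by_cases h0 : m - (inner ℝ n m : ℝ) • n = 0
  · rw [sub_eq_zero] at h0
    have hk : (inner ℝ n m : ℝ) ≠ 0 := by
      intro hk
      rw [hk, zero_smul] at h0
      simp [h0] at hm
    suffices {x : Space d | inner ℝ n x = s} ∩ {x | inner ℝ m x = r} = ∅ by simp [this]
    by_contra hne
    obtain ⟨x, hx1, hx2⟩ := nonempty_iff_ne_empty.2 hne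
    apply h
    simp only [mem_ofPred_eq] at hx1 hx2
    rw [h0, inner_smul_left, hx1] at hx2
    ext y
    simp only [mem_ofPred_eq]
    rw [h0, inner_smul_left, ← hx2]
    simp only [conj_trivial]
    exact ⟨fun hy => by rw [hy], fun hy => mul_left_cancel₀ hk hy⟩
  · have h2 := volume_setOf_inner_eq h0 (r - inner ℝ n m * s)
    rw [← h1.measure_preimage (measurableSet_setOf_inner_eq _ _).nullMeasurableSet] at h2
    have h3 : ((μHE[d - 1] : Measure (Space d)).restrict {x | inner ℝ n x = s}).prod volume
        (({x | inner ℝ n x = s} ∩ {x | inner ℝ m x = r}) ×ˢ (univ : Set ℝ)) = 0 := by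
      refine measure_mono_null ?_ h2
      rintro ⟨y, t⟩ ⟨⟨hy1, hy2⟩, -⟩
      simp only [mem_ofPred_eq] at hy1 hy2
      simp only [mem_preimage, mem_ofPred_eq, inner_add_right, inner_sub_left, inner_smul_left,
        inner_smul_right, hy1, hy2, conj_trivial, real_inner_self_eq_norm_sq, hn,
        real_inner_comm n m]
      ring
    rw [Measure.prod_prod, Real.volume_univ] at h3
    have h4 := (mul_eq_zero.1 h3).resolve_right (by simp)
    rwa [Measure.restrict_apply ((measurableSet_setOf_inner_eq _ _).inter
      (measurableSet_setOf_inner_eq _ _)), inter_comm, ← inter_assoc, inter_self] at h4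

/-- Oblique coordinates with respect to a hyperplane. -/
theorem measurePreserving_add_smul {n v : Space d} (hn : ‖n‖ = 1) (s : ℝ)
    (hv : inner ℝ n v ≠ 0) :
    MeasurePreserving (fun q : Space d × ℝ => q.1 + q.2 • v)
      (ENNReal.ofReal |inner ℝ n v| •
        ((μHE[d - 1] : Measure (Space d)).restrict {x | inner ℝ n x = s}).prod volume) volume := by
  have hsf := sFinite_restrict_hyperplane hn s
  set c : ℝ := inner ℝ n v with hc
  set μ := (μHE[d - 1] : Measure (Space d)).restrict {x | inner ℝ n x = s} with hμ
  have h1 := measurePreserving_add_smul_normal hn s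
  have h2 : MeasurePreserving (fun t : ℝ => c * t) (ENNReal.ofReal |c| • volume) volume :=
    ⟨by fun_prop, by rw [Measure.map_smul, Real.smul_map_volume_mul_left hv]⟩
  -- A displacement t • v is a displacement c t along n together with a translation by t • (v - c •
  -- n) inside the hyperplane, which preserves the surface measure: a skew product with Jacobian
  -- |c|.
  have h3 : MeasurePreserving (fun q : ℝ × Space d => (c * q.1, q.2 + q.1 • (v - c • n)))
      ((ENNReal.ofReal |c| • volume).prod μ) (volume.prod μ) := by
    refine h2.skew_product (g := fun t y => y + t • (v - c • n)) (by fun_prop) ?_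
    refine Filter.Eventually.of_forall fun t => ?_
    have h4 := (measurePreserving_add_right (μHE[d - 1] : Measure (Space d))
      (t • (v - c • n))).restrict_preimage (measurableSet_setOf_inner_eq n s)
    convert! h4.map_eq using 3
    ext y
    simp [inner_add_right, inner_sub_right, inner_smul_right, hn, ← hc]
  have h5 := h1.comp ((Measure.measurePreserving_swap (μ := volume) (ν := μ)).comp
    (h3.comp (Measure.measurePreserving_swap (μ := μ) (ν := ENNReal.ofReal |c| • volume))))
  convert! h5 using 1
  · ext q
    simp
    ring
  · rw [Measure.prod_smul_right]
end TrefftzDG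

/-! ### Outward normals and flat boundary points -/

namespace TrefftzDG

variable {d : ℕ}

theorem IsOutwardNormal.mem_frontier {K : Set (Space d)} {x ν : Space d}
    (h : IsOutwardNormal K x ν) : x ∈ frontier K := by
  obtain ⟨hν, h⟩ := h
  have hx : x ∉ K := fun hx => by simpa using h.self_of_nhds.1 hx
  refine ⟨?_, fun hi => hx (interior_subset hi)⟩
  have hlim : Filter.Tendsto (fun t : ℝ => x - t • ν) (𝓝[>] 0) (𝓝 x) := by
    have : Filter.Tendsto (fun t : ℝ => x - t • ν) (𝓝 0) (𝓝 (x - (0 : ℝ) • ν)) := by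
      apply Continuous.tendsto
      fun_prop
    rw [zero_smul, sub_zero] at this
    exact this.mono_left nhdsWithin_le_nhds
  refine mem_closure_of_tendsto hlim ?_
  filter_upwards [hlim.eventually h, self_mem_nhdsWithin] with t ht ht0
  refine ht.2 ?_
  simpa [inner_smul_left, hν] using ht0

/-- A small step from x in the direction ν - ν' leaves one half-space and enters the other unless
the two unit vectors have inner product one. -/
theorem IsOutwardNormal.unique {K : Set (Space d)} {x ν ν' : Space d}
    (h : IsOutwardNormal K x ν) (h' : IsOutwardNormal K x ν') : ν = ν' := by
  obtain ⟨hν, h⟩ := h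
  obtain ⟨hν', h'⟩ := h'
  have hlim : Filter.Tendsto (fun t : ℝ => x + t • (ν - ν')) (𝓝[>] 0) (𝓝 x) := by
    have : Filter.Tendsto (fun t : ℝ => x + t • (ν - ν')) (𝓝 0) (𝓝 (x + (0 : ℝ) • (ν - ν'))) := by
      apply Continuous.tendsto
      fun_prop
    rw [zero_smul, add_zero] at this
    exact this.mono_left nhdsWithin_le_nhds
  obtain ⟨t, ht, ht', ht0⟩ := ((hlim.eventually h).and ((hlim.eventually h').and
    self_mem_nhdsWithin)).exists
  rw [ht] at ht'
  simp only [add_sub_cancel_left, inner_smul_left, inner_sub_left, real_inner_self_eq_norm_sq,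
    hν, hν', conj_trivial, real_inner_comm ν ν'] at ht'
  have ht0 : (0 : ℝ) < t := ht0
  rw [← inner_eq_one_iff_of_norm_eq_one (𝕜 := ℝ) hν hν']
  have h1 : (inner ℝ ν ν' : ℝ) ≤ 1 := by
    have := real_inner_le_norm ν ν'
    rwa [hν, hν', mul_one] at this
  by_contra hne
  have h2 : (inner ℝ ν ν' : ℝ) < 1 := lt_of_le_of_ne h1 hne
  have h3 : t * (inner ℝ ν ν' - 1 ^ 2) < 0 := by
    apply mul_neg_of_pos_of_neg ht0
    linarith
  have := ht'.2 h3
  nlinarith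

theorem IsOutwardNormal.outwardNormal_eq {K : Set (Space d)} {x ν : Space d}
    (h : IsOutwardNormal K x ν) : outwardNormal K x = ν := by
  have hex : ∃ ν, IsOutwardNormal K x ν := ⟨ν, h⟩
  rw [outwardNormal, dif_pos hex]
  exact hex.choose_spec.unique h

theorem outwardNormal_eq_zero {K : Set (Space d)} {x : Space d} (h : x ∉ frontier K) :
    outwardNormal K x = 0 := by
  rw [outwardNormal, dif_neg]
  rintro ⟨ν, hν⟩
  exact h hν.mem_frontier

theorem norm_outwardNormal_le (K : Set (Space d)) (x : Space d) : ‖outwardNormal K x‖ ≤ 1 := by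
  rw [outwardNormal]
  split_ifs with h
  · exact h.choose_spec.1.le
  · simp

/-- Near `x`, the boundary of `K` lies on the hyperplane through `x` with unit normal `n`. -/
def FlatFrontierAt (K : Set (Space d)) (x n : Space d) : Prop :=
  ‖n‖ = 1 ∧ ∃ r > 0, ∀ y ∈ frontier K, y ∈ Metric.ball x r → inner ℝ (y - x) n = 0

/-- A connected set can pass from an open set to its complement only through the frontier. Applied
to half balls and to segments. -/
theorem IsPreconnected.subset_or_disjoint_of_disjoint_frontier {X : Type*} [TopologicalSpace X]
    {U K : Set X} (hU : IsPreconnected U) (hK : IsOpen K) (h : Disjoint U (frontier K)) :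
    U ⊆ K ∨ Disjoint U K := by
  by_cases hne : (U ∩ K).Nonempty
  · left
    refine hU.subset_of_closure_inter_subset hK hne ?_
    rintro y ⟨hy, hyU⟩
    by_contra hyK
    exact disjoint_left.1 h hyU ⟨hy, by rwa [hK.interior_eq]⟩
  · right
    rwa [disjoint_iff_inter_eq_empty, ← not_nonempty_iff_eq_empty]

/-- Near a point where its boundary is flat, a regular open set is everything, nothing, or one of
the two half-spaces. -/
theorem FlatFrontierAt.cases {K : Set (Space d)} {x n : Space d} (hK : IsOpen K)
    (hreg : interior (closure K) = K) (h : FlatFrontierAt K x n) :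
    (∀ᶠ y in 𝓝 x, y ∈ K) ∨ (∀ᶠ y in 𝓝 x, y ∉ K) ∨ IsOutwardNormal K x n ∨
      IsOutwardNormal K x (-n) := by
  obtain ⟨hn, r, hr, hfr⟩ := h
  have hball : Metric.ball x r ∈ 𝓝 x := Metric.ball_mem_nhds x hr
  -- the two half balls
  have hhalf : ∀ m : Space d, m = n ∨ m = -n →
      (∀ y ∈ Metric.ball x r, inner ℝ (y - x) m < 0 → y ∈ K) ∨
      (∀ y ∈ Metric.ball x r, inner ℝ (y - x) m < 0 → y ∉ K) := by
    intro m hm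
    have hconv : Convex ℝ (Metric.ball x r ∩ {y | inner ℝ m y < inner ℝ m x}) :=
      (convex_ball x r).inter (convex_halfSpace_lt
        (IsLinearMap.mk (fun a b => inner_add_right m a b) fun c a => inner_smul_right m a c) _)
    have hiff : ∀ y, inner ℝ (y - x) m < 0 ↔ inner ℝ m y < inner ℝ m x := by
      intro y
      rw [inner_sub_left, real_inner_comm, real_inner_comm m x, sub_neg]
    have hdisj : Disjoint (Metric.ball x r ∩ {y | inner ℝ m y < inner ℝ m x}) (frontier K) := by
      rw [disjoint_left]
      rintro y ⟨hy, hym⟩ hyK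
      have h0 := hfr y hyK hy
      have h1 := (hiff y).2 hym
      rcases hm with rfl | rfl
      · exact h1.ne h0
      · rw [inner_neg_right, h0] at h1
        simp at h1
    rcases IsPreconnected.subset_or_disjoint_of_disjoint_frontier hconv.isPreconnected hK hdisj
      with h1 | h1
    · exact Or.inl fun y hy hym => h1 ⟨hy, (hiff y).1 hym⟩
    · exact Or.inr fun y hy hym => disjoint_left.1 h1 ⟨hy, (hiff y).1 hym⟩
  -- the hyperplane is approached from each of the half balls
  have happr : ∀ m : Space d, m = n ∨ m = -n → ∀ y ∈ Metric.ball x r, inner ℝ (y - x) m = 0 →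
      ∃ᶠ z in 𝓝 y, z ∈ Metric.ball x r ∧ inner ℝ (z - x) m < 0 := by
    intro m hm y hy hym
    have hm1 : ‖m‖ = 1 := by rcases hm with rfl | rfl <;> simp [hn]
    have hlim : Filter.Tendsto (fun t : ℝ => y - t • m) (𝓝[>] 0) (𝓝 y) := by
      have : Filter.Tendsto (fun t : ℝ => y - t • m) (𝓝 0) (𝓝 (y - (0 : ℝ) • m)) := by
        apply Continuous.tendsto
        fun_prop
      rw [zero_smul, sub_zero] at this
      exact this.mono_left nhdsWithin_le_nhds
    refine hlim.frequently (Filter.Eventually.frequently ?_)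
    filter_upwards [hlim.eventually (Metric.isOpen_ball.mem_nhds hy), self_mem_nhdsWithin]
      with t ht ht0
    refine ⟨ht, ?_⟩
    have ht0 : (0 : ℝ) < t := ht0
    rw [sub_right_comm, inner_sub_left, hym, inner_smul_left, real_inner_self_eq_norm_sq, hm1]
    simpa using ht0
  have hone : ∀ m : Space d, m = n ∨ m = -n →
      (∀ y ∈ Metric.ball x r, inner ℝ (y - x) m < 0 → y ∈ K) →
      (∀ y ∈ Metric.ball x r, inner ℝ (y - x) (-m) < 0 → y ∉ K) → IsOutwardNormal K x m := by
    intro m hm h1 h2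
    refine ⟨by rcases hm with rfl | rfl <;> simp [hn], ?_⟩
    filter_upwards [hball] with y hy
    refine ⟨fun hyK => ?_, h1 y hy⟩
    by_contra hge
    rcases (not_lt.1 hge).lt_or_eq with hgt | heq
    · exact h2 y hy (by rw [inner_neg_right]; linarith) hyK
    · obtain ⟨z, hz, hzK⟩ := ((happr (-m) (by rcases hm with rfl | rfl <;> simp) y hy
        (by rw [inner_neg_right, ← heq, neg_zero])).and_eventually (hK.mem_nhds hyK)).exists
      exact h2 z hz.1 hz.2 hzK
  rcases hhalf n (Or.inl rfl) with h1 | h1 <;> rcases hhalf (-n) (Or.inr rfl) with h2 | h2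
  · left
    -- Both half balls lie in K; a slit along the hyperplane is excluded because K is the interior
    -- of its closure.
    have hsub : Metric.ball x r ⊆ closure K := by
      intro y hy
      rcases lt_trichotomy (inner ℝ (y - x) n) 0 with h3 | h3 | h3
      · exact subset_closure (h1 y hy h3)
      · rw [mem_closure_iff_frequently]
        exact (happr n (Or.inl rfl) y hy h3).mono fun z hz => h1 z hz.1 hz.2
      · exact subset_closure (h2 y hy (by rw [inner_neg_right]; linarith))
    filter_upwards [hball] with y hy
    rw [← hreg]
    exact interior_maximal hsub Metric.isOpen_ball hy
  · exact Or.inr (Or.inr (Or.inl (hone n (Or.inl rfl) h1 h2)))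
  · exact Or.inr (Or.inr (Or.inr (hone (-n) (Or.inr rfl) h2 (by simpa using h1))))
  · right; left
    filter_upwards [hball] with y hy hyK
    rcases lt_trichotomy (inner ℝ (y - x) n) 0 with h3 | h3 | h3
    · exact h1 y hy h3 hyK
    · obtain ⟨z, hz, hzK⟩ := ((happr n (Or.inl rfl) y hy h3).and_eventually
        (hK.mem_nhds hyK)).exists
      exact h1 z hz.1 hz.2 hzK
    · exact h2 y hy (by rw [inner_neg_right]; linarith) hyK

/-- The boundary of `K` lies on the union of the hyperplanes of the family `F`. -/
structure CoversFrontier (F : Finset (Set (Space d))) (K : Set (Space d)) : Prop where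
  isHyperplane : ∀ P ∈ F, IsHyperplane P
  subset : frontier K ⊆ ⋃ P ∈ F, P

theorem IsPolytope.exists_coversFrontier {K : Set (Space d)} (hK : IsPolytope K) :
    ∃ F, CoversFrontier F K := by
  classical
  obtain ⟨H, hH0, hH⟩ := hK.hyperplanes
  refine ⟨H.image fun h => {x | inner ℝ h.1 x = h.2}, ?_, ?_⟩
  · intro P hP
    obtain ⟨h, hh, rfl⟩ := Finset.mem_image.1 hP
    have h0 : ‖h.1‖ ≠ 0 := norm_ne_zero_iff.2 (hH0 h hh)
    refine ⟨‖h.1‖⁻¹ • h.1, ‖h.1‖⁻¹ * h.2, norm_smul_inv_norm (𝕜 := ℝ) (hH0 h hh), ?_⟩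
    ext x
    simp only [mem_ofPred_eq, inner_smul_left, conj_trivial]
    exact ⟨fun hx => by rw [hx], fun hx => mul_left_cancel₀ (inv_ne_zero h0) hx⟩
  · intro x hx
    obtain ⟨h, hh, hhx⟩ := hH x hx
    simp only [mem_iUnion]
    exact ⟨_, Finset.mem_image_of_mem _ hh, hhx⟩

/-- A point of exactly one hyperplane of a finite family, with normal `n`. -/
def IsRegularPoint (F : Finset (Set (Space d))) (x n : Space d) : Prop :=
  ‖n‖ = 1 ∧ ∃ P ∈ F, P = {y | inner ℝ n y = inner ℝ n x} ∧ ∀ Q ∈ F, Q ≠ P → x ∉ Q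

theorem IsHyperplane.isClosed {P : Set (Space d)} (hP : IsHyperplane P) : IsClosed P := by
  obtain ⟨n, s, -, rfl⟩ := hP
  exact isClosed_eq (by fun_prop) (by fun_prop)

/-- The other hyperplanes are closed and miss x, hence miss a small ball, where the frontier can
only lie on the remaining one. -/
theorem IsRegularPoint.flatFrontierAt {F : Finset (Set (Space d))} {x n : Space d}
    (hx : IsRegularPoint F x n) {K : Set (Space d)} (hK : CoversFrontier F K) :
    FlatFrontierAt K x n := by
  obtain ⟨hn, P, hP, hPx, hQ⟩ := hx
  refine ⟨hn, ?_⟩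
  have hev : ∀ᶠ y in 𝓝 x, ∀ Q ∈ F, Q ≠ P → y ∉ Q := by
    rw [Filter.eventually_all_finset]
    intro Q hQF
    by_cases hQP : Q = P
    · exact Filter.Eventually.of_forall fun y h => absurd hQP h
    · filter_upwards [(hK.isHyperplane Q hQF).isClosed.isOpen_compl.mem_nhds (hQ Q hQF hQP)]
        with y hy _
      exact hy
  obtain ⟨r, hr, hr'⟩ := Metric.eventually_nhds_iff_ball.1 hev
  refine ⟨r, hr, fun y hy hyr => ?_⟩
  obtain ⟨Q, hQF, hyQ⟩ := mem_iUnion₂.1 (hK.subset hy)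
  by_cases hQP : Q = P
  · rw [hQP, hPx] at hyQ
    have hyQ : inner ℝ n y = inner ℝ n x := hyQ
    rw [real_inner_comm, inner_sub_right, hyQ, sub_self]
  · exact absurd hyQ (hr' y hyr Q hQF hQP)

/-- Distinct hyperplanes meet in a set of surface measure zero, so points where the normal is
ambiguous are negligible. -/
theorem ae_notMem_of_ne {F : Finset (Set (Space d))} (hF : ∀ P ∈ F, IsHyperplane P)
    {P : Set (Space d)} (hP : IsHyperplane P) :
    ∀ᵐ x ∂(μHE[d - 1] : Measure (Space d)).restrict P, ∀ Q ∈ F, Q ≠ P → x ∉ Q := by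
  rw [Filter.eventually_all_finset]
  intro Q hQF
  rw [Filter.eventually_imp_distrib_left]
  intro hQP
  rw [ae_iff]
  simp only [not_not]
  change (μHE[d - 1] : Measure (Space d)).restrict P Q = 0
  rw [Measure.restrict_apply (hF Q hQF).measurableSet]
  exact (hF Q hQF).measure_inter_eq_zero hP hQP

theorem ae_isRegularPoint {F : Finset (Set (Space d))} (hF : ∀ P ∈ F, IsHyperplane P) :
    ∀ᵐ x ∂(μHE[d - 1] : Measure (Space d)).restrict (⋃ P ∈ F, P), ∃ n, IsRegularPoint F x n := by
  rw [ae_restrict_biUnion_finset_iff]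
  intro P hP
  filter_upwards [ae_notMem_of_ne hF (hF P hP), ae_restrict_mem (hF P hP).measurableSet]
    with x hx hxP
  obtain ⟨n, s, hn, hPn⟩ := hF P hP
  refine ⟨n, hn, P, hP, ?_, hx⟩
  have hxP' := hxP
  rw [hPn] at hxP'
  rw [hPn, show inner ℝ n x = s from hxP']

theorem IsPolytope.measure_frontier_lt_top {K : Set (Space d)} (hK : IsPolytope K) :
    (μHE[d - 1] : Measure (Space d)) (frontier K) < ⊤ := by
  obtain ⟨F, hF, hKF⟩ := hK.exists_coversFrontier
  have hb : Bornology.IsBounded (frontier K) :=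
    hK.isBounded.closure.subset frontier_subset_closure
  have hsub : frontier K ⊆ ⋃ P ∈ F, P ∩ frontier K := by
    intro x hx
    obtain ⟨P, hP, hxP⟩ := mem_iUnion₂.1 (hKF hx)
    exact mem_iUnion₂.2 ⟨P, hP, hxP, hx⟩
  refine (measure_mono hsub).trans_lt ?_
  refine (measure_biUnion_finset_le _ _).trans_lt ?_
  exact ENNReal.sum_lt_top.2 fun P hP => (hF P hP).measure_inter_lt_top hb

/-- At a regular point, the outward normal of a polytope is described by the values of its
indicator function on the normal line. -/
theorem FlatFrontierAt.eventually_indicator {K : Set (Space d)} {x n : Space d} (hK : IsOpen K)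
    (hreg : interior (closure K) = K) (h : FlatFrontierAt K x n) {v : Space d}
    (hv : inner ℝ n v ≠ 0) {a b : ℝ} (ha : a < 0) (hb : 0 < b) :
    ∀ᶠ ε : ℝ in 𝓝[>] 0,
      K.indicator (fun _ => (1 : ℝ)) (x + (ε * a) • v) - K.indicator (fun _ => 1) (x + (ε * b) • v)
        = SignType.sign (inner ℝ (outwardNormal K x) v : ℝ) := by
  have hlim : ∀ c : ℝ, Filter.Tendsto (fun ε : ℝ => x + (ε * c) • v) (𝓝[>] 0) (𝓝 x) := by
    intro c
    have : Filter.Tendsto (fun ε : ℝ => x + (ε * c) • v) (𝓝 0) (𝓝 (x + ((0 : ℝ) * c) • v)) := by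
      apply Continuous.tendsto
      fun_prop
    rw [zero_mul, zero_smul, add_zero] at this
    exact this.mono_left nhdsWithin_le_nhds
  have hhalf : ∀ ν : Space d, inner ℝ ν v ≠ 0 → IsOutwardNormal K x ν → ∀ᶠ ε : ℝ in 𝓝[>] 0,
      K.indicator (fun _ => (1 : ℝ)) (x + (ε * a) • v) - K.indicator (fun _ => 1) (x + (ε * b) • v)
        = SignType.sign (inner ℝ (outwardNormal K x) v : ℝ) := by
    intro ν hνv hν
    filter_upwards [(hlim a).eventually hν.2, (hlim b).eventually hν.2, self_mem_nhdsWithin]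
      with ε h1 h2 hε
    have hε : 0 < ε := hε
    rw [hν.outwardNormal_eq]
    simp only [add_sub_cancel_left, inner_smul_left, conj_trivial, real_inner_comm ν v] at h1 h2
    rcases lt_or_gt_of_ne hνv with h3 | h3
    · have hA : x + (ε * a) • v ∉ K := by
        rw [h1, not_lt]
        exact (mul_pos_of_neg_of_neg (mul_neg_of_pos_of_neg hε ha) h3).le
      have hB : x + (ε * b) • v ∈ K := h2.2 (mul_neg_of_pos_of_neg (mul_pos hε hb) h3)
      simp [hA, hB, h3]
    · have hA : x + (ε * a) • v ∈ K := h1.2 (mul_neg_of_neg_of_pos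
        (mul_neg_of_pos_of_neg hε ha) h3)
      have hB : x + (ε * b) • v ∉ K := by
        rw [h2, not_lt]
        exact (mul_pos (mul_pos hε hb) h3).le
      simp [hA, hB, h3]
  rcases h.cases hK hreg with h1 | h1 | h1 | h1
  · rw [outwardNormal_eq_zero]
    · filter_upwards [(hlim a).eventually h1, (hlim b).eventually h1] with ε h2 h3
      simp [h2, h3]
    · exact fun hx => hx.2 (mem_interior_iff_mem_nhds.2 h1)
  · rw [outwardNormal_eq_zero]
    · filter_upwards [(hlim a).eventually h1, (hlim b).eventually h1] with ε h2 h3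
      simp [h2, h3]
    · exact fun hx => mem_closure_iff_frequently.1 hx.1 h1
  · exact hhalf n hv h1
  · exact hhalf (-n) (by simpa using hv) h1

theorem FlatFrontierAt.outwardNormal_cases {K : Set (Space d)} {x n : Space d} (hK : IsOpen K)
    (hreg : interior (closure K) = K) (h : FlatFrontierAt K x n) :
    outwardNormal K x = 0 ∨ outwardNormal K x = n ∨ outwardNormal K x = -n := by
  rcases h.cases hK hreg with h1 | h1 | h1 | h1
  · exact Or.inl (outwardNormal_eq_zero fun hx => hx.2 (mem_interior_iff_mem_nhds.2 h1))
  · exact Or.inl (outwardNormal_eq_zero fun hx => mem_closure_iff_frequently.1 hx.1 h1)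
  · exact Or.inr (Or.inl h1.outwardNormal_eq)
  · exact Or.inr (Or.inr h1.outwardNormal_eq)

/-- The normal is defined by choice, so measurability is not visible from the definition. Almost
everywhere on P it is the limit of n times the difference of the indicator of K on the two sides of
P, which is measurable. -/
theorem CoversFrontier.aestronglyMeasurable_outwardNormal {F : Finset (Set (Space d))}
    {K : Set (Space d)} (hF : CoversFrontier F K) (hK : IsPolytope K) {P : Set (Space d)}
    (hP : P ∈ F) : AEStronglyMeasurable (outwardNormal K)
      ((μHE[d - 1] : Measure (Space d)).restrict P) := by
  obtain ⟨n, s, hn, hPn⟩ := hF.isHyperplane P hP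
  refine aestronglyMeasurable_of_tendsto_ae (u := 𝓝[>] (0 : ℝ))
    (f := fun ε x => (K.indicator (fun _ => (1 : ℝ)) (x + (ε * (-1)) • n)
      - K.indicator (fun _ => 1) (x + (ε * 1) • n)) • n) (fun ε => ?_) ?_
  · apply Measurable.aestronglyMeasurable
    have hm : Measurable (K.indicator (fun _ => (1 : ℝ))) :=
      measurable_const.indicator hK.isOpen.measurableSet
    exact ((hm.comp (by fun_prop)).sub (hm.comp (by fun_prop))).smul_const n
  · filter_upwards [ae_notMem_of_ne hF.isHyperplane (hF.isHyperplane P hP),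
      ae_restrict_mem (hF.isHyperplane P hP).measurableSet] with x hx hxP
    have hxs : inner ℝ n x = s := by
      rw [hPn] at hxP
      exact hxP
    have hflat : FlatFrontierAt K x n :=
      IsRegularPoint.flatFrontierAt ⟨hn, P, hP, by rw [hPn, hxs], hx⟩ hF
    have hnn : (inner ℝ n n : ℝ) = 1 := by simp [hn]
    refine tendsto_nhds_of_eventually_eq ?_
    filter_upwards [hflat.eventually_indicator hK.isOpen hK.regular (v := n) (by simp [hn])
      (neg_one_lt_zero) one_pos] with ε hε
    rw [hε]
    rcases hflat.outwardNormal_cases hK.isOpen hK.regular with h | h | h <;> rw [h] <;>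
      simp [hn]

theorem IsPolytope.aestronglyMeasurable_outwardNormal {K : Set (Space d)} (hK : IsPolytope K) :
    AEStronglyMeasurable (outwardNormal K)
      ((μHE[d - 1] : Measure (Space d)).restrict (frontier K)) := by
  obtain ⟨F, hF⟩ := hK.exists_coversFrontier
  refine AEStronglyMeasurable.mono_measure ?_ (Measure.restrict_mono hF.subset le_rfl)
  have hU : ⋃ P ∈ F, P = ⋃ P : F, (P : Set (Space d)) := by
    ext x
    simp
  rw [hU, aestronglyMeasurable_iUnion_iff]
  exact fun P => hF.aestronglyMeasurable_outwardNormal hK P.2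

end TrefftzDG

/-! ### Indicator differences and swept hyperplanes -/

namespace TrefftzDG

variable {d : ℕ}

/-- The points swept by `P` when it is translated by `t • v`, for `t` between `0` and `ε`. -/
def sweep (P : Set (Space d)) (v : Space d) (ε : ℝ) : Set (Space d) :=
  {x | ∃ t ∈ Icc 0 ε, x - t • v ∈ P}

open scoped Pointwise in
-- The sweep is closed, being the sum of a closed set and a compact segment.
theorem measurableSet_sweep {P : Set (Space d)} (hP : IsClosed P) (v : Space d) (ε : ℝ) :
    MeasurableSet (sweep P v ε) := by
  have h : sweep P v ε = P + (fun t : ℝ => t • v) '' Icc 0 ε := by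
    ext x
    simp only [sweep, mem_ofPred_eq, mem_add, mem_image, exists_exists_and_eq_and]
    constructor
    · rintro ⟨t, ht, hx⟩
      exact ⟨_, hx, t, ht, sub_add_cancel _ _⟩
    · rintro ⟨y, hy, t, ht, rfl⟩
      exact ⟨t, ht, by simpa using hy⟩
  rw [h]
  have hc : IsCompact ((fun t : ℝ => t • v) '' Icc 0 ε) :=
    isCompact_Icc.image (by fun_prop)
  exact (hP.add_right_of_isCompact hc).measurableSet

/-- The difference between the indicator functions of `K + ε • v` and `K`. -/
noncomputable def indicatorDiff (K : Set (Space d)) (v : Space d) (ε : ℝ) (x : Space d) : ℝ :=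
  K.indicator (fun _ => 1) (x - ε • v) - K.indicator (fun _ => 1) x

theorem measurable_indicatorDiff {K : Set (Space d)} (hK : IsOpen K) (v : Space d) (ε : ℝ) :
    Measurable (indicatorDiff K v ε) := by
  have hm : Measurable (K.indicator (fun _ => (1 : ℝ))) :=
    measurable_const.indicator hK.measurableSet
  exact (hm.comp (by fun_prop)).sub hm

theorem abs_indicatorDiff_le (K : Set (Space d)) (v : Space d) (ε : ℝ) (x : Space d) :
    |indicatorDiff K v ε x| ≤ 1 := by
  rw [indicatorDiff, abs_le]
  by_cases h1 : x - ε • v ∈ K <;> by_cases h2 : x ∈ K <;> simp [h1, h2]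

/-- The segment from x - ε • v to x then avoids the frontier, so both ends lie on the same side. -/
theorem CoversFrontier.indicatorDiff_eq_zero {F : Finset (Set (Space d))} {K : Set (Space d)}
    (hF : CoversFrontier F K) (hK : IsOpen K) {v x : Space d} {ε : ℝ}
    (h : ∀ P ∈ F, x ∉ sweep P v ε) (hε : 0 ≤ ε) : indicatorDiff K v ε x = 0 := by
  have hpre : IsPreconnected ((fun t : ℝ => x - t • v) '' Icc 0 ε) :=
    isPreconnected_Icc.image _ (by fun_prop)
  have hdisj : Disjoint ((fun t : ℝ => x - t • v) '' Icc 0 ε) (frontier K) := by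
    rw [disjoint_left]
    rintro _ ⟨t, ht, rfl⟩ hy
    obtain ⟨P, hP, hxP⟩ := mem_iUnion₂.1 (hF.subset hy)
    exact h P hP ⟨t, ht, hxP⟩
  have h0 : x ∈ (fun t : ℝ => x - t • v) '' Icc 0 ε := ⟨0, ⟨le_rfl, hε⟩, by simp⟩
  have h1 : x - ε • v ∈ (fun t : ℝ => x - t • v) '' Icc 0 ε := ⟨ε, ⟨hε, le_rfl⟩, rfl⟩
  rw [indicatorDiff]
  rcases IsPreconnected.subset_or_disjoint_of_disjoint_frontier hpre hK hdisj with h2 | h2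
  · simp [h2 h0, h2 h1]
  · simp [disjoint_left.1 h2 h0, disjoint_left.1 h2 h1]

/-- The number of hyperplanes of the family which sweep over `x`. -/
noncomputable def sweepCount (F : Finset (Set (Space d))) (v : Space d) (ε : ℝ) (x : Space d) :
    ℝ :=
  ∑ P ∈ F, (sweep P v ε).indicator (fun _ => 1) x

theorem one_le_sweepCount {F : Finset (Set (Space d))} {v x : Space d} {ε : ℝ}
    {P : Set (Space d)} (hP : P ∈ F) (hx : x ∈ sweep P v ε) : 1 ≤ sweepCount F v ε x := by
  have h1 : (sweep P v ε).indicator (fun _ => (1 : ℝ)) x = 1 := by simp [hx]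
  rw [← h1]
  exact Finset.single_le_sum (f := fun Q => (sweep Q v ε).indicator (fun _ => (1 : ℝ)) x)
    (fun Q _ => indicator_nonneg (fun _ _ => zero_le_one) _) hP

theorem measurable_sweepCount {F : Finset (Set (Space d))} (hF : ∀ P ∈ F, IsHyperplane P)
    (v : Space d) (ε : ℝ) : Measurable (sweepCount F v ε) := by
  refine Finset.measurable_sum F fun P hP => ?_
  exact measurable_const.indicator (measurableSet_sweep (hF P hP).isClosed v ε)

/-- The share of the hyperplane `P` in `f * indicatorDiff K v ε`. -/
noncomputable def sweepShare (F : Finset (Set (Space d))) (K : Set (Space d)) (f : Space d → ℝ)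
    (v : Space d) (ε : ℝ) (P : Set (Space d)) (x : Space d) : ℝ :=
  (sweep P v ε).indicator (fun x => f x * indicatorDiff K v ε x / sweepCount F v ε x) x

/-- Points swept by several hyperplanes are divided equally among these, so nothing is counted
twice; at points swept by none, the indicator difference vanishes. -/
theorem CoversFrontier.sum_sweepShare {F : Finset (Set (Space d))} {K : Set (Space d)}
    (hF : CoversFrontier F K) (hK : IsOpen K) (f : Space d → ℝ) (v x : Space d) {ε : ℝ}
    (hε : 0 ≤ ε) : ∑ P ∈ F, sweepShare F K f v ε P x = f x * indicatorDiff K v ε x := by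
  have h1 : ∑ P ∈ F, sweepShare F K f v ε P x
      = sweepCount F v ε x * (f x * indicatorDiff K v ε x / sweepCount F v ε x) := by
    rw [sweepCount, Finset.sum_mul]
    refine Finset.sum_congr rfl fun P _ => ?_
    by_cases hx : x ∈ sweep P v ε <;> simp [sweepShare, hx, sweepCount]
  rw [h1]
  by_cases hx : ∀ P ∈ F, x ∉ sweep P v ε
  · rw [hF.indicatorDiff_eq_zero hK hx hε]
    simp
  · push Not at hx
    obtain ⟨P, hP, hxP⟩ := hx
    have := one_le_sweepCount hP hxP
    field_simp

/-- The bound does not depend on ε, as dominated convergence requires: the count is at least one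
wherever the share is not zero. -/
theorem abs_sweepShare_le {F : Finset (Set (Space d))} (K : Set (Space d)) (f : Space d → ℝ)
    (v : Space d) (ε : ℝ) {P : Set (Space d)} (hP : P ∈ F) (x : Space d) :
    |sweepShare F K f v ε P x| ≤ |f x| := by
  by_cases hx : x ∈ sweep P v ε
  · have h1 := one_le_sweepCount hP hx
    have h2 := abs_indicatorDiff_le K v ε x
    simp only [sweepShare, hx, indicator_of_mem, abs_div, abs_mul]
    rw [abs_of_nonneg (zero_le_one.trans h1), div_le_iff₀ (by linarith)]
    exact mul_le_mul_of_nonneg_left (h2.trans h1) (abs_nonneg _)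
  · simp [sweepShare, hx]

theorem measurable_sweepShare {F : Finset (Set (Space d))} (hF : ∀ P ∈ F, IsHyperplane P)
    {K : Set (Space d)} (hK : IsOpen K) {f : Space d → ℝ} (hf : Measurable f) (v : Space d)
    (ε : ℝ) {P : Set (Space d)} (hP : P ∈ F) : Measurable (sweepShare F K f v ε P) :=
  ((hf.mul (measurable_indicatorDiff hK v ε)).div (measurable_sweepCount hF v ε)).indicator
    (measurableSet_sweep (hF P hP).isClosed v ε)

/-- After rescaling the transversal coordinate by ε, the sweep becomes a slab 0 ≤ u ≤ 1 independent
of ε. -/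
theorem add_smul_mem_sweep_iff {n v y : Space d} {P : Set (Space d)}
    (hPy : P = {x | inner ℝ n x = inner ℝ n y}) (hv : inner ℝ n v ≠ 0) {ε : ℝ} (hε : 0 < ε)
    (u : ℝ) : y + u • (ε • v) ∈ sweep P v ε ↔ u ∈ Icc (0 : ℝ) 1 := by
  have h1 : ∀ t : ℝ, y + u • (ε • v) - t • v ∈ P ↔ t = u * ε := by
    intro t
    rw [hPy]
    simp only [mem_ofPred_eq, inner_sub_right, inner_add_right, inner_smul_right]
    constructor
    · intro h
      have : (u * ε - t) * inner ℝ n v = 0 := by linarith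
      have := (mul_eq_zero.1 this).resolve_right hv
      linarith
    · rintro rfl
      ring
  simp only [sweep, mem_ofPred_eq, h1, exists_eq_right, mem_Icc]
  rw [mul_nonneg_iff_of_pos_right hε, mul_le_iff_le_one_left hε]

/-- The rescaled share of a transversal hyperplane, in oblique coordinates, converges. -/
theorem tendsto_sweepShare {F : Finset (Set (Space d))} {K : Set (Space d)}
    (hF : CoversFrontier F K) (hK : IsPolytope K) {f : Space d → ℝ} (hf : Continuous f)
    {n v y : Space d} {P : Set (Space d)} (hn : ‖n‖ = 1) (hP : P ∈ F)
    (hPy : P = {x | inner ℝ n x = inner ℝ n y}) (hy : ∀ Q ∈ F, Q ≠ P → y ∉ Q)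
    (hv : inner ℝ n v ≠ 0) {u : ℝ} (hu0 : u ≠ 0) (hu1 : u ≠ 1) :
    Filter.Tendsto (fun ε => sweepShare F K f v ε P (y + u • (ε • v))) (𝓝[>] 0)
      (𝓝 ((f y * SignType.sign (inner ℝ (outwardNormal K y) v : ℝ)) *
        (Icc (0 : ℝ) 1).indicator (fun _ => 1) u)) := by
  have hmem : ∀ ε : ℝ, 0 < ε → (y + u • (ε • v) ∈ sweep P v ε ↔ u ∈ Icc (0 : ℝ) 1) :=
    fun ε hε => add_smul_mem_sweep_iff hPy hv hε u
  by_cases hu : u ∈ Icc (0 : ℝ) 1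
  swap
  · rw [indicator_of_notMem hu, mul_zero]
    refine tendsto_nhds_of_eventually_eq ?_
    filter_upwards [self_mem_nhdsWithin] with ε hε
    rw [sweepShare, indicator_of_notMem]
    rwa [hmem ε hε]
  -- With the endpoints excluded, y + uε v and its translate y + (u - 1)ε v lie strictly on opposite
  -- sides of P, so the indicator difference sees the normal.
  have hu0' : 0 < u := lt_of_le_of_ne hu.1 (Ne.symm hu0)
  have hu1' : u - 1 < 0 := sub_neg.2 (lt_of_le_of_ne hu.2 hu1)
  rw [indicator_of_mem hu, mul_one]
  have hflat : FlatFrontierAt K y n := IsRegularPoint.flatFrontierAt ⟨hn, P, hP, hPy, hy⟩ hF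
  have hind := hflat.eventually_indicator hK.isOpen hK.regular hv hu1' hu0'
  have hev : ∀ᶠ z in 𝓝 y, ∀ Q ∈ F, Q ≠ P → z ∉ Q := by
    rw [Filter.eventually_all_finset]
    intro Q hQF
    by_cases hQP : Q = P
    · exact Filter.Eventually.of_forall fun z h => absurd hQP h
    · filter_upwards [(hF.isHyperplane Q hQF).isClosed.isOpen_compl.mem_nhds (hy Q hQF hQP)]
        with z hz _
      exact hz
  obtain ⟨r, hr, hr'⟩ := Metric.eventually_nhds_iff_ball.1 hev
  have hsmall : ∀ᶠ ε : ℝ in 𝓝[>] 0, ε * ‖v‖ < r := by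
    have : Filter.Tendsto (fun ε : ℝ => ε * ‖v‖) (𝓝 0) (𝓝 (0 * ‖v‖)) := by
      apply Continuous.tendsto
      fun_prop
    rw [zero_mul] at this
    exact (this.mono_left nhdsWithin_le_nhds).eventually (Iio_mem_nhds hr)
  have hlim : Filter.Tendsto (fun ε : ℝ => f (y + u • (ε • v))) (𝓝[>] 0) (𝓝 (f y)) := by
    have : Filter.Tendsto (fun ε : ℝ => f (y + u • (ε • v))) (𝓝 0)
        (𝓝 (f (y + u • ((0 : ℝ) • v)))) := by
      apply Continuous.tendsto
      fun_prop
    rw [zero_smul, smul_zero, add_zero] at this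
    exact this.mono_left nhdsWithin_le_nhds
  refine (hlim.mul_const _).congr' ?_
  filter_upwards [hind, hsmall, self_mem_nhdsWithin] with ε h1 h2 hε
  have hε : 0 < ε := hε
  -- The sweeping segment stays within ε‖v‖ < r of y, where P is the only hyperplane of the family.
  have hcount : sweepCount F v ε (y + u • (ε • v)) = 1 := by
    rw [sweepCount, Finset.sum_eq_single P]
    · rw [indicator_of_mem ((hmem ε hε).2 hu)]
    · intro Q hQ hQP
      rw [indicator_of_notMem]
      rintro ⟨t, ht, htQ⟩
      refine hr' _ ?_ Q hQ hQP htQ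
      rw [Metric.mem_ball, dist_eq_norm, show y + u • (ε • v) - t • v - y = (u * ε - t) • v by
        rw [smul_smul, sub_smul]; abel, norm_smul]
      refine lt_of_le_of_lt (mul_le_mul_of_nonneg_right ?_ (norm_nonneg v)) h2
      rw [Real.norm_eq_abs, abs_le]
      have h3 : 0 ≤ u * ε := mul_nonneg hu.1 hε.le
      have h4 : u * ε ≤ ε := mul_le_of_le_one_left hε.le hu.2
      constructor <;> linarith [ht.1, ht.2]
    · exact fun h => absurd hP h
  rw [sweepShare, indicator_of_mem ((hmem ε hε).2 hu), hcount, div_one, ← h1, indicatorDiff]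
  congr 4
  · rw [smul_smul, mul_sub, mul_one, sub_smul, mul_comm u ε]
    abel
  · rw [smul_smul, mul_comm]

end TrefftzDG

/-! ### The divergence theorem on a polytope -/

namespace TrefftzDG

variable {d : ℕ}

/-- If v is parallel to P, the sweep is contained in P, which is null, and the normal component of v
vanishes. Otherwise substitute x = y + uε v: the Jacobian ε|n·v| absorbs ε⁻¹, and the rescaled share
converges to f times the sign of ν·v on 0 ≤ u ≤ 1. Since ν is 0, n or -n, the product of |n·v| with
this sign is ν·v. -/
theorem tendsto_integral_sweepShare {F : Finset (Set (Space d))} {K : Set (Space d)}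
    (hF : CoversFrontier F K) (hK : IsPolytope K) {f : Space d → ℝ} (hf : Continuous f)
    (hfc : HasCompactSupport f) (v : Space d) {P : Set (Space d)} (hP : P ∈ F) :
    Filter.Tendsto (fun ε => ε⁻¹ * ∫ x, sweepShare F K f v ε P x) (𝓝[>] 0)
      (𝓝 (∫ x in P, f x * inner ℝ (outwardNormal K x) v ∂(μHE[d - 1] : Measure (Space d)))) := by
  obtain ⟨n, s, hn, hPn⟩ := hF.isHyperplane P hP
  have hreg : ∀ᵐ y ∂(μHE[d - 1] : Measure (Space d)).restrict P,
      P = {x | inner ℝ n x = inner ℝ n y} ∧ ∀ Q ∈ F, Q ≠ P → y ∉ Q := by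
    filter_upwards [ae_notMem_of_ne hF.isHyperplane (hF.isHyperplane P hP),
      ae_restrict_mem (hF.isHyperplane P hP).measurableSet] with x hx hxP
    refine ⟨?_, hx⟩
    have hxP' := hxP
    rw [hPn] at hxP'
    rw [hPn, show inner ℝ n x = s from hxP']
  have hflat : ∀ᵐ y ∂(μHE[d - 1] : Measure (Space d)).restrict P, FlatFrontierAt K y n := by
    filter_upwards [hreg] with y hy
    exact IsRegularPoint.flatFrontierAt ⟨hn, P, hP, hy.1, hy.2⟩ hF
  by_cases hv : inner ℝ n v = 0
  · have h0 : ∀ ε : ℝ, ∫ x, sweepShare F K f v ε P x = 0 := by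
      intro ε
      refine integral_eq_zero_of_ae ?_
      have hnull : volume P = 0 := by
        rw [hPn]
        exact volume_setOf_inner_eq (by rintro rfl; simp at hn) s
      filter_upwards [measure_eq_zero_iff_ae_notMem.1 hnull] with x hx
      rw [sweepShare, indicator_of_notMem, Pi.zero_apply]
      rintro ⟨t, -, ht⟩
      apply hx
      rw [hPn] at ht ⊢
      simpa [inner_sub_right, inner_smul_right, hv] using ht
    have h1 : ∫ x in P, f x * inner ℝ (outwardNormal K x) v ∂(μHE[d - 1] : Measure (Space d))
        = 0 := by
      refine integral_eq_zero_of_ae ?_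
      filter_upwards [hflat] with y hy
      rcases hy.outwardNormal_cases hK.isOpen hK.regular with h | h | h <;> simp [h, hv]
    simp [h0, h1]
  · have hsf : SFinite ((μHE[d - 1] : Measure (Space d)).restrict P) := by
      rw [hPn]
      exact sFinite_restrict_hyperplane hn s
    set μ := (μHE[d - 1] : Measure (Space d)).restrict P with hμ
    have hchange : ∀ ε : ℝ, 0 < ε → ε⁻¹ * ∫ x, sweepShare F K f v ε P x
        = |inner ℝ n v| * ∫ q : Space d × ℝ, sweepShare F K f v ε P (q.1 + q.2 • (ε • v)) ∂(μ.prod volume) := by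
      intro ε hε
      have hv' : inner ℝ n (ε • v) ≠ 0 := by
        rw [inner_smul_right]
        exact mul_ne_zero hε.ne' hv
      have h1 := measurePreserving_add_smul hn s hv'
      rw [← hPn, ← hμ] at h1
      have h2 := (measurable_sweepShare hF.isHyperplane hK.isOpen hf.measurable v ε hP)
      rw [← h1.map_eq, integral_map h1.measurable.aemeasurable h2.aestronglyMeasurable,
        integral_smul_measure, ENNReal.toReal_ofReal (abs_nonneg _), inner_smul_right, abs_mul,
        abs_of_pos hε, smul_eq_mul]
      field_simp
    have hmeas : ∀ᵐ q : Space d × ℝ ∂(μ.prod volume), (P = {x | inner ℝ n x = inner ℝ n q.1} ∧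
        ∀ Q ∈ F, Q ≠ P → q.1 ∉ Q) ∧ q.2 ≠ (0 : ℝ) ∧ q.2 ≠ 1 := by
      have ha : ∀ᵐ q : Space d × ℝ ∂(μ.prod (volume : Measure ℝ)), (P = {x | inner ℝ n x = inner ℝ n q.1} ∧
        ∀ Q ∈ F, Q ≠ P → q.1 ∉ Q) := Measure.quasiMeasurePreserving_fst.ae hreg
      have hb : ∀ᵐ q : Space d × ℝ ∂(μ.prod (volume : Measure ℝ)), q.2 ≠ (0 : ℝ) ∧ q.2 ≠ 1 :=
        Measure.quasiMeasurePreserving_snd.ae ((Measure.ae_ne volume 0).and (Measure.ae_ne volume 1))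
      filter_upwards [ha, hb] with q h1 h2 using ⟨h1, h2⟩
    obtain ⟨C, hC⟩ := hfc.exists_bound_of_continuous hf
    obtain ⟨R, hR⟩ := hfc.isCompact.isBounded.subset_closedBall 0
    -- For u and ε in [0,1], the point y + uε v can be in the support of f only if y lies in this
    -- ball, so the dominating function is a constant on a set of finite measure.
    set B : Set (Space d) := Metric.closedBall 0 (R + ‖v‖) with hB
    have hlim : Filter.Tendsto
        (fun ε => ∫ q : Space d × ℝ, sweepShare F K f v ε P (q.1 + q.2 • (ε • v)) ∂(μ.prod volume)) (𝓝[>] 0)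
        (𝓝 (∫ q : Space d × ℝ, (f q.1 * SignType.sign (inner ℝ (outwardNormal K q.1) v : ℝ)) *
          (Icc (0 : ℝ) 1).indicator (fun _ => 1) q.2 ∂(μ.prod volume))) := by
      refine tendsto_integral_filter_of_dominated_convergence
        ((B ×ˢ Icc (0 : ℝ) 1).indicator fun _ => C) ?_ ?_ ?_ ?_
      · refine Filter.Eventually.of_forall fun ε => ?_
        exact ((measurable_sweepShare hF.isHyperplane hK.isOpen hf.measurable v ε hP).comp
          (by fun_prop)).aestronglyMeasurable
      · filter_upwards [self_mem_nhdsWithin, Ioo_mem_nhdsGT (zero_lt_one' ℝ)] with ε hε hε1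
        have hε : 0 < ε := hε
        filter_upwards [hmeas] with q hq
        have hiff := add_smul_mem_sweep_iff hq.1.1 hv hε q.2
        rw [Real.norm_eq_abs]
        by_cases hq2 : q.2 ∈ Icc (0 : ℝ) 1
        · by_cases hqB : q.1 ∈ B
          · rw [indicator_of_mem (mk_mem_prod hqB hq2)]
            exact (abs_sweepShare_le K f v ε hP _).trans (hC _)
          · rw [indicator_of_notMem fun h => hqB h.1]
            refine (abs_sweepShare_le K f v ε hP _).trans ?_
            rw [abs_nonpos_iff]
            by_contra hne
            have h3 := hR (subset_tsupport f hne)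
            apply hqB
            rw [hB, mem_closedBall_zero_iff]
            rw [mem_closedBall_zero_iff] at h3
            have h4 : q.1 = (q.1 + q.2 • (ε • v)) - q.2 • (ε • v) := by abel
            rw [h4]
            refine (norm_sub_le _ _).trans (add_le_add h3 ?_)
            rw [norm_smul, norm_smul, Real.norm_eq_abs, Real.norm_eq_abs, abs_of_pos hε,
              abs_of_nonneg hq2.1, ← mul_assoc]
            exact mul_le_of_le_one_left (norm_nonneg v) (mul_le_one₀ hq2.2 hε.le hε1.2.le)
        · rw [indicator_of_notMem fun h => hq2 h.2, sweepShare,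
            indicator_of_notMem (mt hiff.1 hq2), abs_zero]
      · rw [integrable_indicator_iff (measurableSet_closedBall.prod measurableSet_Icc)]
        refine integrableOn_const ?_
        rw [Measure.prod_prod, hμ, Measure.restrict_apply measurableSet_closedBall, inter_comm]
        refine (ENNReal.mul_lt_top ((hF.isHyperplane P hP).measure_inter_lt_top
          Metric.isBounded_closedBall) ?_).ne
        simp
      · filter_upwards [hmeas] with q hq
        exact tendsto_sweepShare hF hK hf hn hP hq.1.1 hq.1.2 hv hq.2.1 hq.2.2
    have heq : |inner ℝ n v| * ∫ q : Space d × ℝ, (f q.1 * SignType.sign (inner ℝ (outwardNormal K q.1) v : ℝ)) *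
          (Icc (0 : ℝ) 1).indicator (fun _ => 1) q.2 ∂(μ.prod volume)
        = ∫ x, f x * inner ℝ (outwardNormal K x) v ∂μ := by
      rw [integral_prod_mul (μ := μ) (ν := (volume : Measure ℝ))
        (fun y => f y * SignType.sign (inner ℝ (outwardNormal K y) v : ℝ))
        (fun u => (Icc (0 : ℝ) 1).indicator (fun _ => 1) u)]
      rw [integral_indicator measurableSet_Icc]
      simp only [integral_const, MeasurableSet.univ, measureReal_restrict_apply, univ_inter,
        Real.volume_real_Icc, sub_zero, max_eq_left zero_le_one, smul_eq_mul, mul_one]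
      rw [← integral_const_mul]
      refine integral_congr_ae ?_
      filter_upwards [hflat] with y hy
      have hs : ∀ a : ℝ, |a| * SignType.sign a = a := fun a => by
        rw [mul_comm]; exact sign_mul_abs a
      rcases hy.outwardNormal_cases hK.isOpen hK.regular with h | h | h
      · simp [h]
      · rw [h, mul_left_comm, hs]
      · rw [h, mul_left_comm, inner_neg_left, ← abs_neg, hs]
    rw [← heq]
    refine (hlim.const_mul _).congr' ?_
    filter_upwards [self_mem_nhdsWithin] with ε hε
    rw [hchange ε hε]

/-- The divergence theorem on a polytope, for a compactly supported function. -/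
theorem IsPolytope.integral_fderiv_of_hasCompactSupport {K : Set (Space d)} (hK : IsPolytope K)
    {f : Space d → ℝ} (hf : ContDiff ℝ 1 f) (hfc : HasCompactSupport f) (v : Space d) :
    ∫ x in K, fderiv ℝ f x v = ∫ x in frontier K, f x * inner ℝ (outwardNormal K x) v
      ∂(μHE[d - 1] : Measure (Space d)) := by
  obtain ⟨F, hF⟩ := hK.exists_coversFrontier
  have hKm : MeasurableSet K := hK.isOpen.measurableSet
  have hKf : volume K ≠ ⊤ := hK.isBounded.measure_lt_top.ne
  have hfi : Integrable f := hf.continuous.integrable_of_hasCompactSupport hfc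
  obtain ⟨C, hC⟩ := ContDiff.lipschitzWith_of_hasCompactSupport hfc hf one_ne_zero
  have hind : Integrable (K.indicator (fun _ => (1 : ℝ))) :=
    (integrable_indicator_iff hKm).2 (integrableOn_const hKf)
  -- The left side is the limit of difference quotients of f integrated against the indicator of K.
  have hlim1 := hC.integral_inv_smul_sub_mul_tendsto_integral_lineDeriv_mul (μ := volume) hind v
  have h1 : ∫ x, lineDeriv ℝ f x v * K.indicator (fun _ => (1 : ℝ)) x
      = ∫ x in K, fderiv ℝ f x v := by
    rw [← integral_indicator hKm]
    refine integral_congr_ae (Filter.Eventually.of_forall fun x => ?_)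
    simp only
    rw [(hf.differentiable one_ne_zero).differentiableAt.lineDeriv_eq_fderiv]
    by_cases hx : x ∈ K <;> simp [hx]
  rw [h1] at hlim1
  have hlim2 := tendsto_finsetSum F fun P hP =>
    tendsto_integral_sweepShare hF hK hf.continuous hfc v hP
  have hshare : ∀ ε : ℝ, ∀ P ∈ F, Integrable (sweepShare F K f v ε P) := by
    intro ε P hP
    refine hfi.mono (measurable_sweepShare hF.isHyperplane hK.isOpen hf.continuous.measurable v ε
      hP).aestronglyMeasurable (Filter.Eventually.of_forall fun x => ?_)
    exact abs_sweepShare_le K f v ε hP x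
  have h2 : ∀ ε : ℝ, 0 < ε →
      ∫ x, (ε⁻¹ • (f (x + ε • v) - f x)) * K.indicator (fun _ => (1 : ℝ)) x
        = ∑ P ∈ F, ε⁻¹ * ∫ x, sweepShare F K f v ε P x := by
    intro ε hε
    rw [← Finset.mul_sum, ← integral_finsetSum F (hshare ε)]
    simp only [hF.sum_sweepShare hK.isOpen f v _ hε.le, indicatorDiff, smul_eq_mul, mul_assoc]
    rw [integral_const_mul]
    congr 1
    have hb : ∀ x, ‖K.indicator (fun _ => (1 : ℝ)) x‖ ≤ 1 := by
      intro x
      by_cases hx : x ∈ K <;> simp [hx]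
    have hm : Measurable (K.indicator (fun _ => (1 : ℝ))) := measurable_const.indicator hKm
    have hi0 : Integrable fun x => f x * K.indicator (fun _ => (1 : ℝ)) x :=
      hfi.mul_bdd hm.aestronglyMeasurable (Filter.Eventually.of_forall hb)
    have hi1 : Integrable fun x => f x * K.indicator (fun _ => (1 : ℝ)) (x - ε • v) :=
      hfi.mul_bdd (hm.comp (measurable_sub_const _)).aestronglyMeasurable
        (Filter.Eventually.of_forall fun x => hb _)
    have hi2 : Integrable fun x => f (x + ε • v) * K.indicator (fun _ => (1 : ℝ)) x := by
      have := hi1.comp_add_right (ε • v)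
      simpa using this
    -- Translation invariance moves the increment from f to the indicator.
    have h3 : ∫ x, f (x + ε • v) * K.indicator (fun _ => (1 : ℝ)) x
        = ∫ x, f x * K.indicator (fun _ => (1 : ℝ)) (x - ε • v) := by
      rw [← integral_add_right_eq_self
        (fun x => f x * K.indicator (fun _ => (1 : ℝ)) (x - ε • v)) (ε • v)]
      simp only [add_sub_cancel_right]
    simp only [sub_mul, mul_sub]
    rw [integral_sub hi2 hi0, integral_sub hi1 hi0, h3]
  have h3 := tendsto_nhds_unique (hlim1.congr' (by
    filter_upwards [self_mem_nhdsWithin] with ε hε using h2 ε hε)) hlim2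
  rw [h3]
  have hU : ⋃ P ∈ F, P = ⋃ P : F, (P : Set (Space d)) := by
    ext x
    simp
  -- The normal is zero off the frontier by its default value, so the frontier integral extends to
  -- the union of the hyperplanes, whose pairwise intersections are null.
  have h4 : ∫ x in frontier K, f x * inner ℝ (outwardNormal K x) v
      ∂(μHE[d - 1] : Measure (Space d)) = ∫ x in ⋃ P : F, (P : Set (Space d)),
        f x * inner ℝ (outwardNormal K x) v ∂(μHE[d - 1] : Measure (Space d)) := by
    rw [← hU]
    refine (setIntegral_eq_of_subset_of_forall_sdiff_eq_zero ?_ hF.subset fun x hx => ?_).symm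
    · exact F.measurableSet_biUnion fun P hP => (hF.isHyperplane P hP).measurableSet
    · rw [outwardNormal_eq_zero hx.2, inner_zero_left, mul_zero]
  obtain ⟨C', hC'⟩ := hfc.exists_bound_of_continuous hf.continuous
  have hint : IntegrableOn (fun x => f x * inner ℝ (outwardNormal K x) v)
      (⋃ P : F, (P : Set (Space d))) (μHE[d - 1] : Measure (Space d)) := by
    have hfin : IsFiniteMeasure ((μHE[d - 1] : Measure (Space d)).restrict (frontier K)) :=
      ⟨by simpa using hK.measure_frontier_lt_top⟩
    have h5 : IntegrableOn (fun x => f x * inner ℝ (outwardNormal K x) v) (frontier K)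
        (μHE[d - 1] : Measure (Space d)) := by
      refine Integrable.of_bound (hf.continuous.aestronglyMeasurable.mul
        (hK.aestronglyMeasurable_outwardNormal.inner aestronglyMeasurable_const)) (C' * ‖v‖)
        (Filter.Eventually.of_forall fun x => ?_)
      rw [norm_mul]
      refine mul_le_mul (hC' x) ((norm_inner_le_norm _ _).trans ?_) (norm_nonneg _)
        ((norm_nonneg _).trans (hC' x))
      exact mul_le_of_le_one_left (norm_nonneg v) (norm_outwardNormal_le K x)
    refine h5.of_forall_sdiff_eq_zero ?_ fun x hx => ?_
    · rw [← hU]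
      exact F.measurableSet_biUnion fun P hP => (hF.isHyperplane P hP).measurableSet
    · rw [outwardNormal_eq_zero hx.2, inner_zero_left, mul_zero]
  rw [h4, integral_iUnion_ae (ι := F) (s := fun P => (P : Set (Space d)))
    (fun P => (hF.isHyperplane P P.2).measurableSet.nullMeasurableSet) ?_ hint, tsum_fintype]
  · exact (Finset.sum_coe_sort F fun P => ∫ x in P, f x * inner ℝ (outwardNormal K x) v
      ∂(μHE[d - 1] : Measure (Space d))).symm
  · intro P Q hPQ
    exact (hF.isHyperplane P P.2).measure_inter_eq_zero (hF.isHyperplane Q Q.2)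
      fun h => hPQ (Subtype.ext h)

/-- The divergence theorem on a polytope. -/
theorem IsPolytope.integral_fderiv {K : Set (Space d)} (hK : IsPolytope K)
    {f : Space d → ℝ} (hf : ContDiff ℝ 1 f) (v : Space d) :
    ∫ x in K, fderiv ℝ f x v = ∫ x in frontier K, f x * inner ℝ (outwardNormal K x) v
      ∂(μHE[d - 1] : Measure (Space d)) := by
  obtain ⟨R, hR⟩ := hK.isBounded.closure.subset_ball (0 : Space d)
  -- A cutoff equal to one near the closure of K makes f compactly supported without changing either
  -- side. The maximum with 1 keeps the inner radius positive.
  let χ : ContDiffBump (0 : Space d) := ⟨max R 1, max R 1 + 1, by positivity, by linarith⟩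
  have hball : closure K ⊆ Metric.ball 0 χ.rIn :=
    hR.trans (Metric.ball_subset_ball (le_max_left R 1))
  have hone : ∀ x ∈ closure K, (fun y => χ y * f y) =ᶠ[𝓝 x] f := by
    intro x hx
    filter_upwards [χ.eventuallyEq_one_of_mem_ball (hball hx)] with y hy
    rw [hy, Pi.one_apply, one_mul]
  have h1 := hK.integral_fderiv_of_hasCompactSupport (χ.contDiff.mul hf)
    (χ.hasCompactSupport.mul_right (f' := f)) v
  rw [setIntegral_congr_fun (g := fun x => fderiv ℝ f x v) hK.isOpen.measurableSet
    fun x hx => by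
      have := (hone x (subset_closure hx)).fderiv_eq (𝕜 := ℝ)
      exact congrArg (fun A : Space d →L[ℝ] ℝ => A v) this] at h1
  rw [h1]
  refine setIntegral_congr_fun isClosed_frontier.measurableSet fun x hx => ?_
  have h2 : χ x * f x = f x := (hone x (frontier_subset_closure hx)).self_of_nhds
  change χ x * f x * _ = f x * _
  rw [h2]

end TrefftzDG

/-! ### Faces of the mesh -/

namespace TrefftzDG

variable {d : ℕ}

theorem frequently_inner_neg {ν : Space d} (hν : ‖ν‖ = 1) (x : Space d) :
    ∃ᶠ y in 𝓝 x, inner ℝ (y - x) ν < 0 := by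
  have hlim : Filter.Tendsto (fun t : ℝ => x - t • ν) (𝓝[>] 0) (𝓝 x) := by
    have : Filter.Tendsto (fun t : ℝ => x - t • ν) (𝓝 0) (𝓝 (x - (0 : ℝ) • ν)) := by
      apply Continuous.tendsto
      fun_prop
    rw [zero_smul, sub_zero] at this
    exact this.mono_left nhdsWithin_le_nhds
  refine hlim.frequently (Filter.Eventually.frequently ?_)
  filter_upwards [self_mem_nhdsWithin] with t ht
  simpa [inner_smul_left, hν] using ht

namespace Mesh

variable {S : Model d}

/-- A single family for the domain and all the elements: at a regular point of it, all their
boundaries are flat along the same hyperplane. -/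
theorem exists_coversFrontier (h : Mesh S) : ∃ F : Finset (Set (Space d)),
    CoversFrontier F S.Ω ∧ ∀ i, CoversFrontier F (h.K i) := by
  classical
  obtain ⟨F₀, hF₀⟩ := S.polytope.exists_coversFrontier
  choose G hG using fun i => (h.polytope i).exists_coversFrontier
  have hyp : ∀ P ∈ F₀ ∪ Finset.univ.biUnion G, IsHyperplane P := by
    intro P hP
    rcases Finset.mem_union.1 hP with hP | hP
    · exact hF₀.isHyperplane P hP
    · obtain ⟨i, -, hi⟩ := Finset.mem_biUnion.1 hP
      exact (hG i).isHyperplane P hi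
  refine ⟨F₀ ∪ Finset.univ.biUnion G, ⟨hyp, fun x hx => ?_⟩, fun i => ⟨hyp, fun x hx => ?_⟩⟩
  · obtain ⟨P, hP, hxP⟩ := mem_iUnion₂.1 (hF₀.subset hx)
    exact mem_iUnion₂.2 ⟨P, Finset.mem_union_left _ hP, hxP⟩
  · obtain ⟨P, hP, hxP⟩ := mem_iUnion₂.1 ((hG i).subset hx)
    exact mem_iUnion₂.2 ⟨P, Finset.mem_union_right _
      (Finset.mem_biUnion.2 ⟨i, Finset.mem_univ i, hP⟩), hxP⟩

/-- An open subset of the closure of Ω lies in its interior, which is Ω since a polytope has no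
slits. -/
theorem subset_domain (h : Mesh S) (i : Fin h.m) : h.K i ⊆ S.Ω := by
  rw [← S.polytope.regular, ← h.cover]
  exact interior_maximal (subset_closure.trans (subset_iUnion (fun i => closure (h.K i)) i))
    (h.polytope i).isOpen

/-- At `x`, the element `i` meets exactly one other element `j`, on an interior face. -/
structure IsInteriorFacePoint (h : Mesh S) (i j : Fin h.m) (x : Space d) : Prop where
  ne : j ≠ i
  mem : x ∈ frontier (h.K j)
  eq_or_eq : ∀ k, x ∈ frontier (h.K k) → k = i ∨ k = j
  normal : outwardNormal (h.K j) x = -outwardNormal (h.K i) x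
  notMem : x ∉ frontier S.Ω

/-- At `x`, the element `i` touches the boundary of the domain and no other element. -/
structure IsBoundaryFacePoint (h : Mesh S) (i : Fin h.m) (x : Space d) : Prop where
  mem : x ∈ frontier S.Ω
  eq : ∀ k, x ∈ frontier (h.K k) → k = i
  normal : outwardNormal S.Ω x = outwardNormal (h.K i) x

/-- Locally every element is everything, nothing, or one of the two sides of the hyperplane, and
element i occupies one side. By disjointness, at most one other element occupies the opposite side
and the rest stay away. If that side is occupied, Ω contains both sides and so x is not on its
boundary; if it is free, the covering property forces Ω to be locally the same half-space as element
i. -/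
theorem facePoint_cases_of_flat (h : Mesh S) {x n : Space d} (hΩ : FlatFrontierAt S.Ω x n)
    (hK : ∀ i, FlatFrontierAt (h.K i) x n) {i : Fin h.m} (hi : x ∈ frontier (h.K i)) :
    (∃ j, h.IsInteriorFacePoint i j x) ∨ h.IsBoundaryFacePoint i x := by
  have hcl : ∀ {K : Set (Space d)}, x ∈ frontier K → ¬ ∀ᶠ y in 𝓝 x, y ∉ K :=
    fun hx => mem_closure_iff_frequently.1 hx.1
  have hin : ∀ {K : Set (Space d)}, x ∈ frontier K → ¬ ∀ᶠ y in 𝓝 x, y ∈ K :=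
    fun hx hy => hx.2 (mem_interior_iff_mem_nhds.2 hy)
  obtain ⟨ν, hν, hνn⟩ : ∃ ν, IsOutwardNormal (h.K i) x ν ∧ (ν = n ∨ ν = -n) := by
    rcases (hK i).cases (h.polytope i).isOpen (h.polytope i).regular with h1 | h1 | h1 | h1
    · exact absurd h1 (hin hi)
    · exact absurd h1 (hcl hi)
    · exact ⟨n, h1, Or.inl rfl⟩
    · exact ⟨-n, h1, Or.inr rfl⟩
  have hcases : ∀ {K : Set (Space d)}, IsPolytope K → FlatFrontierAt K x n →
      (∀ᶠ y in 𝓝 x, y ∈ K) ∨ (∀ᶠ y in 𝓝 x, y ∉ K) ∨ IsOutwardNormal K x ν ∨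
        IsOutwardNormal K x (-ν) := by
    intro K hKp hKf
    rcases hKf.cases hKp.isOpen hKp.regular with h1 | h1 | h1 | h1
    · exact Or.inl h1
    · exact Or.inr (Or.inl h1)
    · rcases hνn with rfl | rfl
      · exact Or.inr (Or.inr (Or.inl h1))
      · exact Or.inr (Or.inr (Or.inr (by rwa [neg_neg])))
    · rcases hνn with rfl | rfl
      · exact Or.inr (Or.inr (Or.inr h1))
      · exact Or.inr (Or.inr (Or.inl h1))
  have hsame : ∀ {j k : Fin h.m} {ν' : Space d}, IsOutwardNormal (h.K j) x ν' →
      IsOutwardNormal (h.K k) x ν' → j = k := by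
    intro j k ν' hj hk
    by_contra hne
    obtain ⟨y, hy, hyj, hyk⟩ := ((frequently_inner_neg hj.1 x).and_eventually
      (hj.2.and hk.2)).exists
    exact disjoint_left.1 (h.disjoint j k hne) (hyj.2 hy) (hyk.2 hy)
  have hother : ∀ k, k ≠ i → (∀ᶠ y in 𝓝 x, y ∉ h.K k) ∨ IsOutwardNormal (h.K k) x (-ν) := by
    intro k hki
    rcases hcases (h.polytope k) (hK k) with h1 | h1 | h1 | h1
    · obtain ⟨y, hy, hyi, hyk⟩ := ((frequently_inner_neg hν.1 x).and_eventually
        (hν.2.and h1)).exists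
      exact absurd hyk (disjoint_left.1 (h.disjoint i k hki.symm) (hyi.2 hy))
    · exact Or.inl h1
    · exact absurd (hsame h1 hν) hki
    · exact Or.inr h1
  have hΩnot : ¬ ∀ᶠ y in 𝓝 x, y ∉ S.Ω := by
    intro h1
    obtain ⟨y, hy, hyi, hyΩ⟩ := ((frequently_inner_neg hν.1 x).and_eventually
      (hν.2.and h1)).exists
    exact hyΩ (h.subset_domain i (hyi.2 hy))
  have hΩneg : ¬ IsOutwardNormal S.Ω x (-ν) := by
    intro h1
    obtain ⟨y, hy, hyi, hyΩ⟩ := ((frequently_inner_neg hν.1 x).and_eventually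
      (hν.2.and h1.2)).exists
    have h2 := hyΩ.1 (h.subset_domain i (hyi.2 hy))
    rw [inner_neg_right] at h2
    linarith
  by_cases hj : ∃ j, j ≠ i ∧ IsOutwardNormal (h.K j) x (-ν)
  · left
    obtain ⟨j, hji, hj⟩ := hj
    refine ⟨j, hji, hj.mem_frontier, fun k hk => ?_, ?_, fun hxΩ => ?_⟩
    · by_cases hki : k = i
      · exact Or.inl hki
      · rcases hother k hki with h1 | h1
        · exact absurd h1 (hcl hk)
        · exact Or.inr (hsame h1 hj)
    · rw [hj.outwardNormal_eq, hν.outwardNormal_eq]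
    · rcases hcases S.polytope hΩ with h1 | h1 | h1 | h1
      · exact hin hxΩ h1
      · exact hΩnot h1
      · obtain ⟨y, hy, hyj, hyΩ⟩ := ((frequently_inner_neg hj.1 x).and_eventually
          (hj.2.and h1.2)).exists
        have h2 := hyΩ.1 (h.subset_domain j (hyj.2 hy))
        rw [inner_neg_right] at hy
        linarith
      · exact hΩneg h1
  · right
    have hnone : ∀ k, k ≠ i → ∀ᶠ y in 𝓝 x, y ∉ h.K k := fun k hki =>
      (hother k hki).resolve_right fun h1 => hj ⟨k, hki, h1⟩
    have hnorm : IsOutwardNormal S.Ω x ν := by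
      rcases hcases S.polytope hΩ with h1 | h1 | h1 | h1
      -- If Ω were everything near x, the unoccupied side would contain points of Ω in no closed
      -- element, against the covering property.
      · exfalso
        have h2 : ∀ᶠ y in 𝓝 x, ∀ k, k ≠ i → y ∉ closure (h.K k) := by
          rw [Filter.eventually_all]
          intro k
          by_cases hki : k = i
          · exact Filter.Eventually.of_forall fun y h => absurd hki h
          · filter_upwards [(hnone k hki).eventually_nhds] with y hy _ hyk
            exact mem_closure_iff_frequently.1 hyk hy
        have h3 : ∀ᶠ y in 𝓝 x, 0 < inner ℝ (y - x) ν → y ∉ closure (h.K i) := by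
          filter_upwards [hν.2.eventually_nhds] with y hy hpos hyi
          obtain ⟨z, hz, hzi, hz0⟩ := ((mem_closure_iff_frequently.1 hyi).and_eventually
            (hy.and ((isOpen_lt continuous_const (by fun_prop : Continuous fun z : Space d =>
              (inner ℝ (z - x) ν : ℝ))).mem_nhds hpos))).exists
          have hz0 : 0 < (inner ℝ (z - x) ν : ℝ) := hz0
          exact absurd (hzi.1 hz) (not_lt.2 hz0.le)
        obtain ⟨y, hy, hy1, hy2, hy3⟩ := ((frequently_inner_neg (ν := -ν) (by simp [hν.1])
          x).and_eventually (h1.and (h2.and h3))).exists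
        rw [inner_neg_right, neg_lt_zero] at hy
        have hycl : y ∈ ⋃ k, closure (h.K k) := by
          rw [h.cover]
          exact subset_closure hy1
        obtain ⟨k, hk⟩ := mem_iUnion.1 hycl
        by_cases hki : k = i
        · subst hki
          exact hy3 hy hk
        · exact hy2 k hki hk
      · exact absurd h1 hΩnot
      · exact h1
      · exact absurd h1 hΩneg
    refine ⟨hnorm.mem_frontier, fun k hk => ?_, ?_⟩
    · by_contra hki
      exact hcl hk (hnone k hki)
    · rw [hnorm.outwardNormal_eq, hν.outwardNormal_eq]

theorem ae_facePoint_cases (h : Mesh S) (i : Fin h.m) :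
    ∀ᵐ x ∂(μHE[d - 1] : Measure (Space d)).restrict (frontier (h.K i)),
      (∃ j, h.IsInteriorFacePoint i j x) ∨ h.IsBoundaryFacePoint i x := by
  obtain ⟨F, hΩ, hF⟩ := h.exists_coversFrontier
  filter_upwards [ae_restrict_of_ae_restrict_of_subset (hF i).subset
    (ae_isRegularPoint hΩ.isHyperplane), ae_restrict_mem isClosed_frontier.measurableSet]
    with x hx hxi
  obtain ⟨n, hn⟩ := hx
  exact h.facePoint_cases_of_flat (hn.flatFrontierAt hΩ) (fun k => hn.flatFrontierAt (hF k)) hxi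

theorem ae_outwardNormal_eq_neg (h : Mesh S) {i j : Fin h.m} (hij : i ≠ j) :
    ∀ᵐ x ∂(μHE[d - 1] : Measure (Space d)).restrict (frontier (h.K i) ∩ frontier (h.K j)),
      outwardNormal (h.K j) x = -outwardNormal (h.K i) x := by
  filter_upwards [ae_restrict_of_ae_restrict_of_subset inter_subset_left (h.ae_facePoint_cases i),
    ae_restrict_mem (isClosed_frontier.inter isClosed_frontier).measurableSet] with x hx hxij
  rcases hx with ⟨k, hk⟩ | hb
  · rcases hk.eq_or_eq j hxij.2 with h1 | h1
    · exact absurd h1.symm hij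
    · rw [h1]
      exact hk.normal
  · exact absurd (hb.eq j hxij.2).symm hij

theorem ae_outwardNormal_eq (h : Mesh S) (i : Fin h.m) {Γ : Set (Space d)}
    (hΓ : MeasurableSet Γ) (hsub : Γ ⊆ frontier S.Ω) :
    ∀ᵐ x ∂(μHE[d - 1] : Measure (Space d)).restrict (frontier (h.K i) ∩ Γ),
      outwardNormal S.Ω x = outwardNormal (h.K i) x := by
  filter_upwards [ae_restrict_of_ae_restrict_of_subset inter_subset_left (h.ae_facePoint_cases i),
    ae_restrict_mem (isClosed_frontier.measurableSet.inter hΓ)] with x hx hxi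
  rcases hx with ⟨k, hk⟩ | hb
  · exact absurd (hsub hxi.2) hk.notMem
  · exact hb.normal

theorem ΓD_subset_frontier (S : Model d) : S.ΓD ⊆ frontier S.Ω :=
  subset_union_left.trans S.boundary_eq.subset

theorem ΓN_subset_frontier (S : Model d) : S.ΓN ⊆ frontier S.Ω :=
  subset_union_right.trans S.boundary_eq.subset

/-- The boundary of an element splits into its interior faces, its Dirichlet part, and its
Neumann part. -/
theorem restrict_frontier (h : Mesh S) (i : Fin h.m) :
    (μHE[d - 1] : Measure (Space d)).restrict (frontier (h.K i))
      = ∑ j ∈ Finset.univ.erase i,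
          (μHE[d - 1] : Measure (Space d)).restrict (frontier (h.K i) ∩ frontier (h.K j))
        + (μHE[d - 1] : Measure (Space d)).restrict (frontier (h.K i) ∩ S.ΓD)
        + (μHE[d - 1] : Measure (Space d)).restrict (frontier (h.K i) ∩ S.ΓN) := by
  set μ := (μHE[d - 1] : Measure (Space d))
  have hm : ∀ j, MeasurableSet (frontier (h.K j)) := fun j => isClosed_frontier.measurableSet
  have hae := (ae_restrict_iff' (hm i)).1 (h.ae_facePoint_cases i)
  have hDN : ∀ᵐ x ∂μ, x ∉ S.ΓD ∩ S.ΓN := measure_eq_zero_iff_ae_notMem.1 S.boundary_disjoint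
  set U : Finset (Fin h.m) → Set (Space d) :=
    fun s => ⋃ j ∈ s, frontier (h.K i) ∩ frontier (h.K j) with hU
  -- Faces towards different neighbours overlap only in a null set, because almost every boundary
  -- point has at most one neighbour.
  have h1 : ∀ s : Finset (Fin h.m), i ∉ s →
      μ.restrict (U s) = ∑ j ∈ s, μ.restrict (frontier (h.K i) ∩ frontier (h.K j)) := by
    intro s
    induction s using Finset.induction_on with
    | empty => simp [hU]
    | insert a s ha ih =>
      intro hi
      rw [Finset.mem_insert, not_or] at hi
      rw [Finset.sum_insert ha, ← ih hi.2]
      simp only [hU, Finset.set_biUnion_insert]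
      refine Measure.restrict_union₀ ?_ (s.measurableSet_biUnion fun j _ =>
        (hm i).inter (hm j)).nullMeasurableSet
      refine measure_eq_zero_iff_ae_notMem.2 ?_
      filter_upwards [hae] with x hx
      rintro ⟨⟨hxi, hxa⟩, hxs⟩
      obtain ⟨j, hj, -, hxj⟩ := mem_iUnion₂.1 hxs
      rcases hx hxi with ⟨k, hk⟩ | hb
      · have h2 := (hk.eq_or_eq a hxa).resolve_left (Ne.symm hi.1)
        have h3 := (hk.eq_or_eq j hxj).resolve_left (by rintro rfl; exact hi.2 hj)
        exact ha (by rw [h2, ← h3]; exact hj)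
      · exact hi.1 (hb.eq a hxa).symm
  have h2 : ∀ᵐ x ∂μ, x ∈ frontier (h.K i) ↔ x ∈ U (Finset.univ.erase i)
      ∪ (frontier (h.K i) ∩ S.ΓD) ∪ (frontier (h.K i) ∩ S.ΓN) := by
    filter_upwards [hae] with x hx
    constructor
    · intro hxi
      rcases hx hxi with ⟨k, hk⟩ | hb
      · exact Or.inl (Or.inl (mem_iUnion₂.2 ⟨k, by simp [hk.ne], hxi, hk.mem⟩))
      · have h3 := hb.mem
        rw [← S.boundary_eq] at h3
        rcases h3 with h3 | h3
        · exact Or.inl (Or.inr ⟨hxi, h3⟩)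
        · exact Or.inr ⟨hxi, h3⟩
    · rintro ((h3 | h3) | h3)
      · obtain ⟨j, -, hj, -⟩ := mem_iUnion₂.1 h3
        exact hj
      · exact h3.1
      · exact h3.1
  have h3 : ∀ᵐ x ∂μ, x ∈ U (Finset.univ.erase i) → x ∉ frontier S.Ω := by
    filter_upwards [hae] with x hx hxU
    obtain ⟨j, hj, hxi, hxj⟩ := mem_iUnion₂.1 hxU
    rcases hx hxi with ⟨k, hk⟩ | hb
    · exact hk.notMem
    · exact absurd (hb.eq j hxj) (Finset.ne_of_mem_erase hj)
  rw [Measure.restrict_congr_set (Filter.eventuallyEq_set.2 h2), Measure.restrict_union₀ _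
    ((hm i).inter S.measurable_ΓN).nullMeasurableSet, Measure.restrict_union₀ _
    ((hm i).inter S.measurable_ΓD).nullMeasurableSet, h1 _ (Finset.notMem_erase i _)]
  · refine measure_eq_zero_iff_ae_notMem.2 ?_
    filter_upwards [h3] with x hx
    rintro ⟨hxU, -, hxD⟩
    exact hx hxU (ΓD_subset_frontier S hxD)
  · refine measure_eq_zero_iff_ae_notMem.2 ?_
    filter_upwards [h3, hDN] with x hx hxDN
    rintro ⟨hxU | hxD, -, hxN⟩
    · exact hx hxU (ΓN_subset_frontier S hxN)
    · exact hxDN ⟨hxD.2, hxN⟩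

end Mesh
end TrefftzDG

/-! ### Powers of A in its eigenbasis, and the chain rule for polynomials -/

namespace TrefftzDG

variable {d : ℕ}

namespace Model

/-- The eigenvectors of `A`, that is, the rows of `P`. -/
noncomputable def axis (S : Model d) (k : Fin d) : Space d := WithLp.toLp 2 (S.P k)

theorem inner_axis (S : Model d) (k : Fin d) (u : Space d) :
    inner ℝ (S.axis k) u = ∑ i, S.P k i * u i := by
  simp [axis, PiLp.inner_apply, mul_comm]

theorem inner_axis_axis (S : Model d) (k l : Fin d) :
    inner ℝ (S.axis k) (S.axis l) = if k = l then (1 : ℝ) else 0 := by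
  rw [inner_axis]
  have h := (Matrix.mem_orthogonalGroup_iff (Fin d) ℝ).1 S.orthogonal
  have h2 := congrFun (congrFun h k) l
  rw [Matrix.mul_apply, Matrix.one_apply] at h2
  simpa [axis] using h2

theorem mulVec_apply_eq_inner (S : Model d) (u : Space d) (k : Fin d) :
    S.P.mulVec (WithLp.ofLp u) k = inner ℝ (S.axis k) u := by
  rw [inner_axis]
  rfl

/-- Spectral form: the rows of P are an orthonormal eigenbasis. Symmetry and the exponent law are
read off from it. -/
theorem pow_apply (S : Model d) (s : ℝ) (u : Space d) :
    S.pow s u = ∑ k, (S.lam k ^ s * inner ℝ (S.axis k) u) • S.axis k := by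
  ext i
  rw [pow, Matrix.ofLp_toEuclideanCLM, ← Matrix.mulVec_mulVec, ← Matrix.mulVec_mulVec,
    Matrix.mulVec, dotProduct, WithLp.ofLp_sum, Finset.sum_apply]
  refine Finset.sum_congr rfl fun k _ => ?_
  rw [Matrix.mulVec_diagonal, mulVec_apply_eq_inner, mul_comm]
  rfl

theorem toHat_apply (S : Model d) (u : Space d) (k : Fin d) :
    S.toHat u k = S.lam k ^ (-(1 / 2) : ℝ) * inner ℝ (S.axis k) u := by
  rw [toHat, Matrix.ofLp_toEuclideanCLM, ← Matrix.mulVec_mulVec, Matrix.mulVec_diagonal,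
    mulVec_apply_eq_inner]

theorem transpose_apply (S : Model d) (g : Fin d → ℝ) :
    Matrix.toEuclideanCLM (n := Fin d) (𝕜 := ℝ) S.P.transpose (WithLp.toLp 2 g)
      = ∑ k, g k • S.axis k := by
  ext i
  rw [Matrix.ofLp_toEuclideanCLM, Matrix.mulVec, dotProduct, WithLp.ofLp_sum, Finset.sum_apply]
  refine Finset.sum_congr rfl fun k _ => ?_
  rw [mul_comm]
  rfl

theorem axis_ne_zero (S : Model d) (k : Fin d) : S.axis k ≠ 0 := by
  intro h
  have := S.inner_axis_axis k k
  simp [h] at this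

/-- Evaluating the quadratic form of A at the k-th row of P gives exactly the k-th eigenvalue. -/
theorem lam_pos (S : Model d) (k : Fin d) : 0 < S.lam k := by
  have h1 := (Matrix.posDef_iff_dotProduct_mulVec.1 S.posDef).2 (x := S.P k)
    fun h0 => S.axis_ne_zero k (by ext i; simp [axis, h0])
  have h2 : S.P.mulVec (S.P k) = Pi.single k 1 := by
    ext l
    have := S.inner_axis_axis l k
    rw [← mulVec_apply_eq_inner] at this
    rw [Pi.single_apply]
    exact this
  rw [S.diagonalization, ← Matrix.mulVec_mulVec, ← Matrix.mulVec_mulVec, h2,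
    Matrix.dotProduct_mulVec, star_trivial, Matrix.vecMul_transpose, h2] at h1
  simpa [Matrix.mulVec_diagonal] using h1

theorem inner_pow_left (S : Model d) (s : ℝ) (u v : Space d) :
    inner ℝ (S.pow s u) v = inner ℝ u (S.pow s v) := by
  simp only [pow_apply, sum_inner, inner_sum, inner_smul_left, inner_smul_right, conj_trivial]
  refine Finset.sum_congr rfl fun k _ => ?_
  rw [real_inner_comm (S.axis k) u]
  ring

theorem pow_pow (S : Model d) (s t : ℝ) (u : Space d) :
    S.pow s (S.pow t u) = S.pow (s + t) u := by
  simp only [pow_apply, inner_sum, inner_smul_right, inner_axis_axis, mul_ite, mul_one, mul_zero,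
    Finset.sum_ite_eq, Finset.mem_univ, if_true, ← mul_assoc, Real.rpow_add (S.lam_pos _)]

end Model

/-- The chain rule, used with γ moving only the time variable and with γ moving the space variables
through `toHat`. -/
theorem hasFDerivAt_eval {σ E : Type*} [Fintype σ] [NormedAddCommGroup E] [NormedSpace ℝ E]
    {γ : E → σ → ℝ} {γ' : σ → E →L[ℝ] ℝ} {x : E} (hγ : ∀ o, HasFDerivAt (fun x => γ x o) (γ' o) x)
    (b : MvPolynomial σ ℝ) : HasFDerivAt (fun x => MvPolynomial.eval (γ x) b)
      (∑ o, MvPolynomial.eval (γ x) (MvPolynomial.pderiv o b) • γ' o) x := by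
  classical
  induction b using MvPolynomial.induction_on with
  | C a => simpa using hasFDerivAt_const a x
  | add p q hp hq => simpa [add_smul, Finset.sum_add_distrib] using hp.fun_add hq
  | mul_X p o hp =>
    have h1 := hp.mul (hγ o)
    simp only [map_mul, MvPolynomial.eval_X]
    refine h1.congr_fderiv ?_
    simp only [Derivation.leibniz, MvPolynomial.pderiv_X, map_add, smul_eq_mul, map_mul,
      MvPolynomial.eval_X, add_smul, Finset.sum_add_distrib, Finset.smul_sum, mul_smul]
    congr 1
    rw [Finset.sum_eq_single o]
    · simp
    · intro i _ hi
      simp [hi.symm]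
    · simp
end TrefftzDG

/-! ### Polynomial potentials, their energy and their flux -/

namespace TrefftzDG

variable {d : ℕ}

theorem continuous_polyEval (b : MvPolynomial (Option (Fin d)) ℝ) :
    Continuous fun z : Space d × ℝ => polyEval b z.1 z.2 := by
  refine (MvPolynomial.continuous_eval b).comp (continuous_pi fun o => ?_)
  rcases o with _ | i
  · exact continuous_snd
  · simp only [Option.elim_some]
    fun_prop

theorem hasDerivAt_polyEval (b : MvPolynomial (Option (Fin d)) ℝ) (x : Space d) (t : ℝ) :
    HasDerivAt (fun t => polyEval b x t) (polyEval (MvPolynomial.pderiv none b) x t) t := by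
  have h := hasFDerivAt_eval (E := ℝ) (x := t)
    (γ := fun t o => o.elim t (fun i : Fin d => x i))
    (γ' := fun o => o.elim (ContinuousLinearMap.id ℝ ℝ) fun _ => 0) (fun o => by
      rcases o with _ | i
      · exact hasFDerivAt_id t
      · exact hasFDerivAt_const _ t) b
  have h2 := h.hasDerivAt
  simp only [Fintype.sum_option, Option.elim_none, Option.elim_some, smul_zero,
    Finset.sum_const_zero, add_zero, _root_.smul_apply, ContinuousLinearMap.id_apply,
    smul_eq_mul, mul_one] at h2
  exact h2

/-- The commutator of two derivations is a derivation, and this one kills the variables. -/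
theorem pderiv_pderiv_comm {σ R : Type*} [CommRing R] (i j : σ) (f : MvPolynomial σ R) :
    MvPolynomial.pderiv i (MvPolynomial.pderiv j f)
      = MvPolynomial.pderiv j (MvPolynomial.pderiv i f) := by
  classical
  have h : ⁅(MvPolynomial.pderiv (R := R) i : Derivation R (MvPolynomial σ R) (MvPolynomial σ R)),
      (MvPolynomial.pderiv (R := R) j : Derivation R (MvPolynomial σ R) (MvPolynomial σ R))⁆
        = 0 := by
    refine MvPolynomial.derivation_ext fun k => ?_
    simp [Derivation.commutator_apply, MvPolynomial.pderiv_X, Pi.single_apply, apply_ite]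
  have h2 := DFunLike.congr_fun h f
  rwa [Derivation.commutator_apply, Derivation.zero_apply, sub_eq_zero] at h2

namespace Model

theorem continuous_polyEval_toHat (S : Model d) (b : MvPolynomial (Option (Fin d)) ℝ) :
    Continuous fun z : Space d × ℝ => polyEval b (S.toHat z.1) z.2 :=
  (continuous_polyEval b).comp (f := fun z : Space d × ℝ => (S.toHat z.1, z.2)) (by fun_prop)

theorem hasFDerivAt_polyEval_toHat (S : Model d) (b : MvPolynomial (Option (Fin d)) ℝ)
    (x : Space d) (t : ℝ) : HasFDerivAt (fun x => polyEval b (S.toHat x) t)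
      (∑ k, polyEval (MvPolynomial.pderiv (some k) b) (S.toHat x) t •
        (EuclideanSpace.proj (𝕜 := ℝ) k ∘L S.toHat)) x := by
  have h := hasFDerivAt_eval (E := Space d) (x := x)
    (γ := fun x o => o.elim t (fun i : Fin d => S.toHat x i))
    (γ' := fun o => o.elim 0 fun k => EuclideanSpace.proj (𝕜 := ℝ) k ∘L S.toHat) (fun o => by
      rcases o with _ | i
      · exact hasFDerivAt_const t x
      · exact (EuclideanSpace.proj (𝕜 := ℝ) i ∘L S.toHat).hasFDerivAt) b
  simp only [Fintype.sum_option, Option.elim_none, Option.elim_some, smul_zero, zero_add] at h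
  exact h

theorem contDiff_polyEval_toHat (S : Model d) (b : MvPolynomial (Option (Fin d)) ℝ) (t : ℝ) :
    ContDiff ℝ 1 fun x => polyEval b (S.toHat x) t := by
  rw [contDiff_one_iff_fderiv]
  refine ⟨fun x => (S.hasFDerivAt_polyEval_toHat b x t).differentiableAt, ?_⟩
  have h : fderiv ℝ (fun x => polyEval b (S.toHat x) t) = fun x =>
      ∑ k, polyEval (MvPolynomial.pderiv (some k) b) (S.toHat x) t •
        (EuclideanSpace.proj (𝕜 := ℝ) k ∘L S.toHat) :=
    funext fun x => (S.hasFDerivAt_polyEval_toHat b x t).fderiv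
  rw [h]
  refine continuous_finsetSum _ fun k _ => ?_
  exact ((S.continuous_polyEval_toHat _).comp
    (f := fun x : Space d => (x, t)) (by fun_prop)).smul continuous_const

/-- The directions which `toHat` maps to the coordinate directions. -/
noncomputable def hatDir (S : Model d) (k : Fin d) : Space d :=
  S.lam k ^ (1 / 2 : ℝ) • S.axis k

theorem toHat_hatDir (S : Model d) (k l : Fin d) :
    S.toHat (S.hatDir k) l = if l = k then 1 else 0 := by
  rw [toHat_apply, hatDir, inner_smul_right, inner_axis_axis]
  split_ifs with h
  · rw [h, mul_one, ← Real.rpow_add (S.lam_pos k)]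
    norm_num
  · simp

theorem fderiv_polyEval_toHat (S : Model d) (b : MvPolynomial (Option (Fin d)) ℝ)
    (x : Space d) (t : ℝ) (k : Fin d) : fderiv ℝ (fun x => polyEval b (S.toHat x) t) x (S.hatDir k)
      = polyEval (MvPolynomial.pderiv (some k) b) (S.toHat x) t := by
  rw [(S.hasFDerivAt_polyEval_toHat b x t).fderiv]
  simp [toHat_hatDir]

/-- A^(1/2)Pᵀ sends the k-th basis vector to the direction that `toHat` sends back to it. Hence the
divergence of an A^(1/2)-weighted field is the ordinary divergence in the transformed coordinates,
and the anisotropy disappears. -/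
theorem pow_half_transpose_apply (S : Model d) (g : Fin d → ℝ) :
    S.pow (1 / 2) (Matrix.toEuclideanCLM (n := Fin d) (𝕜 := ℝ) S.P.transpose (WithLp.toLp 2 g))
      = ∑ k, g k • S.hatDir k := by
  rw [transpose_apply, pow_apply]
  refine Finset.sum_congr rfl fun k _ => ?_
  simp [inner_sum, inner_smul_right, inner_axis_axis, hatDir, smul_smul, mul_comm]

/-- The energy density of two potentials. -/
noncomputable def energyPoly (S : Model d) (b b' : MvPolynomial (Option (Fin d)) ℝ) :
    MvPolynomial (Option (Fin d)) ℝ :=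
  MvPolynomial.C ((S.c ^ 2)⁻¹) * MvPolynomial.pderiv none b * MvPolynomial.pderiv none b'
    + ∑ k, MvPolynomial.pderiv (some k) b * MvPolynomial.pderiv (some k) b'

/-- The components of the energy flux of two potentials. -/
noncomputable def fluxPoly (b b' : MvPolynomial (Option (Fin d)) ℝ) (k : Fin d) :
    MvPolynomial (Option (Fin d)) ℝ :=
  MvPolynomial.pderiv none b * MvPolynomial.pderiv (some k) b'
    + MvPolynomial.pderiv none b' * MvPolynomial.pderiv (some k) b

/-- Local conservation of energy: expand both sides by the product rule and exchange c⁻²∂ₜ² for the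
Laplacian in each potential. -/
theorem pderiv_energyPoly (S : Model d) {q : ℕ} {b b' : MvPolynomial (Option (Fin d)) ℝ}
    (hb : IsWavePolynomial S.c q b) (hb' : IsWavePolynomial S.c q b') :
    MvPolynomial.pderiv none (S.energyPoly b b')
      = ∑ k, MvPolynomial.pderiv (some k) (fluxPoly b b' k) := by
  have h1 := hb.2
  have h2 := hb'.2
  rw [neg_add_eq_zero] at h1 h2
  have hcomm : ∀ (f : MvPolynomial (Option (Fin d)) ℝ) (k : Fin d),
      MvPolynomial.pderiv (some k) (MvPolynomial.pderiv none f)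
        = MvPolynomial.pderiv none (MvPolynomial.pderiv (some k) f) := fun f k =>
    pderiv_pderiv_comm _ _ f
  have e1 : ∀ k, MvPolynomial.pderiv (some k) (fluxPoly b b' k)
      = (MvPolynomial.pderiv (some k) b * MvPolynomial.pderiv none (MvPolynomial.pderiv (some k) b')
        + MvPolynomial.pderiv (some k) b' *
          MvPolynomial.pderiv none (MvPolynomial.pderiv (some k) b))
        + (MvPolynomial.pderiv none b *
            MvPolynomial.pderiv (some k) (MvPolynomial.pderiv (some k) b')
          + MvPolynomial.pderiv none b' *
            MvPolynomial.pderiv (some k) (MvPolynomial.pderiv (some k) b)) := by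
    intro k
    simp only [fluxPoly, map_add, Derivation.leibniz, smul_eq_mul, hcomm]
    ring
  simp only [e1, Finset.sum_add_distrib, ← Finset.mul_sum, h1, h2, energyPoly, map_add, map_sum,
    Derivation.leibniz, smul_eq_mul, MvPolynomial.pderiv_C, mul_zero, add_zero]
  ring

theorem energy_trefftzField (S : Model d) (b b' : MvPolynomial (Option (Fin d)) ℝ) (x : Space d)
    (t : ℝ) : (S.c ^ 2)⁻¹ * (S.trefftzField b).1 x t * (S.trefftzField b').1 x t
        + inner ℝ ((S.trefftzField b).2 x t) ((S.trefftzField b').2 x t)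
      = polyEval (S.energyPoly b b') (S.toHat x) t := by
  simp only [trefftzField, transpose_apply, inner_neg_left, inner_neg_right, neg_neg, sum_inner,
    inner_sum, inner_smul_left, inner_smul_right, inner_axis_axis, conj_trivial, energyPoly,
    polyEval, map_add, map_mul, map_sum, MvPolynomial.eval_C, mul_ite, mul_one, mul_zero,
    Finset.sum_ite_eq', Finset.mem_univ, if_true, mul_neg, Finset.sum_neg_distrib, neg_neg]
  congr 1
  exact Finset.sum_congr rfl fun k _ => mul_comm _ _

/-- The minus sign is the one in the vector component -Pᵀ∇b; it makes this flux the outflow of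
energy. -/
theorem flux_trefftzField (S : Model d) (b b' : MvPolynomial (Option (Fin d)) ℝ) (x n : Space d)
    (t : ℝ) : (S.trefftzField b).1 x t * inner ℝ (S.pow (1 / 2) ((S.trefftzField b').2 x t)) n
        + (S.trefftzField b').1 x t * inner ℝ (S.pow (1 / 2) ((S.trefftzField b).2 x t)) n
      = -∑ k, polyEval (fluxPoly b b' k) (S.toHat x) t * inner ℝ n (S.hatDir k) := by
  rw [real_inner_comm n, real_inner_comm n]
  simp only [trefftzField, map_neg, pow_half_transpose_apply, inner_neg_right, inner_sum,
    inner_smul_right, fluxPoly, polyEval, map_add, map_mul, add_mul,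
    Finset.sum_add_distrib, mul_neg, Finset.mul_sum, neg_add, mul_assoc]

end Model

/-! ### The surface measures -/

theorem isFiniteMeasure_restrict_frontier {K : Set (Space d)} (hK : IsPolytope K)
    {F : Set (Space d)} (hF : F ⊆ frontier K) :
    IsFiniteMeasure ((μHE[d - 1] : Measure (Space d)).restrict F) :=
  ⟨by
    rw [Measure.restrict_apply_univ]
    exact (measure_mono hF).trans_lt hK.measure_frontier_lt_top⟩

theorem isFiniteMeasure_lateral {K : Set (Space d)} (hK : IsPolytope K)
    {F : Set (Space d)} (hF : F ⊆ frontier K) (a b : ℝ) : IsFiniteMeasure (lateral F a b) := by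
  have := isFiniteMeasure_restrict_frontier hK hF
  rw [lateral]
  infer_instance

theorem ae_lateral_fst {K : Set (Space d)} (hK : IsPolytope K) {F : Set (Space d)}
    (hF : F ⊆ frontier K) (a b : ℝ) {p : Space d → Prop}
    (hp : ∀ᵐ x ∂(μHE[d - 1] : Measure (Space d)).restrict F, p x) :
    ∀ᵐ z ∂lateral F a b, p z.1 := by
  have := isFiniteMeasure_restrict_frontier hK hF
  rw [lateral]
  exact Measure.quasiMeasurePreserving_fst.ae hp

theorem ae_lateral_mem {K : Set (Space d)} (hK : IsPolytope K) {F : Set (Space d)}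
    (hF : F ⊆ frontier K) (hm : MeasurableSet F) (a b : ℝ) :
    ∀ᵐ z ∂lateral F a b, z ∈ F ×ˢ Ioo a b := by
  have := isFiniteMeasure_restrict_frontier hK hF
  rw [lateral]
  have h1 : ∀ᵐ z ∂((μHE[d - 1] : Measure (Space d)).restrict F).prod
      ((volume : Measure ℝ).restrict (Ioo a b)), z.1 ∈ F :=
    Measure.quasiMeasurePreserving_fst.ae (ae_restrict_mem hm)
  have h2 : ∀ᵐ z ∂((μHE[d - 1] : Measure (Space d)).restrict F).prod
      ((volume : Measure ℝ).restrict (Ioo a b)), z.2 ∈ Ioo a b :=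
    Measure.quasiMeasurePreserving_snd.ae (ae_restrict_mem measurableSet_Ioo)
  filter_upwards [h1, h2] with z hz1 hz2 using ⟨hz1, hz2⟩

/-- Integrability is always checked through essential boundedness, which survives products and inner
products and implies integrability for the finite measures of the faces. -/
theorem memLp_top_of_continuous {X E : Type*} [MeasurableSpace X] [PseudoMetricSpace X]
    [ProperSpace X] [OpensMeasurableSpace X] [SecondCountableTopology X] [NormedAddCommGroup E]
    {μ : Measure X} {B : Set X}
    (hB : Bornology.IsBounded B) (hμ : ∀ᵐ x ∂μ, x ∈ B) {g : X → E} (hg : Continuous g) :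
    MemLp g ⊤ μ := by
  obtain ⟨C, hC⟩ := hB.isCompact_closure.exists_bound_of_continuousOn hg.continuousOn
  exact memLp_top_of_bound hg.aestronglyMeasurable C
    (hμ.mono fun x hx => hC x (subset_closure hx))

theorem IsPolytope.isFiniteMeasure_restrict {K : Set (Space d)} (hK : IsPolytope K) :
    IsFiniteMeasure ((volume : Measure (Space d)).restrict K) :=
  ⟨by
    rw [Measure.restrict_apply_univ]
    exact hK.isBounded.measure_lt_top⟩

theorem IsPolytope.isBounded_frontier {K : Set (Space d)} (hK : IsPolytope K) :
    Bornology.IsBounded (frontier K) :=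
  hK.isBounded.closure.subset frontier_subset_closure

theorem memLp_top_volume {K : Set (Space d)} (hK : IsPolytope K) {E : Type*}
    [NormedAddCommGroup E] {g : Space d → E} (hg : Continuous g) :
    MemLp g ⊤ (volume.restrict K) :=
  memLp_top_of_continuous hK.isBounded (ae_restrict_mem hK.isOpen.measurableSet) hg

theorem memLp_top_lateral {K : Set (Space d)} (hK : IsPolytope K) {F : Set (Space d)}
    (hF : F ⊆ frontier K) (hm : MeasurableSet F) (a b : ℝ) {E : Type*} [NormedAddCommGroup E]
    {g : Space d × ℝ → E} (hg : Continuous g) : MemLp g ⊤ (lateral F a b) :=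
  memLp_top_of_continuous ((hK.isBounded_frontier.subset hF).prod (Metric.isBounded_Ioo a b))
    (ae_lateral_mem hK hF hm a b) hg

theorem memLp_top_outwardNormal {K : Set (Space d)} (hK : IsPolytope K) {F : Set (Space d)}
    (hF : F ⊆ frontier K) (a b : ℝ) :
    MemLp (fun z : Space d × ℝ => outwardNormal K z.1) ⊤ (lateral F a b) := by
  have := isFiniteMeasure_restrict_frontier hK hF
  refine memLp_top_of_bound ?_ 1 (Filter.Eventually.of_forall fun z => norm_outwardNormal_le K z.1)
  rw [lateral]
  exact (hK.aestronglyMeasurable_outwardNormal.mono_measure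
    (Measure.restrict_mono hF le_rfl)).comp_quasiMeasurePreserving
      Measure.quasiMeasurePreserving_fst

/-! ### The energy balance on an element -/

/-- Energy balance of two Trefftz fields on the element `K × (a, b)`. -/
theorem IsPolytope.energy_balance {K : Set (Space d)} (hK : IsPolytope K) (S : Model d) {q : ℕ}
    {b b' : MvPolynomial (Option (Fin d)) ℝ} (hb : IsWavePolynomial S.c q b)
    (hb' : IsWavePolynomial S.c q b') {t₀ t₁ : ℝ} (ht : t₀ ≤ t₁) :
    (∫ x in K, polyEval (S.energyPoly b b') (S.toHat x) t₁)
      - (∫ x in K, polyEval (S.energyPoly b b') (S.toHat x) t₀)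
      = ∫ z, ∑ k, polyEval (Model.fluxPoly b b' k) (S.toHat z.1) z.2 *
          inner ℝ (outwardNormal K z.1) (S.hatDir k) ∂(lateral (frontier K) t₀ t₁) := by
  have hfin := hK.isFiniteMeasure_restrict
  have hfin' := isFiniteMeasure_restrict_frontier hK subset_rfl
  have hfinl := isFiniteMeasure_lateral hK subset_rfl t₀ t₁
  have hcont : ∀ (f : MvPolynomial (Option (Fin d)) ℝ) (t : ℝ),
      Continuous fun x => polyEval f (S.toHat x) t := fun f t => (S.contDiff_polyEval_toHat f t).continuous
  have hint : ∀ (f : MvPolynomial (Option (Fin d)) ℝ) (t : ℝ),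
      Integrable (fun x => polyEval f (S.toHat x) t) (volume.restrict K) := fun f t =>
    (memLp_top_volume hK (hcont f t)).integrable le_top
  have hint2 : Integrable (Function.uncurry fun (x : Space d) (t : ℝ) =>
      polyEval (MvPolynomial.pderiv none (S.energyPoly b b')) (S.toHat x) t)
      ((volume.restrict K).prod (volume.restrict (Ioo t₀ t₁))) := by
    refine (memLp_top_of_continuous (hK.isBounded.prod (Metric.isBounded_Ioo t₀ t₁)) ?_
      (S.continuous_polyEval_toHat _)).integrable le_top
    rw [Measure.prod_restrict]
    exact ae_restrict_mem (hK.isOpen.measurableSet.prod measurableSet_Ioo)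
  have hint3 : Integrable (fun z : Space d × ℝ => ∑ k, polyEval (Model.fluxPoly b b' k) (S.toHat z.1) z.2 *
          inner ℝ (outwardNormal K z.1) (S.hatDir k)) (lateral (frontier K) t₀ t₁) := by
    refine integrable_finsetSum _ fun k _ => ?_
    have h1 := memLp_top_lateral hK subset_rfl isClosed_frontier.measurableSet t₀ t₁
      (S.continuous_polyEval_toHat (Model.fluxPoly b b' k))
    have h2 := (memLp_top_outwardNormal hK subset_rfl t₀ t₁).inner_const (𝕜 := ℝ) (S.hatDir k)
    exact (h2.mul' h1).integrable le_top
  rw [lateral] at hint3 ⊢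
  -- Fubini with time outermost, so that the space divergence theorem can be applied at each fixed
  -- time. On the left, the difference of energies is an integral in time, and the order is
  -- exchanged.
  rw [integral_prod_symm _ hint3, ← integral_sub (hint _ _) (hint _ _)]
  have h1 : ∀ x : Space d, polyEval (S.energyPoly b b') (S.toHat x) t₁
      - polyEval (S.energyPoly b b') (S.toHat x) t₀
      = ∫ t in Ioo t₀ t₁, polyEval (MvPolynomial.pderiv none (S.energyPoly b b')) (S.toHat x) t := by
    intro x
    rw [← integral_Ioc_eq_integral_Ioo, ← intervalIntegral.integral_of_le ht]
    refine (intervalIntegral.integral_eq_sub_of_hasDerivAt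
      (fun t _ => hasDerivAt_polyEval _ _ t) ?_).symm
    apply Continuous.intervalIntegrable
    exact (S.continuous_polyEval_toHat _).comp (f := fun t : ℝ => (x, t)) (by fun_prop)
  simp only [h1]
  rw [integral_integral_swap hint2]
  refine integral_congr_ae (Filter.Eventually.of_forall fun t => ?_)
  simp only
  rw [S.pderiv_energyPoly hb hb']
  -- The k-th transformed derivative is the derivative along `hatDir k` in the original variables,
  -- which is the form in which the divergence theorem is available.
  have h2 : ∀ x : Space d, polyEval (∑ k, MvPolynomial.pderiv (some k) (Model.fluxPoly b b' k))
      (S.toHat x) t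
      = ∑ k, fderiv ℝ (fun x => polyEval (Model.fluxPoly b b' k) (S.toHat x) t) x (S.hatDir k) := by
    intro x
    simp only [S.fderiv_polyEval_toHat]
    simp only [polyEval, map_sum]
  simp only [h2]
  rw [integral_finsetSum, integral_finsetSum]
  · exact Finset.sum_congr rfl fun k _ => hK.integral_fderiv (S.contDiff_polyEval_toHat _ t) _
  · intro k _
    have h3 : MemLp (fun x => polyEval (Model.fluxPoly b b' k) (S.toHat x) t) ⊤
        ((μHE[d - 1] : Measure (Space d)).restrict (frontier K)) :=
      memLp_top_of_continuous hK.isBounded_frontier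
        (ae_restrict_mem isClosed_frontier.measurableSet) (hcont _ t)
    have h4 : MemLp (outwardNormal K) ⊤
        ((μHE[d - 1] : Measure (Space d)).restrict (frontier K)) :=
      memLp_top_of_bound hK.aestronglyMeasurable_outwardNormal 1
        (Filter.Eventually.of_forall fun x => norm_outwardNormal_le K x)
    exact ((h4.inner_const (𝕜 := ℝ) (S.hatDir k)).mul' h3).integrable le_top
  · intro k _
    simp only [S.fderiv_polyEval_toHat]
    exact hint _ t

end TrefftzDG

namespace TrefftzDG

variable {d : ℕ}

/-! ### The local Trefftz space -/

/-- As a function of t the polynomial is analytic with zero Taylor series at t₀. -/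
theorem polyEval_eq_zero_of_iterate {f : MvPolynomial (Option (Fin d)) ℝ} {y : Space d} {t₀ : ℝ}
    (h : ∀ m : ℕ, polyEval ((MvPolynomial.pderiv none)^[m] f) y t₀ = 0) (t : ℝ) :
    polyEval f y t = 0 := by
  have hit : ∀ (m : ℕ), iteratedDeriv m (fun t => polyEval f y t)
      = fun t => polyEval ((MvPolynomial.pderiv none)^[m] f) y t := by
    intro m
    induction m with
    | zero => simp
    | succ m ih =>
      rw [iteratedDeriv_succ, ih, Function.iterate_succ_apply']
      exact funext fun t => (hasDerivAt_polyEval _ y t).deriv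
  have han : AnalyticOnNhd ℝ (fun t => polyEval f y t) univ := fun t _ => by
    refine AnalyticAt.aeval_mvPolynomial
      (f := fun (t : ℝ) (o : Option (Fin d)) => o.elim t (fun i => y i)) (fun o => ?_) f
    rcases o with _ | i
    · exact analyticAt_id
    · exact analyticAt_const
  have hps := (han t₀ (mem_univ _)).hasFPowerSeriesAt
  have hzero : (FormalMultilinearSeries.ofScalars ℝ
      fun n => iteratedDeriv n (fun t => polyEval f y t) t₀ / (n.factorial : ℝ)) = 0 := by
    ext n
    simp [FormalMultilinearSeries.ofScalars, hit, h]
  rw [hzero] at hps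
  exact congrFun (han.eq_of_eventuallyEq (g := fun _ => (0 : ℝ)) analyticOnNhd_const
    hps.eventually_eq_zero) t

namespace Model

/-- The identity theorem for analytic functions. -/
theorem polyEval_toHat_eq_zero_of_isOpen (S : Model d) {K : Set (Space d)} (hK : IsOpen K)
    (hne : K.Nonempty) {f : MvPolynomial (Option (Fin d)) ℝ} {t : ℝ}
    (h : ∀ x ∈ K, polyEval f (S.toHat x) t = 0) (x : Space d) :
    polyEval f (S.toHat x) t = 0 := by
  have han : AnalyticOnNhd ℝ (fun x => polyEval f (S.toHat x) t) univ := fun x _ => by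
    refine AnalyticAt.aeval_mvPolynomial
      (f := fun (x : Space d) (o : Option (Fin d)) => o.elim t (fun i => S.toHat x i))
      (fun o => ?_) f
    rcases o with _ | i
    · exact analyticAt_const
    · exact (EuclideanSpace.proj (𝕜 := ℝ) i ∘L S.toHat).analyticAt x
  obtain ⟨x₀, hx₀⟩ := hne
  exact congrFun (han.eq_of_eventuallyEq (g := fun _ => (0 : ℝ)) analyticOnNhd_const
    (z₀ := x₀) (by filter_upwards [hK.mem_nhds hx₀] with x hx using h x hx)) x

theorem polyEval_toHat_pderiv_eq_zero (S : Model d) {f : MvPolynomial (Option (Fin d)) ℝ} {t : ℝ}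
    (h : ∀ x, polyEval f (S.toHat x) t = 0) (k : Fin d) (x : Space d) :
    polyEval (MvPolynomial.pderiv (some k) f) (S.toHat x) t = 0 := by
  rw [← S.fderiv_polyEval_toHat f x t k]
  simp [h]

/-- Uniqueness in the Cauchy problem for polynomial solutions of the wave equation. -/
theorem polyEval_toHat_eq_zero_of_cauchy (S : Model d) {f : MvPolynomial (Option (Fin d)) ℝ}
    (hf : -(∑ i : Fin d, MvPolynomial.pderiv (some i) (MvPolynomial.pderiv (some i) f)) +
      MvPolynomial.C ((S.c ^ 2)⁻¹) * MvPolynomial.pderiv none (MvPolynomial.pderiv none f) = 0)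
    {t₀ : ℝ} (h0 : ∀ x, polyEval f (S.toHat x) t₀ = 0)
    (h1 : ∀ x, polyEval (MvPolynomial.pderiv none f) (S.toHat x) t₀ = 0) (x : Space d) (t : ℝ) :
    polyEval f (S.toHat x) t = 0 := by
  have hc : (S.c ^ 2)⁻¹ ≠ 0 := inv_ne_zero (pow_ne_zero 2 S.c_pos.ne')
  -- The wave equation trades two time derivatives for a Laplacian in space, and a Laplacian of
  -- something zero on the whole time slice is zero there.
  have hstep : ∀ m : ℕ, MvPolynomial.C ((S.c ^ 2)⁻¹) *
      (MvPolynomial.pderiv none)^[m + 2] f = ∑ i : Fin d, MvPolynomial.pderiv (some i)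
        (MvPolynomial.pderiv (some i) ((MvPolynomial.pderiv none)^[m] f)) := by
    intro m
    induction m with
    | zero =>
      rw [neg_add_eq_zero] at hf
      exact hf.symm
    | succ m ih =>
      have h2 := congrArg (MvPolynomial.pderiv none) ih
      rw [Derivation.leibniz, MvPolynomial.pderiv_C, smul_zero, add_zero, smul_eq_mul,
        ← Function.iterate_succ_apply' (f := ⇑(MvPolynomial.pderiv none)), map_sum] at h2
      rw [h2]
      refine Finset.sum_congr rfl fun i _ => ?_
      rw [Function.iterate_succ_apply', pderiv_pderiv_comm none, pderiv_pderiv_comm none]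
  -- Two consecutive orders are carried along because the recursion has step two.
  have hz : ∀ m : ℕ, (∀ x, polyEval ((MvPolynomial.pderiv none)^[m] f) (S.toHat x) t₀ = 0) ∧
      ∀ x, polyEval ((MvPolynomial.pderiv none)^[m + 1] f) (S.toHat x) t₀ = 0 := by
    intro m
    induction m with
    | zero => exact ⟨h0, h1⟩
    | succ m ih =>
      refine ⟨ih.2, fun x => ?_⟩
      have h2 := congrArg (fun g => polyEval g (S.toHat x) t₀) (hstep m)
      have h3 : ∀ i, polyEval (MvPolynomial.pderiv (some i)
          (MvPolynomial.pderiv (some i) ((MvPolynomial.pderiv none)^[m] f))) (S.toHat x) t₀ = 0 :=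
        fun i => S.polyEval_toHat_pderiv_eq_zero (S.polyEval_toHat_pderiv_eq_zero ih.1 i) i x
      simp only [polyEval, map_mul, map_sum, MvPolynomial.eval_C] at h2 h3
      rw [Finset.sum_eq_zero fun i _ => h3 i, mul_eq_zero] at h2
      exact h2.resolve_left hc
  exact polyEval_eq_zero_of_iterate (fun m => (hz m).1 x) t

/-- The field determines only the derivatives of b, so Cauchy uniqueness is applied to each ∂b,
which again solves the wave equation. The missing initial time derivative comes from the equation
itself for ∂ₜb, and from differentiating the vanishing ∂ₜb in space for the space derivatives. -/
theorem trefftzField_eq_zero (S : Model d) {q : ℕ} {b : MvPolynomial (Option (Fin d)) ℝ}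
    (hb : IsWavePolynomial S.c q b) {K : Set (Space d)} (hK : IsOpen K) (hne : K.Nonempty) {t₀ : ℝ}
    (h1 : ∀ x ∈ K, (S.trefftzField b).1 x t₀ = 0) (h2 : ∀ x ∈ K, (S.trefftzField b).2 x t₀ = 0) :
    S.trefftzField b = 0 := by
  have hc : S.c ^ 2 ≠ 0 := pow_ne_zero 2 S.c_pos.ne'
  have hwave := hb.2
  have hD : ∀ o : Option (Fin d),
      -(∑ i : Fin d, MvPolynomial.pderiv (some i) (MvPolynomial.pderiv (some i)
        (MvPolynomial.pderiv o b))) + MvPolynomial.C ((S.c ^ 2)⁻¹) *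
          MvPolynomial.pderiv none (MvPolynomial.pderiv none (MvPolynomial.pderiv o b)) = 0 := by
    intro o
    have h3 := congrArg (MvPolynomial.pderiv o) hwave
    simp only [map_add, map_neg, map_sum, Derivation.leibniz, MvPolynomial.pderiv_C,
      add_zero, mul_zero, smul_eq_mul, map_zero, pderiv_pderiv_comm o] at h3
    exact h3
  have ht : ∀ x, polyEval (MvPolynomial.pderiv none b) (S.toHat x) t₀ = 0 :=
    S.polyEval_toHat_eq_zero_of_isOpen hK hne h1
  have hk : ∀ k x, polyEval (MvPolynomial.pderiv (some k) b) (S.toHat x) t₀ = 0 := by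
    intro k
    refine S.polyEval_toHat_eq_zero_of_isOpen hK hne fun x hx => ?_
    have h3 := congrArg (fun u => inner ℝ (S.axis k) u) (h2 x hx)
    simp only [trefftzField] at h3
    rw [transpose_apply] at h3
    simpa [inner_sum, inner_smul_right, inner_axis_axis] using h3
  have htt : ∀ x, polyEval (MvPolynomial.pderiv none (MvPolynomial.pderiv none b)) (S.toHat x) t₀
      = 0 := by
    intro x
    rw [neg_add_eq_zero] at hwave
    have h3 := congrArg (fun g => polyEval g (S.toHat x) t₀) hwave
    have h4 : ∀ i, polyEval (MvPolynomial.pderiv (some i)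
        (MvPolynomial.pderiv (some i) b)) (S.toHat x) t₀ = 0 :=
      fun i => S.polyEval_toHat_pderiv_eq_zero (hk i) i x
    simp only [polyEval, map_mul, map_sum, MvPolynomial.eval_C] at h3 h4
    rw [Finset.sum_eq_zero fun i _ => h4 i, eq_comm, mul_eq_zero] at h3
    exact h3.resolve_left (inv_ne_zero hc)
  have e1 := S.polyEval_toHat_eq_zero_of_cauchy (hD none) ht htt
  have e2 : ∀ k x t, polyEval (MvPolynomial.pderiv (some k) b) (S.toHat x) t = 0 := fun k =>
    S.polyEval_toHat_eq_zero_of_cauchy (hD (some k)) (hk k) fun x => by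
      rw [pderiv_pderiv_comm]
      exact S.polyEval_toHat_pderiv_eq_zero ht k x
  refine Prod.ext (funext fun x => funext fun t => e1 x t) (funext fun x => funext fun t => ?_)
  simp only [trefftzField]
  rw [transpose_apply]
  simp [e2]

/-- The map from polynomial potentials to Trefftz fields. -/
noncomputable def trefftzMap (S : Model d) : MvPolynomial (Option (Fin d)) ℝ →ₗ[ℝ] Field d where
  toFun := S.trefftzField
  map_add' b b' := by
    refine Prod.ext (funext fun x => funext fun t => ?_) (funext fun x => funext fun t => ?_)
    · simp [trefftzField, polyEval]
    · simp only [trefftzField, transpose_apply, polyEval, map_add, add_smul,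
        Finset.sum_add_distrib, neg_add, Prod.snd_add, Pi.add_apply]
  map_smul' r b := by
    refine Prod.ext (funext fun x => funext fun t => ?_) (funext fun x => funext fun t => ?_)
    · simp [trefftzField, polyEval]
    · simp only [trefftzField, transpose_apply, polyEval, Finset.smul_sum, smul_neg,
        Prod.smul_snd, Pi.smul_apply, MvPolynomial.smul_eval, RingHom.id_apply, smul_smul,
        Derivation.map_smul]

/-- The space of polynomial solutions of the wave equation. -/
noncomputable def wavePolynomials (S : Model d) (q : ℕ) :
    Submodule ℝ (MvPolynomial (Option (Fin d)) ℝ) where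
  carrier := {b | IsWavePolynomial S.c q b}
  zero_mem' := ⟨Submodule.zero_mem _, by simp⟩
  add_mem' := by
    rintro b b' ⟨h1, h2⟩ ⟨h3, h4⟩
    refine ⟨Submodule.add_mem _ h1 h3, ?_⟩
    have := congrArg₂ (· + ·) h2 h4
    simp only [add_zero] at this
    rw [← this]
    simp only [map_add, Finset.sum_add_distrib]
    ring
  smul_mem' := by
    rintro r b ⟨h1, h2⟩
    refine ⟨Submodule.smul_mem _ r h1, ?_⟩
    have := congrArg (r • ·) h2
    simp only [smul_zero] at this
    rw [← this]
    simp only [Derivation.map_smul, ← Finset.smul_sum, smul_add, smul_neg, mul_smul_comm]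

theorem localTrefftz_eq_map (S : Model d) (p : ℕ) :
    S.localTrefftz p = (S.wavePolynomials (p + 1)).map S.trefftzMap := by
  have h : {u | ∃ b, IsWavePolynomial S.c (p + 1) b ∧ u = S.trefftzField b}
      = ((S.wavePolynomials (p + 1)).map S.trefftzMap : Submodule ℝ (Field d)) := by
    ext u
    constructor
    · rintro ⟨b, hb, rfl⟩
      exact ⟨b, hb, rfl⟩
    · rintro ⟨b, hb, rfl⟩
      exact ⟨b, hb, rfl⟩
  rw [localTrefftz, h, Submodule.span_eq]

/-- The generating fields are the image of a subspace under a linear map, so the span adds nothing: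
every local Trefftz field has a single potential. -/
theorem mem_localTrefftz {S : Model d} {p : ℕ} {u : Field d} :
    u ∈ S.localTrefftz p ↔ ∃ b, IsWavePolynomial S.c (p + 1) b ∧ u = S.trefftzField b := by
  rw [localTrefftz_eq_map]
  constructor
  · rintro ⟨b, hb, rfl⟩
    exact ⟨b, hb, rfl⟩
  · rintro ⟨b, hb, rfl⟩
    exact ⟨b, hb, rfl⟩

theorem fg_localTrefftz (S : Model d) (p : ℕ) : (S.localTrefftz p).FG := by
  rw [localTrefftz_eq_map]
  refine Submodule.FG.map _ ?_
  have hle : S.wavePolynomials (p + 1)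
      ≤ MvPolynomial.restrictTotalDegree (Option (Fin d)) ℝ (p + 1) := fun b hb => hb.1
  have : FiniteDimensional ℝ (S.wavePolynomials (p + 1)) :=
    Submodule.finiteDimensional_of_le hle
  exact Module.Finite.iff_fg.1 this

theorem continuous_of_mem_localTrefftz {S : Model d} {p : ℕ} {u : Field d}
    (hu : u ∈ S.localTrefftz p) :
    (Continuous fun z : Space d × ℝ => u.1 z.1 z.2) ∧
      Continuous fun z : Space d × ℝ => u.2 z.1 z.2 := by
  obtain ⟨b, -, rfl⟩ := mem_localTrefftz.1 hu
  refine ⟨S.continuous_polyEval_toHat _, ?_⟩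
  simp only [trefftzField, transpose_apply]
  exact (continuous_finsetSum _ fun k _ =>
    (S.continuous_polyEval_toHat _).smul continuous_const).neg

theorem eq_zero_of_mem_localTrefftz {S : Model d} {p : ℕ} {u : Field d}
    (hu : u ∈ S.localTrefftz p) {K : Set (Space d)} (hK : IsOpen K) (hne : K.Nonempty) {t₀ : ℝ}
    (h1 : ∀ x ∈ K, u.1 x t₀ = 0) (h2 : ∀ x ∈ K, u.2 x t₀ = 0) : u = 0 := by
  obtain ⟨b, hb, rfl⟩ := mem_localTrefftz.1 hu
  exact S.trefftzField_eq_zero hb hK hne h1 h2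

end Model

namespace Mesh

variable {S : Model d}

theorem mem_trefftzSpace {h : Mesh S} {p : ℕ} {W : h.Broken} :
    W ∈ h.trefftzSpace p ↔ ∀ i n, W i n ∈ S.localTrefftz p := by
  simp [trefftzSpace, Submodule.mem_pi]

theorem finiteDimensional_trefftzSpace (h : Mesh S) (p : ℕ) :
    FiniteDimensional ℝ (h.trefftzSpace p) :=
  Module.Finite.iff_fg.2 (Submodule.fg_pi fun _ => Submodule.fg_pi fun _ => S.fg_localTrefftz p)

end Mesh

end TrefftzDG

namespace TrefftzDG

variable {d : ℕ}

/-! ### Bounded functions on the faces -/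

section Bounded

variable {X : Type*} [MeasurableSpace X] {μ : Measure X}

theorem memLp_top_mul {f g : X → ℝ} (hf : MemLp f ⊤ μ) (hg : MemLp g ⊤ μ) :
    MemLp (fun x => f x * g x) ⊤ μ :=
  hg.mul' hf

theorem memLp_top_smul {E : Type*} [NormedAddCommGroup E] [NormedSpace ℝ E] {f : X → ℝ}
    {g : X → E} (hf : MemLp f ⊤ μ) (hg : MemLp g ⊤ μ) : MemLp (fun x => f x • g x) ⊤ μ :=
  hg.smul hf

theorem memLp_top_sq {f : X → ℝ} (hf : MemLp f ⊤ μ) : MemLp (fun x => f x ^ 2) ⊤ μ := by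
  simpa only [sq] using memLp_top_mul hf hf

theorem memLp_top_inner {E : Type*} [NormedAddCommGroup E] [InnerProductSpace ℝ E] {f g : X → E}
    (hf : MemLp f ⊤ μ) (hg : MemLp g ⊤ μ) : MemLp (fun x => inner ℝ (f x) (g x)) ⊤ μ := by
  refine (memLp_top_mul hf.norm hg.norm).mono (hf.1.inner hg.1)
    (Filter.Eventually.of_forall fun x => ?_)
  exact (norm_inner_le_norm (𝕜 := ℝ) _ _).trans (le_abs_self _)

theorem memLp_top_norm_sq {E : Type*} [NormedAddCommGroup E] [InnerProductSpace ℝ E] {f : X → E}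
    (hf : MemLp f ⊤ μ) : MemLp (fun x => ‖f x‖ ^ 2) ⊤ μ := by
  simpa only [real_inner_self_eq_norm_sq] using memLp_top_inner hf hf

theorem integrable_mul_memLp_top [IsFiniteMeasure μ] {f g : X → ℝ} (hf : MemLp f 2 μ)
    (hg : MemLp g ⊤ μ) : Integrable (fun x => f x * g x) μ :=
  (hg.mul' (r := 2) hf).integrable (by norm_num)

theorem integrable_inner_memLp_top [IsFiniteMeasure μ] {E : Type*} [NormedAddCommGroup E]
    [InnerProductSpace ℝ E] {f g : X → E} (hf : MemLp f 2 μ) (hg : MemLp g ⊤ μ) :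
    Integrable (fun x => inner ℝ (f x) (g x)) μ := by
  refine (integrable_mul_memLp_top hf.norm hg.norm).mono (hf.1.inner hg.1)
    (Filter.Eventually.of_forall fun x => ?_)
  exact (norm_inner_le_norm (𝕜 := ℝ) _ _).trans (le_abs_self _)

theorem memLp_top_rpow {f : X → ℝ} (hf : Measurable f) {a b : ℝ} (ha : 0 < a)
    (hfa : ∀ x, a ≤ f x) (hfb : ∀ x, f x ≤ b) (s : ℝ) : MemLp (fun x => f x ^ s) ⊤ μ := by
  refine memLp_top_of_bound (hf.pow_const s).aestronglyMeasurable (max (a ^ s) (b ^ s))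
    (Filter.Eventually.of_forall fun x => ?_)
  rw [Real.norm_eq_abs, abs_of_nonneg (Real.rpow_nonneg (ha.le.trans (hfa x)) s)]
  rcases le_total 0 s with hs | hs
  · exact (Real.rpow_le_rpow (ha.le.trans (hfa x)) (hfb x) hs).trans (le_max_right _ _)
  · exact (Real.rpow_le_rpow_of_nonpos ha (hfa x) hs).trans (le_max_left _ _)

/-- For an eigenvalue raised to a power that varies with the point, as the powers involving δ do. -/
theorem memLp_top_const_rpow {r : ℝ} (hr : 0 < r) {e : X → ℝ} (he : Measurable e) {b : ℝ}
    (hb : ∀ x, |e x| ≤ b) : MemLp (fun x => r ^ e x) ⊤ μ := by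
  refine memLp_top_of_bound (he.const_pow r).aestronglyMeasurable (Real.exp (|Real.log r| * b))
    (Filter.Eventually.of_forall fun x => ?_)
  rw [Real.norm_eq_abs, abs_of_pos (Real.rpow_pos_of_pos hr _), Real.rpow_def_of_pos hr,
    Real.exp_le_exp]
  refine (le_abs_self _).trans ?_
  rw [abs_mul]
  exact mul_le_mul_of_nonneg_left (hb x) (abs_nonneg _)

theorem Model.memLp_top_pow (S : Model d) {e : X → ℝ} (he : Measurable e) {b : ℝ}
    (hb : ∀ x, |e x| ≤ b) {u : X → Space d} (hu : MemLp u ⊤ μ) :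
    MemLp (fun x => S.pow (e x) (u x)) ⊤ μ := by
  simp only [S.pow_apply]
  refine memLp_finsetSum _ fun k _ => memLp_top_smul (memLp_top_mul
    (memLp_top_const_rpow (S.lam_pos k) he hb) (hu.const_inner (𝕜 := ℝ) (S.axis k))) ?_
  exact memLp_top_const _

theorem Model.memLp_top_pow_const (S : Model d) (s : ℝ) {u : X → Space d} (hu : MemLp u ⊤ μ) :
    MemLp (fun x => S.pow s (u x)) ⊤ μ :=
  S.memLp_top_pow measurable_const (fun _ => le_rfl) hu

end Bounded

namespace Parameters

theorem α_pos (π : Parameters d) (z : Space d × ℝ) : 0 < π.α z := by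
  obtain ⟨a, ha, h⟩ := π.lower
  exact ha.trans_le (h z).1

theorem β_pos (π : Parameters d) (z : Space d × ℝ) : 0 < π.β z := by
  obtain ⟨a, ha, h⟩ := π.lower
  exact ha.trans_le (h z).2

theorem memLp_top_α_rpow (π : Parameters d) (μ : Measure (Space d × ℝ)) (s : ℝ) :
    MemLp (fun z => π.α z ^ s) ⊤ μ := by
  obtain ⟨a, ha, h⟩ := π.lower
  obtain ⟨b, h'⟩ := π.upper
  exact memLp_top_rpow π.measurable_α ha (fun z => (h z).1) (fun z => (h' z).1) s

theorem memLp_top_β_rpow (π : Parameters d) (μ : Measure (Space d × ℝ)) (s : ℝ) :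
    MemLp (fun z => π.β z ^ s) ⊤ μ := by
  obtain ⟨a, ha, h⟩ := π.lower
  obtain ⟨b, h'⟩ := π.upper
  exact memLp_top_rpow π.measurable_β ha (fun z => (h z).2) (fun z => (h' z).2.1) s

theorem memLp_top_α (π : Parameters d) (μ : Measure (Space d × ℝ)) : MemLp π.α ⊤ μ := by
  simpa using π.memLp_top_α_rpow μ 1

theorem memLp_top_β (π : Parameters d) (μ : Measure (Space d × ℝ)) : MemLp π.β ⊤ μ := by
  simpa using π.memLp_top_β_rpow μ 1

/-- The powers of `A` which occur in the formulation preserve boundedness. -/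
theorem memLp_top_pow (π : Parameters d) (S : Model d) {μ : Measure (Space d × ℝ)} (r s : ℝ)
    {u : Space d × ℝ → Space d} (hu : MemLp u ⊤ μ) :
    MemLp (fun z => S.pow (r + s * π.δ z) (u z)) ⊤ μ := by
  obtain ⟨b, h'⟩ := π.upper
  refine S.memLp_top_pow (b := |r| + |s| * b) (by have := π.measurable_δ; fun_prop)
    (fun z => ?_) hu
  refine (abs_add_le _ _).trans (add_le_add_right ?_ _)
  rw [abs_mul]
  exact mul_le_mul_of_nonneg_left (h' z).2.2 (abs_nonneg _)

end Parameters

namespace Mesh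

variable {S : Model d}

/-! ### Integration over the skeleton -/

/-- Integrands on the space-like faces, the time-like faces, the bottom, the top, the Dirichlet
part and the Neumann part of the boundary of the cylinder. -/
abbrev Integrand (h : Mesh S) : Type :=
  (Fin h.m → Fin h.M → Space d → ℝ) ×
  (Fin h.m → Fin h.m → Fin (h.M + 1) → Space d × ℝ → ℝ) ×
  (Fin h.m → Space d → ℝ) × (Fin h.m → Space d → ℝ) ×
  (Fin h.m → Fin (h.M + 1) → Space d × ℝ → ℝ) × (Fin h.m → Fin (h.M + 1) → Space d × ℝ → ℝ)

/-- The surface measure on the time-like face between the elements `i` and `j`. -/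
noncomputable def timeMeasure (h : Mesh S) (i j : Fin h.m) (n : Fin (h.M + 1)) :
    Measure (Space d × ℝ) :=
  lateral (frontier (h.K i) ∩ frontier (h.K j)) (h.time n.castSucc) (h.time n.succ)

/-- The surface measure on the part of the lateral boundary of an element which lies over `Γ`. -/
noncomputable def bdryMeasure (h : Mesh S) (Γ : Set (Space d)) (i : Fin h.m)
    (n : Fin (h.M + 1)) : Measure (Space d × ℝ) :=
  lateral (frontier (h.K i) ∩ Γ) (h.time n.castSucc) (h.time n.succ)

instance (h : Mesh S) (i : Fin h.m) :
    IsFiniteMeasure ((volume : Measure (Space d)).restrict (h.K i)) :=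
  (h.polytope i).isFiniteMeasure_restrict

instance (h : Mesh S) (i j : Fin h.m) (n : Fin (h.M + 1)) :
    IsFiniteMeasure (h.timeMeasure i j n) :=
  isFiniteMeasure_lateral (h.polytope i) inter_subset_left _ _

instance (h : Mesh S) (Γ : Set (Space d)) (i : Fin h.m) (n : Fin (h.M + 1)) :
    IsFiniteMeasure (h.bdryMeasure Γ i n) :=
  isFiniteMeasure_lateral (h.polytope i) inter_subset_left _ _

/-- The integral over the whole skeleton. -/
noncomputable def total (h : Mesh S) (F : h.Integrand) : ℝ :=
  h.intSpace F.1 + h.intTime F.2.1 + h.intSlice F.2.2.1 + h.intSlice F.2.2.2.1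
    + h.intBdry S.ΓD F.2.2.2.2.1 + h.intBdry S.ΓN F.2.2.2.2.2

/-- Integrability on each face of the skeleton. -/
structure IsIntegrable (h : Mesh S) (F : h.Integrand) : Prop where
  space : ∀ i k, Integrable (F.1 i k) (volume.restrict (h.K i))
  time : ∀ i j n, Integrable (F.2.1 i j n) (h.timeMeasure i j n)
  bottom : ∀ i, Integrable (F.2.2.1 i) (volume.restrict (h.K i))
  top : ∀ i, Integrable (F.2.2.2.1 i) (volume.restrict (h.K i))
  dirichlet : ∀ i n, Integrable (F.2.2.2.2.1 i n) (h.bdryMeasure S.ΓD i n)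
  neumann : ∀ i n, Integrable (F.2.2.2.2.2 i n) (h.bdryMeasure S.ΓN i n)

theorem IsIntegrable.add {h : Mesh S} {F G : h.Integrand} (hF : h.IsIntegrable F)
    (hG : h.IsIntegrable G) : h.IsIntegrable (F + G) where
  space i k := (hF.space i k).add (hG.space i k)
  time i j n := (hF.time i j n).add (hG.time i j n)
  bottom i := (hF.bottom i).add (hG.bottom i)
  top i := (hF.top i).add (hG.top i)
  dirichlet i n := (hF.dirichlet i n).add (hG.dirichlet i n)
  neumann i n := (hF.neumann i n).add (hG.neumann i n)

theorem IsIntegrable.smul {h : Mesh S} {F : h.Integrand} (hF : h.IsIntegrable F) (r : ℝ) :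
    h.IsIntegrable (r • F) where
  space i k := (hF.space i k).smul r
  time i j n := (hF.time i j n).smul r
  bottom i := (hF.bottom i).smul r
  top i := (hF.top i).smul r
  dirichlet i n := (hF.dirichlet i n).smul r
  neumann i n := (hF.neumann i n).smul r

theorem intSpace_add (h : Mesh S) {f g : Fin h.m → Fin h.M → Space d → ℝ}
    (hf : ∀ i k, Integrable (f i k) (volume.restrict (h.K i)))
    (hg : ∀ i k, Integrable (g i k) (volume.restrict (h.K i))) :
    h.intSpace (fun i k x => f i k x + g i k x) = h.intSpace f + h.intSpace g := by
  simp only [intSpace, ← Finset.sum_add_distrib]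
  exact Finset.sum_congr rfl fun i _ => Finset.sum_congr rfl fun k _ =>
    integral_add (hf i k) (hg i k)

theorem intTime_add (h : Mesh S) {f g : Fin h.m → Fin h.m → Fin (h.M + 1) → Space d × ℝ → ℝ}
    (hf : ∀ i j n, Integrable (f i j n) (h.timeMeasure i j n))
    (hg : ∀ i j n, Integrable (g i j n) (h.timeMeasure i j n)) :
    h.intTime (fun i j n z => f i j n z + g i j n z) = h.intTime f + h.intTime g := by
  simp only [intTime, ← Finset.sum_add_distrib]
  exact Finset.sum_congr rfl fun i _ => Finset.sum_congr rfl fun j _ =>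
    Finset.sum_congr rfl fun n _ => integral_add (hf i j n) (hg i j n)

theorem intSlice_add (h : Mesh S) {f g : Fin h.m → Space d → ℝ}
    (hf : ∀ i, Integrable (f i) (volume.restrict (h.K i)))
    (hg : ∀ i, Integrable (g i) (volume.restrict (h.K i))) :
    h.intSlice (fun i x => f i x + g i x) = h.intSlice f + h.intSlice g := by
  simp only [intSlice, ← Finset.sum_add_distrib]
  exact Finset.sum_congr rfl fun i _ => integral_add (hf i) (hg i)

theorem intBdry_add (h : Mesh S) {Γ : Set (Space d)}
    {f g : Fin h.m → Fin (h.M + 1) → Space d × ℝ → ℝ}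
    (hf : ∀ i n, Integrable (f i n) (h.bdryMeasure Γ i n))
    (hg : ∀ i n, Integrable (g i n) (h.bdryMeasure Γ i n)) :
    h.intBdry Γ (fun i n z => f i n z + g i n z) = h.intBdry Γ f + h.intBdry Γ g := by
  simp only [intBdry, ← Finset.sum_add_distrib]
  exact Finset.sum_congr rfl fun i _ => Finset.sum_congr rfl fun n _ =>
    integral_add (hf i n) (hg i n)

theorem intSpace_const_mul (h : Mesh S) (r : ℝ) (f : Fin h.m → Fin h.M → Space d → ℝ) :
    h.intSpace (fun i k x => r * f i k x) = r * h.intSpace f := by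
  simp only [intSpace, Finset.mul_sum, ← integral_const_mul]

theorem intTime_const_mul (h : Mesh S) (r : ℝ)
    (f : Fin h.m → Fin h.m → Fin (h.M + 1) → Space d × ℝ → ℝ) :
    h.intTime (fun i j n z => r * f i j n z) = r * h.intTime f := by
  simp only [intTime, Finset.mul_sum, ← integral_const_mul]

theorem intSlice_const_mul (h : Mesh S) (r : ℝ) (f : Fin h.m → Space d → ℝ) :
    h.intSlice (fun i x => r * f i x) = r * h.intSlice f := by
  simp only [intSlice, Finset.mul_sum, ← integral_const_mul]

theorem intBdry_const_mul (h : Mesh S) (Γ : Set (Space d)) (r : ℝ)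
    (f : Fin h.m → Fin (h.M + 1) → Space d × ℝ → ℝ) :
    h.intBdry Γ (fun i n z => r * f i n z) = r * h.intBdry Γ f := by
  simp only [intBdry, Finset.mul_sum, ← integral_const_mul]

theorem total_add (h : Mesh S) {F G : h.Integrand} (hF : h.IsIntegrable F)
    (hG : h.IsIntegrable G) : h.total (F + G) = h.total F + h.total G := by
  have h1 := h.intSpace_add hF.space hG.space
  have h2 := h.intTime_add hF.time hG.time
  have h3 := h.intSlice_add hF.bottom hG.bottom
  have h4 := h.intSlice_add hF.top hG.top
  have h5 := h.intBdry_add hF.dirichlet hG.dirichlet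
  have h6 := h.intBdry_add hF.neumann hG.neumann
  have e : h.total (F + G) = h.intSpace (fun i k x => F.1 i k x + G.1 i k x)
      + h.intTime (fun i j n z => F.2.1 i j n z + G.2.1 i j n z)
      + h.intSlice (fun i x => F.2.2.1 i x + G.2.2.1 i x)
      + h.intSlice (fun i x => F.2.2.2.1 i x + G.2.2.2.1 i x)
      + h.intBdry S.ΓD (fun i n z => F.2.2.2.2.1 i n z + G.2.2.2.2.1 i n z)
      + h.intBdry S.ΓN (fun i n z => F.2.2.2.2.2 i n z + G.2.2.2.2.2 i n z) := rfl
  rw [e, total, total, h1, h2, h3, h4, h5, h6]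
  ring

theorem total_smul (h : Mesh S) (r : ℝ) (F : h.Integrand) :
    h.total (r • F) = r * h.total F := by
  have e : h.total (r • F) = h.intSpace (fun i k x => r * F.1 i k x)
      + h.intTime (fun i j n z => r * F.2.1 i j n z)
      + h.intSlice (fun i x => r * F.2.2.1 i x)
      + h.intSlice (fun i x => r * F.2.2.2.1 i x)
      + h.intBdry S.ΓD (fun i n z => r * F.2.2.2.2.1 i n z)
      + h.intBdry S.ΓN (fun i n z => r * F.2.2.2.2.2 i n z) := rfl
  rw [e, total, intSpace_const_mul, intTime_const_mul, intSlice_const_mul, intSlice_const_mul,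
    intBdry_const_mul, intBdry_const_mul]
  ring

/-- Reduces every estimate to one pointwise inequality per kind of face. -/
theorem total_mono (h : Mesh S) {F G : h.Integrand} (hF : h.IsIntegrable F)
    (hG : h.IsIntegrable G) (hle : F ≤ G) : h.total F ≤ h.total G := by
  obtain ⟨l1, l2, l3, l4, l5, l6⟩ := hle
  refine add_le_add (add_le_add (add_le_add (add_le_add (add_le_add ?_ ?_) ?_) ?_) ?_) ?_
  · exact Finset.sum_le_sum fun i _ => Finset.sum_le_sum fun k _ =>
      integral_mono (hF.space i k) (hG.space i k) (l1 i k)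
  · exact Finset.sum_le_sum fun i _ => Finset.sum_le_sum fun j _ => Finset.sum_le_sum fun n _ =>
      integral_mono (hF.time i j n) (hG.time i j n) (l2 i j n)
  · exact Finset.sum_le_sum fun i _ => integral_mono (hF.bottom i) (hG.bottom i) (l3 i)
  · exact Finset.sum_le_sum fun i _ => integral_mono (hF.top i) (hG.top i) (l4 i)
  · exact Finset.sum_le_sum fun i _ => Finset.sum_le_sum fun n _ =>
      integral_mono (hF.dirichlet i n) (hG.dirichlet i n) (l5 i n)
  · exact Finset.sum_le_sum fun i _ => Finset.sum_le_sum fun n _ =>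
      integral_mono (hF.neumann i n) (hG.neumann i n) (l6 i n)

end Mesh

end TrefftzDG

namespace TrefftzDG

variable {d : ℕ}

namespace Mesh

variable {S : Model d}

/-! ### The integrands of the formulation -/

/-- The integrand of the bilinear form. -/
noncomputable def formIntegrand (h : Mesh S) (π : Parameters d) (V W : h.Broken) : h.Integrand :=
  ⟨fun i k x => (S.c ^ 2)⁻¹ * h.below V i k x * h.tJump W i k x
      + inner ℝ (h.belowVec V i k x) (h.tJumpVec W i k x),
   fun i j n z => h.avg V i j n z * h.nJumpVec W i j n z
      + inner ℝ (h.avgVec V i j n z) (S.pow (1 / 2) (h.nJump W i j n z))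
      + π.α z * inner ℝ (S.pow (π.δ z) (h.nJump V i j n z)) (S.pow (1 / 2) (h.nJump W i j n z))
      + π.β z * h.nJumpVec V i j n z * h.nJumpVec W i j n z,
   -- The form has no term at the initial time; the initial values enter its diagonal only through
   -- the energy flux.
   fun _ _ => 0,
   fun i x => (S.c ^ 2)⁻¹ * (V i (Fin.last h.M)).1 x S.T * (W i (Fin.last h.M)).1 x S.T
      + inner ℝ ((V i (Fin.last h.M)).2 x S.T) ((W i (Fin.last h.M)).2 x S.T),
   fun i n z =>
      inner ℝ ((V i n).2 z.1 z.2) ((W i n).1 z.1 z.2 • S.pow (1 / 2) (outwardNormal S.Ω z.1))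
        + π.α z * (V i n).1 z.1 z.2 * (W i n).1 z.1 z.2 *
          inner ℝ (S.pow (π.δ z) (outwardNormal S.Ω z.1))
            (S.pow (1 / 2) (outwardNormal S.Ω z.1)),
   fun i n z =>
      (V i n).1 z.1 z.2 * inner ℝ (S.pow (1 / 2) ((W i n).2 z.1 z.2)) (outwardNormal S.Ω z.1)
        + π.β z * inner ℝ (S.pow (1 / 2) ((V i n).2 z.1 z.2)) (outwardNormal S.Ω z.1) *
          inner ℝ (S.pow (1 / 2) ((W i n).2 z.1 z.2)) (outwardNormal S.Ω z.1)⟩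

/-- The integrand of the energy identity: its integral over the skeleton is the sum over the
elements of the energy flux of two fields through the boundary of the element. -/
noncomputable def fluxIntegrand (h : Mesh S) (V W : h.Broken) : h.Integrand :=
  ⟨fun i k x => ((S.c ^ 2)⁻¹ * (V i k.castSucc).1 x (h.level k) * (W i k.castSucc).1 x (h.level k)
        + inner ℝ ((V i k.castSucc).2 x (h.level k)) ((W i k.castSucc).2 x (h.level k)))
      - ((S.c ^ 2)⁻¹ * (V i k.succ).1 x (h.level k) * (W i k.succ).1 x (h.level k)
        + inner ℝ ((V i k.succ).2 x (h.level k)) ((W i k.succ).2 x (h.level k))),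
   fun i j n z => (h.avg V i j n z * h.nJumpVec W i j n z
        + inner ℝ (h.avgVec V i j n z) (S.pow (1 / 2) (h.nJump W i j n z)))
      + (h.avg W i j n z * h.nJumpVec V i j n z
        + inner ℝ (h.avgVec W i j n z) (S.pow (1 / 2) (h.nJump V i j n z))),
   fun i x => -((S.c ^ 2)⁻¹ * (V i 0).1 x 0 * (W i 0).1 x 0
      + inner ℝ ((V i 0).2 x 0) ((W i 0).2 x 0)),
   fun i x => (S.c ^ 2)⁻¹ * (V i (Fin.last h.M)).1 x S.T * (W i (Fin.last h.M)).1 x S.T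
      + inner ℝ ((V i (Fin.last h.M)).2 x S.T) ((W i (Fin.last h.M)).2 x S.T),
   fun i n z =>
      (V i n).1 z.1 z.2 * inner ℝ (S.pow (1 / 2) ((W i n).2 z.1 z.2)) (outwardNormal S.Ω z.1)
      + (W i n).1 z.1 z.2 * inner ℝ (S.pow (1 / 2) ((V i n).2 z.1 z.2)) (outwardNormal S.Ω z.1),
   fun i n z =>
      (V i n).1 z.1 z.2 * inner ℝ (S.pow (1 / 2) ((W i n).2 z.1 z.2)) (outwardNormal S.Ω z.1)
      + (W i n).1 z.1 z.2 * inner ℝ (S.pow (1 / 2) ((V i n).2 z.1 z.2)) (outwardNormal S.Ω z.1)⟩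

/-- The integrand of the square of the DG norm. -/
noncomputable def dgIntegrand (h : Mesh S) (π : Parameters d) (W : h.Broken) : h.Integrand :=
  ⟨fun i k x => (1 / 2) * (S.c⁻¹ * h.tJump W i k x) ^ 2 + (1 / 2) * ‖h.tJumpVec W i k x‖ ^ 2,
   fun i j n z => ‖π.α z ^ (1 / 2 : ℝ) • S.pow (1 / 4 + π.δ z / 2) (h.nJump W i j n z)‖ ^ 2
      + (π.β z ^ (1 / 2 : ℝ) * h.nJumpVec W i j n z) ^ 2,
   fun i x => (1 / 2) * (S.c⁻¹ * (W i 0).1 x 0) ^ 2 + (1 / 2) * ‖(W i 0).2 x 0‖ ^ 2,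
   fun i x => (1 / 2) * (S.c⁻¹ * (W i (Fin.last h.M)).1 x S.T) ^ 2
      + (1 / 2) * ‖(W i (Fin.last h.M)).2 x S.T‖ ^ 2,
   fun i n z => ‖(π.α z ^ (1 / 2 : ℝ) * (W i n).1 z.1 z.2) •
        S.pow (1 / 4 + π.δ z / 2) (outwardNormal S.Ω z.1)‖ ^ 2,
   fun i n z => (π.β z ^ (1 / 2 : ℝ) *
        inner ℝ (S.pow (1 / 2) ((W i n).2 z.1 z.2)) (outwardNormal S.Ω z.1)) ^ 2⟩

/-- The integrand of the terms which are added to the DG norm in the augmented norm. -/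
noncomputable def augmentIntegrand (h : Mesh S) (π : Parameters d) (W : h.Broken) :
    h.Integrand :=
  ⟨fun i k x => 2 * (S.c⁻¹ * h.below W i k x) ^ 2 + 2 * ‖h.belowVec W i k x‖ ^ 2,
   fun i j n z => ‖π.α z ^ (-(1 / 2) : ℝ) • S.pow (1 / 4 - π.δ z / 2) (h.avgVec W i j n z)‖ ^ 2
      + (π.β z ^ (-(1 / 2) : ℝ) * h.avg W i j n z) ^ 2,
   fun _ _ => 0,
   fun _ _ => 0,
   fun i n z => ‖π.α z ^ (-(1 / 2) : ℝ) • S.pow (1 / 4 - π.δ z / 2) ((W i n).2 z.1 z.2)‖ ^ 2,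
   fun i n z => (π.β z ^ (-(1 / 2) : ℝ) * (W i n).1 z.1 z.2) ^ 2⟩

/-- The integrand of the linear functional. -/
noncomputable def loadIntegrand (h : Mesh S) (π : Parameters d) (g : Data S) (W : h.Broken) :
    h.Integrand :=
  ⟨fun _ _ _ => 0, fun _ _ _ _ => 0,
   fun i x => (S.c ^ 2)⁻¹ * g.v₀ x * (W i 0).1 x 0 + inner ℝ (g.σ₀ x) ((W i 0).2 x 0),
   fun _ _ => 0,
   fun i n z => π.α z * g.gD z * (W i n).1 z.1 z.2 *
        inner ℝ (S.pow (π.δ z) (outwardNormal S.Ω z.1)) (S.pow (1 / 2) (outwardNormal S.Ω z.1))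
      - g.gD z * inner ℝ (S.pow (1 / 2) ((W i n).2 z.1 z.2)) (outwardNormal S.Ω z.1),
   fun i n z => g.gN z * (π.β z * inner ℝ (S.pow (1 / 2) ((W i n).2 z.1 z.2))
        (outwardNormal S.Ω z.1) - (W i n).1 z.1 z.2)⟩

/-- Broken fields which are continuous on each element, up to the boundary. -/
def IsContinuous (h : Mesh S) (V : h.Broken) : Prop :=
  ∀ i n, (Continuous fun z : Space d × ℝ => (V i n).1 z.1 z.2) ∧
    Continuous fun z : Space d × ℝ => (V i n).2 z.1 z.2

theorem isContinuous_of_mem {h : Mesh S} {p : ℕ} {V : h.Broken} (hV : V ∈ h.trefftzSpace p) :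
    h.IsContinuous V :=
  fun i n => Model.continuous_of_mem_localTrefftz (mem_trefftzSpace.1 hV i n)

section Traces

variable {h : Mesh S} {V W : h.Broken}

theorem IsContinuous.slice (hV : h.IsContinuous V) (i : Fin h.m) (n : Fin (h.M + 1)) (t : ℝ) :
    (Continuous fun x => (V i n).1 x t) ∧ Continuous fun x => (V i n).2 x t :=
  ⟨(hV i n).1.comp (f := fun x : Space d => (x, t)) (by fun_prop),
    (hV i n).2.comp (f := fun x : Space d => (x, t)) (by fun_prop)⟩

theorem IsContinuous.memLp_slice (hV : h.IsContinuous V) (i : Fin h.m) (n : Fin (h.M + 1))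
    (t : ℝ) : MemLp (fun x => (V i n).1 x t) ⊤ (volume.restrict (h.K i)) :=
  memLp_top_volume (h.polytope i) (hV.slice i n t).1

theorem IsContinuous.memLp_sliceVec (hV : h.IsContinuous V) (i : Fin h.m) (n : Fin (h.M + 1))
    (t : ℝ) : MemLp (fun x => (V i n).2 x t) ⊤ (volume.restrict (h.K i)) :=
  memLp_top_volume (h.polytope i) (hV.slice i n t).2

theorem IsContinuous.memLp_tJump (hV : h.IsContinuous V) (i : Fin h.m) (k : Fin h.M) :
    MemLp (h.tJump V i k) ⊤ (volume.restrict (h.K i)) :=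
  (hV.memLp_slice i k.castSucc _).sub (hV.memLp_slice i k.succ _)

theorem IsContinuous.memLp_tJumpVec (hV : h.IsContinuous V) (i : Fin h.m) (k : Fin h.M) :
    MemLp (h.tJumpVec V i k) ⊤ (volume.restrict (h.K i)) :=
  (hV.memLp_sliceVec i k.castSucc _).sub (hV.memLp_sliceVec i k.succ _)

theorem memLp_timeMeasure (h : Mesh S) (i j : Fin h.m) (n : Fin (h.M + 1)) {E : Type*}
    [NormedAddCommGroup E] {g : Space d × ℝ → E} (hg : Continuous g) :
    MemLp g ⊤ (h.timeMeasure i j n) :=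
  memLp_top_lateral (h.polytope i) inter_subset_left
    (isClosed_frontier.inter isClosed_frontier).measurableSet _ _ hg

theorem memLp_left_normal (h : Mesh S) (i j : Fin h.m) (n : Fin (h.M + 1)) :
    MemLp (fun z : Space d × ℝ => outwardNormal (h.K i) z.1) ⊤ (h.timeMeasure i j n) :=
  memLp_top_outwardNormal (h.polytope i) inter_subset_left _ _

theorem memLp_right_normal (h : Mesh S) (i j : Fin h.m) (n : Fin (h.M + 1)) :
    MemLp (fun z : Space d × ℝ => outwardNormal (h.K j) z.1) ⊤ (h.timeMeasure i j n) :=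
  memLp_top_outwardNormal (h.polytope j) inter_subset_right _ _

theorem IsContinuous.memLp_avg (hV : h.IsContinuous V) (i j : Fin h.m) (n : Fin (h.M + 1)) :
    MemLp (h.avg V i j n) ⊤ (h.timeMeasure i j n) :=
  h.memLp_timeMeasure i j n (((hV i n).1.add (hV j n).1).div_const 2)

theorem IsContinuous.memLp_avgVec (hV : h.IsContinuous V) (i j : Fin h.m) (n : Fin (h.M + 1)) :
    MemLp (h.avgVec V i j n) ⊤ (h.timeMeasure i j n) :=
  h.memLp_timeMeasure i j n (((hV i n).2.add (hV j n).2).const_smul (1 / 2 : ℝ))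

theorem IsContinuous.memLp_nJump (hV : h.IsContinuous V) (i j : Fin h.m) (n : Fin (h.M + 1)) :
    MemLp (h.nJump V i j n) ⊤ (h.timeMeasure i j n) :=
  (memLp_top_smul (h.memLp_timeMeasure i j n (hV i n).1) (h.memLp_left_normal i j n)).add
    (memLp_top_smul (h.memLp_timeMeasure i j n (hV j n).1) (h.memLp_right_normal i j n))

theorem IsContinuous.memLp_nJumpVec (hV : h.IsContinuous V) (i j : Fin h.m)
    (n : Fin (h.M + 1)) : MemLp (h.nJumpVec V i j n) ⊤ (h.timeMeasure i j n) :=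
  (memLp_top_inner (S.memLp_top_pow_const _ (h.memLp_timeMeasure i j n (hV i n).2))
    (h.memLp_left_normal i j n)).add
    (memLp_top_inner (S.memLp_top_pow_const _ (h.memLp_timeMeasure i j n (hV j n).2))
      (h.memLp_right_normal i j n))

theorem memLp_bdryMeasure (h : Mesh S) {Γ : Set (Space d)} (hΓ : MeasurableSet Γ) (i : Fin h.m)
    (n : Fin (h.M + 1)) {E : Type*} [NormedAddCommGroup E] {g : Space d × ℝ → E}
    (hg : Continuous g) : MemLp g ⊤ (h.bdryMeasure Γ i n) :=
  memLp_top_lateral (h.polytope i) inter_subset_left (isClosed_frontier.measurableSet.inter hΓ)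
    _ _ hg

theorem memLp_bdry_normal (h : Mesh S) {Γ : Set (Space d)} (hΓ : Γ ⊆ frontier S.Ω) (i : Fin h.m)
    (n : Fin (h.M + 1)) :
    MemLp (fun z : Space d × ℝ => outwardNormal S.Ω z.1) ⊤ (h.bdryMeasure Γ i n) :=
  memLp_top_outwardNormal S.polytope (inter_subset_right.trans hΓ) _ _

theorem IsContinuous.memLp_bdryFlux (hV : h.IsContinuous V) {Γ : Set (Space d)}
    (hΓ : MeasurableSet Γ) (hsub : Γ ⊆ frontier S.Ω) (i : Fin h.m) (n : Fin (h.M + 1)) :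
    MemLp (fun z : Space d × ℝ =>
      inner ℝ (S.pow (1 / 2) ((V i n).2 z.1 z.2)) (outwardNormal S.Ω z.1)) ⊤
      (h.bdryMeasure Γ i n) :=
  memLp_top_inner (S.memLp_top_pow_const _ (h.memLp_bdryMeasure hΓ i n (hV i n).2))
    (h.memLp_bdry_normal hsub i n)

end Traces

theorem memLp_top_pow_δ (π : Parameters d) (S : Model d) {μ : Measure (Space d × ℝ)}
    {u : Space d × ℝ → Space d} (hu : MemLp u ⊤ μ) :
    MemLp (fun z => S.pow (π.δ z) (u z)) ⊤ μ := by
  simpa using π.memLp_top_pow S 0 1 hu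

theorem memLp_top_pow_add (π : Parameters d) (S : Model d) {μ : Measure (Space d × ℝ)}
    {u : Space d × ℝ → Space d} (hu : MemLp u ⊤ μ) :
    MemLp (fun z => S.pow (1 / 4 + π.δ z / 2) (u z)) ⊤ μ := by
  simpa only [one_div, inv_mul_eq_div] using π.memLp_top_pow S (1 / 4) (1 / 2) hu

theorem memLp_top_pow_sub (π : Parameters d) (S : Model d) {μ : Measure (Space d × ℝ)}
    {u : Space d × ℝ → Space d} (hu : MemLp u ⊤ μ) :
    MemLp (fun z => S.pow (1 / 4 - π.δ z / 2) (u z)) ⊤ μ := by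
  simpa only [one_div, inv_mul_eq_div, neg_mul, ← sub_eq_add_neg]
    using π.memLp_top_pow S (1 / 4) (-(1 / 2)) hu

section Integrability

variable {h : Mesh S} {V W : h.Broken}

theorem isIntegrable_formIntegrand (π : Parameters d) (hV : h.IsContinuous V)
    (hW : h.IsContinuous W) : h.IsIntegrable (h.formIntegrand π V W) where
  space i k := by
    refine MemLp.integrable le_top ((memLp_top_mul ((hV.memLp_slice i _ _).const_mul _)
      (hW.memLp_tJump i k)).add (memLp_top_inner (hV.memLp_sliceVec i _ _) (hW.memLp_tJumpVec i k)))
  time i j n := by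
    refine MemLp.integrable le_top ((((memLp_top_mul (hV.memLp_avg i j n)
      (hW.memLp_nJumpVec i j n)).add (memLp_top_inner (hV.memLp_avgVec i j n)
        (S.memLp_top_pow_const _ (hW.memLp_nJump i j n)))).add
      (memLp_top_mul (π.memLp_top_α _) (memLp_top_inner (memLp_top_pow_δ π S
        (hV.memLp_nJump i j n)) (S.memLp_top_pow_const _ (hW.memLp_nJump i j n))))).add
      (memLp_top_mul (memLp_top_mul (π.memLp_top_β _) (hV.memLp_nJumpVec i j n))
        (hW.memLp_nJumpVec i j n)))
  bottom _ := integrable_zero _ _ _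
  top i := by
    refine MemLp.integrable le_top ((memLp_top_mul ((hV.memLp_slice i _ _).const_mul _)
      (hW.memLp_slice i _ _)).add (memLp_top_inner (hV.memLp_sliceVec i _ _)
        (hW.memLp_sliceVec i _ _)))
  dirichlet i n := by
    have hn := h.memLp_bdry_normal (ΓD_subset_frontier S) i n
    have hc := fun {E : Type} [NormedAddCommGroup E] {g : Space d × ℝ → E} (hg : Continuous g) =>
      h.memLp_bdryMeasure S.measurable_ΓD i n hg
    refine MemLp.integrable le_top ((memLp_top_inner (hc (hV i n).2) (memLp_top_smul
      (hc (hW i n).1) (S.memLp_top_pow_const _ hn))).add (memLp_top_mul (memLp_top_mul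
        (memLp_top_mul (π.memLp_top_α _) (hc (hV i n).1)) (hc (hW i n).1)) (memLp_top_inner
          (memLp_top_pow_δ π S hn) (S.memLp_top_pow_const _ hn))))
  neumann i n := by
    have hf := fun {U : h.Broken} (hU : h.IsContinuous U) =>
      hU.memLp_bdryFlux S.measurable_ΓN (ΓN_subset_frontier S) i n
    refine MemLp.integrable le_top ((memLp_top_mul (h.memLp_bdryMeasure S.measurable_ΓN i n
      (hV i n).1) (hf hW)).add (memLp_top_mul (memLp_top_mul (π.memLp_top_β _) (hf hV)) (hf hW)))

theorem isIntegrable_fluxIntegrand (hV : h.IsContinuous V) (hW : h.IsContinuous W) :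
    h.IsIntegrable (h.fluxIntegrand V W) := by
  have hslice : ∀ i n t, MemLp (fun x => (S.c ^ 2)⁻¹ * (V i n).1 x t * (W i n).1 x t
      + inner ℝ ((V i n).2 x t) ((W i n).2 x t)) ⊤ (volume.restrict (h.K i)) := fun i n t =>
    (memLp_top_mul ((hV.memLp_slice i n t).const_mul _) (hW.memLp_slice i n t)).add
      (memLp_top_inner (hV.memLp_sliceVec i n t) (hW.memLp_sliceVec i n t))
  have htime : ∀ {V W : h.Broken}, h.IsContinuous V → h.IsContinuous W → ∀ i j n,
      MemLp (fun z => h.avg V i j n z * h.nJumpVec W i j n z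
        + inner ℝ (h.avgVec V i j n z) (S.pow (1 / 2) (h.nJump W i j n z))) ⊤
        (h.timeMeasure i j n) := fun hV hW i j n =>
    (memLp_top_mul (hV.memLp_avg i j n) (hW.memLp_nJumpVec i j n)).add
      (memLp_top_inner (hV.memLp_avgVec i j n) (S.memLp_top_pow_const _ (hW.memLp_nJump i j n)))
  have hbdry : ∀ {Γ : Set (Space d)}, MeasurableSet Γ → Γ ⊆ frontier S.Ω → ∀ i n,
      Integrable (fun z : Space d × ℝ =>
        (V i n).1 z.1 z.2 * inner ℝ (S.pow (1 / 2) ((W i n).2 z.1 z.2)) (outwardNormal S.Ω z.1)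
        + (W i n).1 z.1 z.2 * inner ℝ (S.pow (1 / 2) ((V i n).2 z.1 z.2))
          (outwardNormal S.Ω z.1)) (h.bdryMeasure Γ i n) := fun hm hsub i n =>
    MemLp.integrable le_top ((memLp_top_mul (h.memLp_bdryMeasure hm i n (hV i n).1)
      (hW.memLp_bdryFlux hm hsub i n)).add (memLp_top_mul (h.memLp_bdryMeasure hm i n (hW i n).1)
        (hV.memLp_bdryFlux hm hsub i n)))
  exact
  { space := fun i k => MemLp.integrable le_top ((hslice i _ _).sub (hslice i _ _))
    time := fun i j n => MemLp.integrable le_top ((htime hV hW i j n).add (htime hW hV i j n))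
    bottom := fun i => MemLp.integrable le_top (hslice i _ _).neg
    top := fun i => MemLp.integrable le_top (hslice i _ _)
    dirichlet := hbdry S.measurable_ΓD (ΓD_subset_frontier S)
    neumann := hbdry S.measurable_ΓN (ΓN_subset_frontier S) }

theorem isIntegrable_dgIntegrand (π : Parameters d) (hW : h.IsContinuous W) :
    h.IsIntegrable (h.dgIntegrand π W) where
  space i k := MemLp.integrable le_top (((memLp_top_sq ((hW.memLp_tJump i k).const_mul _)).const_mul
    _).add ((memLp_top_norm_sq (hW.memLp_tJumpVec i k)).const_mul _))
  time i j n := MemLp.integrable le_top ((memLp_top_norm_sq (memLp_top_smul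
    (π.memLp_top_α_rpow _ _) (memLp_top_pow_add π S (hW.memLp_nJump i j n)))).add
      (memLp_top_sq (memLp_top_mul (π.memLp_top_β_rpow _ _) (hW.memLp_nJumpVec i j n))))
  bottom i := MemLp.integrable le_top (((memLp_top_sq ((hW.memLp_slice i _ _).const_mul
    _)).const_mul _).add ((memLp_top_norm_sq (hW.memLp_sliceVec i _ _)).const_mul _))
  top i := MemLp.integrable le_top (((memLp_top_sq ((hW.memLp_slice i _ _).const_mul
    _)).const_mul _).add ((memLp_top_norm_sq (hW.memLp_sliceVec i _ _)).const_mul _))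
  dirichlet i n := MemLp.integrable le_top (memLp_top_norm_sq (memLp_top_smul (memLp_top_mul
    (π.memLp_top_α_rpow _ _) (h.memLp_bdryMeasure S.measurable_ΓD i n (hW i n).1))
      (memLp_top_pow_add π S (h.memLp_bdry_normal (ΓD_subset_frontier S) i n))))
  neumann i n := MemLp.integrable le_top (memLp_top_sq (memLp_top_mul (π.memLp_top_β_rpow _ _)
    (hW.memLp_bdryFlux S.measurable_ΓN (ΓN_subset_frontier S) i n)))

theorem isIntegrable_augmentIntegrand (π : Parameters d) (hW : h.IsContinuous W) :
    h.IsIntegrable (h.augmentIntegrand π W) where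
  space i _ := MemLp.integrable le_top (((memLp_top_sq ((hW.memLp_slice i _ _).const_mul
    _)).const_mul _).add ((memLp_top_norm_sq (hW.memLp_sliceVec i _ _)).const_mul _))
  time i j n := MemLp.integrable le_top ((memLp_top_norm_sq (memLp_top_smul
    (π.memLp_top_α_rpow _ _) (memLp_top_pow_sub π S (hW.memLp_avgVec i j n)))).add
      (memLp_top_sq (memLp_top_mul (π.memLp_top_β_rpow _ _) (hW.memLp_avg i j n))))
  bottom _ := integrable_zero _ _ _
  top _ := integrable_zero _ _ _
  dirichlet i n := MemLp.integrable le_top (memLp_top_norm_sq (memLp_top_smul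
    (π.memLp_top_α_rpow _ _) (memLp_top_pow_sub π S
      (h.memLp_bdryMeasure S.measurable_ΓD i n (hW i n).2))))
  neumann i n := MemLp.integrable le_top (memLp_top_sq (memLp_top_mul (π.memLp_top_β_rpow _ _)
    (h.memLp_bdryMeasure S.measurable_ΓN i n (hW i n).1)))

/-- Passes the square integrability of the boundary data from the whole lateral boundary to the
pieces cut out by the elements. -/
theorem bdryMeasure_le (h : Mesh S) {Γ : Set (Space d)} (hΓ : Γ ⊆ frontier S.Ω)
    (i : Fin h.m) (n : Fin (h.M + 1)) : h.bdryMeasure Γ i n ≤ lateral Γ 0 S.T := by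
  have := isFiniteMeasure_restrict_frontier S.polytope hΓ
  have h0 : 0 ≤ h.time n.castSucc := by
    rw [← h.time_zero]
    exact h.time_strictMono.monotone (Fin.zero_le _)
  have h1 : h.time n.succ ≤ S.T := by
    rw [← h.time_last]
    exact h.time_strictMono.monotone (Fin.le_last _)
  have := isFiniteMeasure_restrict_frontier (h.polytope i)
    (inter_subset_left : frontier (h.K i) ∩ Γ ⊆ frontier (h.K i))
  exact Measure.prod_mono (Measure.restrict_mono inter_subset_right le_rfl)
    (Measure.restrict_mono (Ioo_subset_Ioo h0 h1) le_rfl)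

theorem isIntegrable_loadIntegrand (π : Parameters d) (g : Data S) (hW : h.IsContinuous W) :
    h.IsIntegrable (h.loadIntegrand π g W) where
  space _ _ := integrable_zero _ _ _
  time _ _ _ := integrable_zero _ _ _
  bottom i := by
    refine (integrable_mul_memLp_top ((g.memLp_v₀.mono_measure (Measure.restrict_mono
      (h.subset_domain i) le_rfl)).const_mul _) (hW.memLp_slice i _ _)).add
      (integrable_inner_memLp_top (g.memLp_σ₀.mono_measure (Measure.restrict_mono
      (h.subset_domain i) le_rfl)) (hW.memLp_sliceVec i _ _))
  top _ := integrable_zero _ _ _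
  dirichlet i n := by
    have hg := g.memLp_gD.mono_measure (h.bdryMeasure_le (ΓD_subset_frontier S) i n)
    have hn := h.memLp_bdry_normal (ΓD_subset_frontier S) i n
    have h1 := integrable_mul_memLp_top hg (memLp_top_mul (memLp_top_mul (π.memLp_top_α _)
      (h.memLp_bdryMeasure S.measurable_ΓD i n (hW i n).1)) (memLp_top_inner
        (memLp_top_pow_δ π S hn) (S.memLp_top_pow_const (1 / 2) hn)))
    refine (h1.congr (Filter.Eventually.of_forall fun z => ?_)).sub (integrable_mul_memLp_top hg
      (hW.memLp_bdryFlux S.measurable_ΓD (ΓD_subset_frontier S) i n))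
    simp only
    ring
  neumann i n := by
    have hg := g.memLp_gN.mono_measure (h.bdryMeasure_le (ΓN_subset_frontier S) i n)
    exact integrable_mul_memLp_top hg ((memLp_top_mul (π.memLp_top_β _)
      (hW.memLp_bdryFlux S.measurable_ΓN (ΓN_subset_frontier S) i n)).sub
      (h.memLp_bdryMeasure S.measurable_ΓN i n (hW i n).1))

end Integrability

end Mesh

end TrefftzDG

/-! ### Form, functional and norms as integrals over the skeleton -/

namespace TrefftzDG

variable {d : ℕ}

namespace Mesh

variable {S : Model d}

theorem form_eq_total (h : Mesh S) (π : Parameters d) (V W : h.Broken) :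
    h.form π V W = h.total (h.formIntegrand π V W) := by
  simp only [form, total, formIntegrand]
  have : h.intSlice (fun _ _ => 0) = 0 := by simp [intSlice]
  rw [this, add_zero]

/-- Continuity is required because the two Dirichlet integrals are merged into one; the form, whose
integrals match the slots one by one, needs no such hypothesis. -/
theorem load_eq_total {h : Mesh S} (π : Parameters d) (g : Data S) {W : h.Broken}
    (hW : h.IsContinuous W) : h.load π g W = h.total (h.loadIntegrand π g W) := by
  have hg : ∀ i n, MemLp g.gD 2 (h.bdryMeasure S.ΓD i n) := fun i n =>
    g.memLp_gD.mono_measure (h.bdryMeasure_le (ΓD_subset_frontier S) i n)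
  have hn := h.memLp_bdry_normal (ΓD_subset_frontier S)
  have h1 : ∀ i n, Integrable (fun z : Space d × ℝ =>
      -(g.gD z * inner ℝ (S.pow (1 / 2) ((W i n).2 z.1 z.2)) (outwardNormal S.Ω z.1)))
      (h.bdryMeasure S.ΓD i n) := fun i n =>
    (integrable_mul_memLp_top (hg i n)
      (hW.memLp_bdryFlux S.measurable_ΓD (ΓD_subset_frontier S) i n)).neg
  have h2 : ∀ i n, Integrable (fun z : Space d × ℝ =>
      π.α z * g.gD z * (W i n).1 z.1 z.2 * inner ℝ (S.pow (π.δ z) (outwardNormal S.Ω z.1))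
        (S.pow (1 / 2) (outwardNormal S.Ω z.1))) (h.bdryMeasure S.ΓD i n) := fun i n =>
    (integrable_mul_memLp_top (hg i n) (memLp_top_mul (memLp_top_mul (π.memLp_top_α _)
      (h.memLp_bdryMeasure S.measurable_ΓD i n (hW i n).1)) (memLp_top_inner
        (memLp_top_pow_δ π S (hn i n)) (S.memLp_top_pow_const (1 / 2) (hn i n))))).congr
      (Filter.Eventually.of_forall fun z => by simp only; ring)
  have h3 := h.intBdry_add h2 h1
  have h4 : h.intBdry S.ΓD (fun i n z =>
      -(g.gD z * inner ℝ (S.pow (1 / 2) ((W i n).2 z.1 z.2)) (outwardNormal S.Ω z.1)))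
      = -h.intBdry S.ΓD (fun i n z =>
        g.gD z * inner ℝ (S.pow (1 / 2) ((W i n).2 z.1 z.2)) (outwardNormal S.Ω z.1)) := by
    simp only [intBdry, integral_neg, Finset.sum_neg_distrib]
  rw [h4] at h3
  simp only [load, total, loadIntegrand, sub_eq_add_neg]
  rw [h3]
  simp only [intSpace, intTime, intSlice, integral_zero, Finset.sum_const_zero]
  ring

theorem dgSq_eq_total {h : Mesh S} (π : Parameters d) {W : h.Broken}
    (hW : h.IsContinuous W) : h.dgSq π W = h.total (h.dgIntegrand π W) := by
  have h1 := h.intSpace_add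
    (f := fun i k x => (1 / 2) * (S.c⁻¹ * h.tJump W i k x) ^ 2)
    (g := fun i k x => (1 / 2) * ‖h.tJumpVec W i k x‖ ^ 2)
    (fun i k => MemLp.integrable le_top
      ((memLp_top_sq ((hW.memLp_tJump i k).const_mul _)).const_mul _))
    (fun i k => MemLp.integrable le_top ((memLp_top_norm_sq (hW.memLp_tJumpVec i k)).const_mul _))
  have h2 := h.intTime_add
    (f := fun i j n z =>
      ‖π.α z ^ (1 / 2 : ℝ) • S.pow (1 / 4 + π.δ z / 2) (h.nJump W i j n z)‖ ^ 2)
    (g := fun i j n z => (π.β z ^ (1 / 2 : ℝ) * h.nJumpVec W i j n z) ^ 2)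
    (fun i j n => MemLp.integrable le_top (memLp_top_norm_sq (memLp_top_smul
      (π.memLp_top_α_rpow _ _) (memLp_top_pow_add π S (hW.memLp_nJump i j n)))))
    (fun i j n => MemLp.integrable le_top
      (memLp_top_sq (memLp_top_mul (π.memLp_top_β_rpow _ _) (hW.memLp_nJumpVec i j n))))
  have h3 : ∀ (n : Fin (h.M + 1)) (t : ℝ), _ := fun n t => h.intSlice_add
    (f := fun i x => (1 / 2) * (S.c⁻¹ * (W i n).1 x t) ^ 2)
    (g := fun i x => (1 / 2) * ‖(W i n).2 x t‖ ^ 2)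
    (fun i => MemLp.integrable le_top
      ((memLp_top_sq ((hW.memLp_slice i n t).const_mul _)).const_mul _))
    (fun i => MemLp.integrable le_top ((memLp_top_norm_sq (hW.memLp_sliceVec i n t)).const_mul _))
  simp only [dgSq, total, dgIntegrand, h1, h2, h3, intSpace_const_mul, intSlice_const_mul]
  ring

theorem dgPlusSq_eq_total {h : Mesh S} (π : Parameters d) {W : h.Broken}
    (hW : h.IsContinuous W) :
    h.dgPlusSq π W = h.dgSq π W + h.total (h.augmentIntegrand π W) := by
  have h1 := h.intSpace_add
    (f := fun i k x => 2 * (S.c⁻¹ * h.below W i k x) ^ 2)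
    (g := fun i k x => 2 * ‖h.belowVec W i k x‖ ^ 2)
    (fun i k => MemLp.integrable le_top
      ((memLp_top_sq ((hW.memLp_slice i _ _).const_mul _)).const_mul _))
    (fun i k => MemLp.integrable le_top ((memLp_top_norm_sq (hW.memLp_sliceVec i _ _)).const_mul _))
  have h2 := h.intTime_add
    (f := fun i j n z =>
      ‖π.α z ^ (-(1 / 2) : ℝ) • S.pow (1 / 4 - π.δ z / 2) (h.avgVec W i j n z)‖ ^ 2)
    (g := fun i j n z => (π.β z ^ (-(1 / 2) : ℝ) * h.avg W i j n z) ^ 2)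
    (fun i j n => MemLp.integrable le_top (memLp_top_norm_sq (memLp_top_smul
      (π.memLp_top_α_rpow _ _) (memLp_top_pow_sub π S (hW.memLp_avgVec i j n)))))
    (fun i j n => MemLp.integrable le_top
      (memLp_top_sq (memLp_top_mul (π.memLp_top_β_rpow _ _) (hW.memLp_avg i j n))))
  have h3 : h.intSlice (fun _ _ => 0) = 0 := by simp [intSlice]
  simp only [dgPlusSq, total, augmentIntegrand, h1, h2, h3, intSpace_const_mul]
  ring

/-! ### Bilinearity -/

section Linear

variable {h : Mesh S} {V V' W W' : h.Broken}

theorem IsContinuous.add (hV : h.IsContinuous V) (hW : h.IsContinuous W) :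
    h.IsContinuous (V + W) :=
  fun i n => ⟨(hV i n).1.add (hW i n).1, (hV i n).2.add (hW i n).2⟩

theorem IsContinuous.smul (hV : h.IsContinuous V) (r : ℝ) : h.IsContinuous (r • V) :=
  fun i n => ⟨(hV i n).1.const_smul r, (hV i n).2.const_smul r⟩

theorem nJump_add (i j : Fin h.m) (n : Fin (h.M + 1)) (z : Space d × ℝ) :
    h.nJump (V + W) i j n z = h.nJump V i j n z + h.nJump W i j n z := by
  simp only [nJump, Pi.add_apply, Prod.fst_add, add_smul]
  abel

theorem nJump_smul (r : ℝ) (i j : Fin h.m) (n : Fin (h.M + 1)) (z : Space d × ℝ) :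
    h.nJump (r • V) i j n z = r • h.nJump V i j n z := by
  simp only [nJump, Pi.smul_apply, Prod.smul_fst, smul_add, smul_assoc]

theorem nJumpVec_add (i j : Fin h.m) (n : Fin (h.M + 1)) (z : Space d × ℝ) :
    h.nJumpVec (V + W) i j n z = h.nJumpVec V i j n z + h.nJumpVec W i j n z := by
  simp only [nJumpVec, Pi.add_apply, Prod.snd_add, map_add, inner_add_left]
  ring

theorem nJumpVec_smul (r : ℝ) (i j : Fin h.m) (n : Fin (h.M + 1)) (z : Space d × ℝ) :
    h.nJumpVec (r • V) i j n z = r * h.nJumpVec V i j n z := by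
  simp only [nJumpVec, Pi.smul_apply, Prod.smul_snd, map_smul, real_inner_smul_left]
  ring

theorem avg_add (i j : Fin h.m) (n : Fin (h.M + 1)) (z : Space d × ℝ) :
    h.avg (V + W) i j n z = h.avg V i j n z + h.avg W i j n z := by
  simp only [avg, Pi.add_apply, Prod.fst_add]
  ring

theorem avg_smul (r : ℝ) (i j : Fin h.m) (n : Fin (h.M + 1)) (z : Space d × ℝ) :
    h.avg (r • V) i j n z = r * h.avg V i j n z := by
  simp only [avg, Pi.smul_apply, Prod.smul_fst, smul_eq_mul]
  ring

theorem avgVec_add (i j : Fin h.m) (n : Fin (h.M + 1)) (z : Space d × ℝ) :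
    h.avgVec (V + W) i j n z = h.avgVec V i j n z + h.avgVec W i j n z := by
  simp only [avgVec, Pi.add_apply, Prod.snd_add, ← smul_add]
  congr 1
  abel

theorem avgVec_smul (r : ℝ) (i j : Fin h.m) (n : Fin (h.M + 1)) (z : Space d × ℝ) :
    h.avgVec (r • V) i j n z = r • h.avgVec V i j n z := by
  simp only [avgVec, Pi.smul_apply, Prod.smul_snd, smul_add, smul_comm r]

theorem formIntegrand_add_left (π : Parameters d) :
    h.formIntegrand π (V + V') W = h.formIntegrand π V W + h.formIntegrand π V' W := by
  refine Prod.ext ?_ (Prod.ext ?_ (Prod.ext ?_ (Prod.ext ?_ (Prod.ext ?_ ?_))))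
  · funext i k x
    simp only [formIntegrand, below, belowVec, Pi.add_apply, Prod.fst_add, Prod.snd_add,
      inner_add_left]
    ring
  · funext i j n z
    simp only [formIntegrand, nJump_add, nJumpVec_add, avg_add, avgVec_add, map_add,
      inner_add_left, Prod.mk_add_mk, Pi.add_apply]
    ring
  · funext i x
    simp [formIntegrand]
  · funext i x
    simp only [formIntegrand, Pi.add_apply, Prod.fst_add, Prod.snd_add, inner_add_left]
    ring
  · funext i n z
    simp only [formIntegrand, Pi.add_apply, Prod.fst_add, Prod.snd_add, inner_add_left]
    ring
  · funext i n z
    simp only [formIntegrand, Pi.add_apply, Prod.fst_add, Prod.snd_add, map_add, inner_add_left]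
    ring

theorem formIntegrand_smul_left (π : Parameters d) (r : ℝ) :
    h.formIntegrand π (r • V) W = r • h.formIntegrand π V W := by
  refine Prod.ext ?_ (Prod.ext ?_ (Prod.ext ?_ (Prod.ext ?_ (Prod.ext ?_ ?_))))
  · funext i k x
    simp only [formIntegrand, below, belowVec, Pi.smul_apply, Prod.smul_fst, Prod.smul_snd,
      real_inner_smul_left, smul_eq_mul]
    ring
  · funext i j n z
    simp only [formIntegrand, nJump_smul, nJumpVec_smul, avg_smul, avgVec_smul, map_smul,
      real_inner_smul_left, Prod.smul_mk, Pi.smul_apply, smul_eq_mul]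
    ring
  · funext i x
    simp [formIntegrand]
  · funext i x
    simp only [formIntegrand, Pi.smul_apply, Prod.smul_fst, Prod.smul_snd, real_inner_smul_left,
      smul_eq_mul]
    ring
  · funext i n z
    simp only [formIntegrand, Pi.smul_apply, Prod.smul_fst, Prod.smul_snd, real_inner_smul_left,
      smul_eq_mul]
    ring
  · funext i n z
    simp only [formIntegrand, Pi.smul_apply, Prod.smul_fst, Prod.smul_snd, map_smul,
      real_inner_smul_left, smul_eq_mul]
    ring

theorem formIntegrand_add_right (π : Parameters d) :
    h.formIntegrand π V (W + W') = h.formIntegrand π V W + h.formIntegrand π V W' := by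
  refine Prod.ext ?_ (Prod.ext ?_ (Prod.ext ?_ (Prod.ext ?_ (Prod.ext ?_ ?_))))
  · funext i k x
    simp only [formIntegrand, tJump, tJumpVec, Pi.add_apply, Prod.fst_add, Prod.snd_add,
      inner_add_right, inner_sub_right]
    ring
  · funext i j n z
    simp only [formIntegrand, nJump_add, nJumpVec_add, map_add,
      inner_add_right, Prod.mk_add_mk, Pi.add_apply]
    ring
  · funext i x
    simp [formIntegrand]
  · funext i x
    simp only [formIntegrand, Pi.add_apply, Prod.fst_add, Prod.snd_add, inner_add_right]
    ring
  · funext i n z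
    simp only [formIntegrand, Pi.add_apply, Prod.fst_add, Prod.snd_add, inner_add_right, add_smul]
    ring
  · funext i n z
    simp only [formIntegrand, Pi.add_apply, Prod.fst_add, Prod.snd_add, map_add, inner_add_left]
    ring

theorem formIntegrand_smul_right (π : Parameters d) (r : ℝ) :
    h.formIntegrand π V (r • W) = r • h.formIntegrand π V W := by
  refine Prod.ext ?_ (Prod.ext ?_ (Prod.ext ?_ (Prod.ext ?_ (Prod.ext ?_ ?_))))
  · funext i k x
    simp only [formIntegrand, tJump, tJumpVec, Pi.smul_apply, Prod.smul_fst, Prod.smul_snd,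
      real_inner_smul_right, inner_sub_right, smul_eq_mul]
    ring
  · funext i j n z
    simp only [formIntegrand, nJump_smul, nJumpVec_smul, map_smul,
      real_inner_smul_right, Prod.smul_mk, Pi.smul_apply, smul_eq_mul]
    ring
  · funext i x
    simp [formIntegrand]
  · funext i x
    simp only [formIntegrand, Pi.smul_apply, Prod.smul_fst, Prod.smul_snd, real_inner_smul_right,
      smul_eq_mul]
    ring
  · funext i n z
    simp only [formIntegrand, Pi.smul_apply, Prod.smul_fst, Prod.smul_snd, real_inner_smul_right,
      smul_eq_mul]
    ring
  · funext i n z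
    simp only [formIntegrand, Pi.smul_apply, Prod.smul_fst, Prod.smul_snd, map_smul,
      real_inner_smul_left, smul_eq_mul]
    ring

theorem loadIntegrand_add (π : Parameters d) (g : Data S) :
    h.loadIntegrand π g (W + W') = h.loadIntegrand π g W + h.loadIntegrand π g W' := by
  refine Prod.ext ?_ (Prod.ext ?_ (Prod.ext ?_ (Prod.ext ?_ (Prod.ext ?_ ?_))))
  · funext i k x
    simp [loadIntegrand]
  · funext i j n z
    simp [loadIntegrand]
  · funext i x
    simp only [loadIntegrand, Pi.add_apply, Prod.fst_add, Prod.snd_add, inner_add_right]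
    ring
  · funext i x
    simp [loadIntegrand]
  · funext i n z
    simp only [loadIntegrand, Pi.add_apply, Prod.fst_add, Prod.snd_add, map_add, inner_add_left]
    ring
  · funext i n z
    simp only [loadIntegrand, Pi.add_apply, Prod.fst_add, Prod.snd_add, map_add, inner_add_left]
    ring

theorem loadIntegrand_smul (π : Parameters d) (g : Data S) (r : ℝ) :
    h.loadIntegrand π g (r • W) = r • h.loadIntegrand π g W := by
  refine Prod.ext ?_ (Prod.ext ?_ (Prod.ext ?_ (Prod.ext ?_ (Prod.ext ?_ ?_))))
  · funext i k x
    simp [loadIntegrand]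
  · funext i j n z
    simp [loadIntegrand]
  · funext i x
    simp only [loadIntegrand, Pi.smul_apply, Prod.smul_fst, Prod.smul_snd, real_inner_smul_right,
      smul_eq_mul]
    ring
  · funext i x
    simp [loadIntegrand]
  · funext i n z
    simp only [loadIntegrand, Pi.smul_apply, Prod.smul_fst, Prod.smul_snd, map_smul,
      real_inner_smul_left, smul_eq_mul]
    ring
  · funext i n z
    simp only [loadIntegrand, Pi.smul_apply, Prod.smul_fst, Prod.smul_snd, map_smul,
      real_inner_smul_left, smul_eq_mul]
    ring

theorem form_add_left (π : Parameters d) (hV : h.IsContinuous V) (hV' : h.IsContinuous V')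
    (hW : h.IsContinuous W) : h.form π (V + V') W = h.form π V W + h.form π V' W := by
  simp only [form_eq_total, formIntegrand_add_left]
  exact h.total_add (isIntegrable_formIntegrand π hV hW) (isIntegrable_formIntegrand π hV' hW)

theorem form_smul_left (π : Parameters d) (r : ℝ) :
    h.form π (r • V) W = r * h.form π V W := by
  simp only [form_eq_total, formIntegrand_smul_left, total_smul]

theorem form_add_right (π : Parameters d) (hV : h.IsContinuous V) (hW : h.IsContinuous W)
    (hW' : h.IsContinuous W') : h.form π V (W + W') = h.form π V W + h.form π V W' := by
  simp only [form_eq_total, formIntegrand_add_right]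
  exact h.total_add (isIntegrable_formIntegrand π hV hW) (isIntegrable_formIntegrand π hV hW')

theorem form_smul_right (π : Parameters d) (r : ℝ) :
    h.form π V (r • W) = r * h.form π V W := by
  simp only [form_eq_total, formIntegrand_smul_right, total_smul]

theorem load_add (π : Parameters d) (g : Data S) (hW : h.IsContinuous W)
    (hW' : h.IsContinuous W') : h.load π g (W + W') = h.load π g W + h.load π g W' := by
  rw [load_eq_total π g hW, load_eq_total π g hW', load_eq_total π g (hW.add hW'),
    loadIntegrand_add]
  exact h.total_add (isIntegrable_loadIntegrand π g hW) (isIntegrable_loadIntegrand π g hW')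

theorem load_smul (π : Parameters d) (g : Data S) (hW : h.IsContinuous W) (r : ℝ) :
    h.load π g (r • W) = r * h.load π g W := by
  rw [load_eq_total π g hW, load_eq_total π g (hW.smul r), loadIntegrand_smul, total_smul]

theorem dgIntegrand_smul (π : Parameters d) (r : ℝ) :
    h.dgIntegrand π (r • W) = r ^ 2 • h.dgIntegrand π W := by
  refine Prod.ext ?_ (Prod.ext ?_ (Prod.ext ?_ (Prod.ext ?_ (Prod.ext ?_ ?_))))
  · funext i k x
    simp only [dgIntegrand, tJump, tJumpVec, Pi.smul_apply, Prod.smul_fst, Prod.smul_snd,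
      ← smul_sub, norm_smul, mul_pow, Real.norm_eq_abs, sq_abs, smul_eq_mul]
    ring
  · funext i j n z
    simp only [dgIntegrand, nJump_smul, nJumpVec_smul, map_smul, Prod.smul_mk, Pi.smul_apply,
      norm_smul, mul_pow, Real.norm_eq_abs, sq_abs, smul_eq_mul]
    ring
  · funext i x
    simp only [dgIntegrand, Pi.smul_apply, Prod.smul_fst, Prod.smul_snd, norm_smul, mul_pow,
      Real.norm_eq_abs, sq_abs, smul_eq_mul]
    ring
  · funext i x
    simp only [dgIntegrand, Pi.smul_apply, Prod.smul_fst, Prod.smul_snd, norm_smul, mul_pow,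
      Real.norm_eq_abs, sq_abs, smul_eq_mul]
    ring
  · funext i n z
    simp only [dgIntegrand, Pi.smul_apply, Prod.smul_fst, Prod.smul_snd, norm_smul, mul_pow,
      Real.norm_eq_abs, sq_abs, smul_eq_mul]
    ring
  · funext i n z
    simp only [dgIntegrand, Pi.smul_apply, Prod.smul_fst, Prod.smul_snd, map_smul,
      real_inner_smul_left, smul_eq_mul]
    ring

theorem augmentIntegrand_smul (π : Parameters d) (r : ℝ) :
    h.augmentIntegrand π (r • W) = r ^ 2 • h.augmentIntegrand π W := by
  refine Prod.ext ?_ (Prod.ext ?_ (Prod.ext ?_ (Prod.ext ?_ (Prod.ext ?_ ?_))))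
  · funext i k x
    simp only [augmentIntegrand, below, belowVec, Pi.smul_apply, Prod.smul_fst, Prod.smul_snd,
      norm_smul, mul_pow, Real.norm_eq_abs, sq_abs, smul_eq_mul]
    ring
  · funext i j n z
    simp only [augmentIntegrand, avg_smul, avgVec_smul, map_smul, Prod.smul_mk, Pi.smul_apply,
      norm_smul, mul_pow, Real.norm_eq_abs, sq_abs, smul_eq_mul]
    ring
  · funext i x
    simp [augmentIntegrand]
  · funext i x
    simp [augmentIntegrand]
  · funext i n z
    simp only [augmentIntegrand, Pi.smul_apply, Prod.smul_fst, Prod.smul_snd, map_smul, norm_smul,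
      mul_pow, Real.norm_eq_abs, sq_abs, smul_eq_mul]
    ring
  · funext i n z
    simp only [augmentIntegrand, Pi.smul_apply, Prod.smul_fst, Prod.smul_snd, smul_eq_mul]
    ring

theorem dgSq_smul (π : Parameters d) (hW : h.IsContinuous W) (r : ℝ) :
    h.dgSq π (r • W) = r ^ 2 * h.dgSq π W := by
  rw [dgSq_eq_total π hW, dgSq_eq_total π (hW.smul r), dgIntegrand_smul, total_smul]

theorem dgPlusSq_smul (π : Parameters d) (hW : h.IsContinuous W) (r : ℝ) :
    h.dgPlusSq π (r • W) = r ^ 2 * h.dgPlusSq π W := by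
  rw [dgPlusSq_eq_total π hW, dgPlusSq_eq_total π (hW.smul r), dgSq_smul π hW,
    augmentIntegrand_smul, total_smul]
  ring

end Linear

end Mesh

end TrefftzDG

namespace TrefftzDG

variable {d : ℕ}

/-! ### Pointwise identities and inequalities -/

section Young

variable {E : Type*} [NormedAddCommGroup E] [InnerProductSpace ℝ E]

theorem inner_le_half_norm_sq (u v : E) :
    inner ℝ u v ≤ (1 / 2) * ‖u‖ ^ 2 + (1 / 2) * ‖v‖ ^ 2 := by
  have := norm_sub_sq_real u v
  nlinarith [sq_nonneg ‖u - v‖]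

/-- Half the sum of ‖p - q‖², ‖a - q‖² and ‖a + p‖² is nonnegative. For the lateral faces in the
second bound: p and q are weighted jumps of V and W (boundary values on the boundary), a the
weighted mean or trace of W. -/
theorem inner_sub_add_le_norm_sq (a p q : E) :
    inner ℝ p q - inner ℝ a p + inner ℝ a q ≤ ‖p‖ ^ 2 + ‖q‖ ^ 2 + ‖a‖ ^ 2 := by
  have h1 := norm_sub_sq_real p q
  have h2 := norm_sub_sq_real a q
  have h3 := norm_add_sq_real a p
  nlinarith [sq_nonneg ‖p - q‖, sq_nonneg ‖a - q‖, sq_nonneg ‖a + p‖]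

/-- The left side is -(u - u')·v', at most ½‖u - u'‖² + ½‖v'‖². The trace v' from above does not
occur alone in the augmented norm; the last term on the right supplies ½‖v'‖² at the price of ½‖v‖²,
which 2‖v‖² covers. -/
theorem inner_jump_le_norm_sq (u u' v v' : E) :
    inner ℝ u (v - v') - (inner ℝ u v - inner ℝ u' v')
      ≤ (1 / 2) * ‖u - u'‖ ^ 2 + (1 / 2) * ‖v - v'‖ ^ 2 + 2 * ‖v‖ ^ 2
        - (1 / 2) * (inner ℝ v v - inner ℝ v' v') := by
  have h1 := norm_add_sq_real (u - u') v'
  rw [inner_sub_left] at h1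
  rw [inner_sub_right, real_inner_self_eq_norm_sq, real_inner_self_eq_norm_sq]
  nlinarith [sq_nonneg ‖u - u' + v'‖, sq_nonneg ‖v - v'‖, sq_nonneg ‖v‖]

end Young

/-- The exponent e + 1/2 is split evenly as twice 1/4 + e/2. -/
theorem Model.weighted_inner_pow (S : Model d) {a : ℝ} (ha : 0 < a) (e : ℝ) (u v : Space d) :
    a * inner ℝ (S.pow e u) (S.pow (1 / 2) v)
      = inner ℝ (a ^ (1 / 2 : ℝ) • S.pow (1 / 4 + e / 2) u)
        (a ^ (1 / 2 : ℝ) • S.pow (1 / 4 + e / 2) v) := by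
  rw [real_inner_smul_left, real_inner_smul_right, S.inner_pow_left, S.inner_pow_left, S.pow_pow,
    S.pow_pow, ← mul_assoc, ← Real.rpow_add ha]
  norm_num
  left
  congr 3
  ring

/-- The weights of the means in the augmented norm are dual to those of the jumps: the powers of a
cancel, and 1/4 - e/2 and 1/4 + e/2 add up to 1/2. -/
theorem Model.inner_pow_half_eq (S : Model d) {a : ℝ} (ha : 0 < a) (e : ℝ) (u v : Space d) :
    inner ℝ u (S.pow (1 / 2) v) = inner ℝ (a ^ (-(1 / 2) : ℝ) • S.pow (1 / 4 - e / 2) u)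
        (a ^ (1 / 2 : ℝ) • S.pow (1 / 4 + e / 2) v) := by
  rw [real_inner_smul_left, real_inner_smul_right, S.inner_pow_left, S.pow_pow, ← mul_assoc,
    ← Real.rpow_add ha]
  norm_num

theorem rpow_half_mul_rpow_half {b : ℝ} (hb : 0 < b) :
    b ^ (1 / 2 : ℝ) * b ^ (1 / 2 : ℝ) = b := by
  rw [← Real.rpow_add hb]
  norm_num

theorem rpow_neg_half_mul_rpow_half {b : ℝ} (hb : 0 < b) :
    b ^ (-(1 / 2) : ℝ) * b ^ (1 / 2 : ℝ) = 1 := by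
  rw [← Real.rpow_add hb]
  norm_num

namespace Mesh

variable {S : Model d} {h : Mesh S} {V W : h.Broken}

/-- Written in the weighted quantities that occur in the norms, the density involves only products
of abstract scalars and vectors, so the weights play no further role. Likewise for the similar
identities that follow. -/
theorem form_time_eq (π : Parameters d) (i j : Fin h.m) (n : Fin (h.M + 1)) (z : Space d × ℝ) :
    (h.formIntegrand π V W).2.1 i j n z
      = (π.β z ^ (-(1 / 2) : ℝ) * h.avg V i j n z) * (π.β z ^ (1 / 2 : ℝ) * h.nJumpVec W i j n z)
        + inner ℝ (π.α z ^ (-(1 / 2) : ℝ) • S.pow (1 / 4 - π.δ z / 2) (h.avgVec V i j n z))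
          (π.α z ^ (1 / 2 : ℝ) • S.pow (1 / 4 + π.δ z / 2) (h.nJump W i j n z))
        + inner ℝ (π.α z ^ (1 / 2 : ℝ) • S.pow (1 / 4 + π.δ z / 2) (h.nJump V i j n z))
          (π.α z ^ (1 / 2 : ℝ) • S.pow (1 / 4 + π.δ z / 2) (h.nJump W i j n z))
        + (π.β z ^ (1 / 2 : ℝ) * h.nJumpVec V i j n z)
          * (π.β z ^ (1 / 2 : ℝ) * h.nJumpVec W i j n z) := by
  rw [← S.weighted_inner_pow (π.α_pos z), ← S.inner_pow_half_eq (π.α_pos z)]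
  simp only [formIntegrand]
  linear_combination (-(h.avg V i j n z * h.nJumpVec W i j n z))
      * rpow_neg_half_mul_rpow_half (π.β_pos z)
    - (h.nJumpVec V i j n z * h.nJumpVec W i j n z) * rpow_half_mul_rpow_half (π.β_pos z)

theorem flux_time_eq (π : Parameters d) (i j : Fin h.m) (n : Fin (h.M + 1)) (z : Space d × ℝ) :
    (h.fluxIntegrand V W).2.1 i j n z
      = ((π.β z ^ (-(1 / 2) : ℝ) * h.avg V i j n z) * (π.β z ^ (1 / 2 : ℝ) * h.nJumpVec W i j n z)
        + inner ℝ (π.α z ^ (-(1 / 2) : ℝ) • S.pow (1 / 4 - π.δ z / 2) (h.avgVec V i j n z))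
          (π.α z ^ (1 / 2 : ℝ) • S.pow (1 / 4 + π.δ z / 2) (h.nJump W i j n z)))
      + ((π.β z ^ (-(1 / 2) : ℝ) * h.avg W i j n z) * (π.β z ^ (1 / 2 : ℝ) * h.nJumpVec V i j n z)
        + inner ℝ (π.α z ^ (-(1 / 2) : ℝ) • S.pow (1 / 4 - π.δ z / 2) (h.avgVec W i j n z))
          (π.α z ^ (1 / 2 : ℝ) • S.pow (1 / 4 + π.δ z / 2) (h.nJump V i j n z))) := by
  rw [← S.inner_pow_half_eq (π.α_pos z), ← S.inner_pow_half_eq (π.α_pos z)]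
  simp only [fluxIntegrand]
  linear_combination (-(h.avg V i j n z * h.nJumpVec W i j n z
    + h.avg W i j n z * h.nJumpVec V i j n z)) * rpow_neg_half_mul_rpow_half (π.β_pos z)

theorem form_dirichlet_eq (π : Parameters d) (i : Fin h.m) (n : Fin (h.M + 1))
    (z : Space d × ℝ) :
    (h.formIntegrand π V W).2.2.2.2.1 i n z
      = inner ℝ (π.α z ^ (-(1 / 2) : ℝ) • S.pow (1 / 4 - π.δ z / 2) ((V i n).2 z.1 z.2))
          ((π.α z ^ (1 / 2 : ℝ) * (W i n).1 z.1 z.2) •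
            S.pow (1 / 4 + π.δ z / 2) (outwardNormal S.Ω z.1))
        + inner ℝ ((π.α z ^ (1 / 2 : ℝ) * (V i n).1 z.1 z.2) •
            S.pow (1 / 4 + π.δ z / 2) (outwardNormal S.Ω z.1))
          ((π.α z ^ (1 / 2 : ℝ) * (W i n).1 z.1 z.2) •
            S.pow (1 / 4 + π.δ z / 2) (outwardNormal S.Ω z.1)) := by
  have h1 : ∀ r : ℝ, (π.α z ^ (1 / 2 : ℝ) * r) • S.pow (1 / 4 + π.δ z / 2) (outwardNormal S.Ω z.1)
      = π.α z ^ (1 / 2 : ℝ) • S.pow (1 / 4 + π.δ z / 2) (r • outwardNormal S.Ω z.1) := by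
    intro r
    rw [map_smul, smul_smul]
  rw [h1, h1, ← S.weighted_inner_pow (π.α_pos z), ← S.inner_pow_half_eq (π.α_pos z)]
  simp only [formIntegrand, map_smul, real_inner_smul_left, real_inner_smul_right]
  ring

theorem flux_dirichlet_eq (π : Parameters d) (i : Fin h.m) (n : Fin (h.M + 1))
    (z : Space d × ℝ) :
    (h.fluxIntegrand V W).2.2.2.2.1 i n z
      = inner ℝ (π.α z ^ (-(1 / 2) : ℝ) • S.pow (1 / 4 - π.δ z / 2) ((V i n).2 z.1 z.2))
          ((π.α z ^ (1 / 2 : ℝ) * (W i n).1 z.1 z.2) •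
            S.pow (1 / 4 + π.δ z / 2) (outwardNormal S.Ω z.1))
        + inner ℝ (π.α z ^ (-(1 / 2) : ℝ) • S.pow (1 / 4 - π.δ z / 2) ((W i n).2 z.1 z.2))
          ((π.α z ^ (1 / 2 : ℝ) * (V i n).1 z.1 z.2) •
            S.pow (1 / 4 + π.δ z / 2) (outwardNormal S.Ω z.1)) := by
  have h1 : ∀ r : ℝ, (π.α z ^ (1 / 2 : ℝ) * r) • S.pow (1 / 4 + π.δ z / 2) (outwardNormal S.Ω z.1)
      = π.α z ^ (1 / 2 : ℝ) • S.pow (1 / 4 + π.δ z / 2) (r • outwardNormal S.Ω z.1) := by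
    intro r
    rw [map_smul, smul_smul]
  rw [h1, h1, ← S.inner_pow_half_eq (π.α_pos z), ← S.inner_pow_half_eq (π.α_pos z)]
  simp only [fluxIntegrand, map_smul, real_inner_smul_right, S.inner_pow_left]
  ring

theorem form_neumann_eq (π : Parameters d) (i : Fin h.m) (n : Fin (h.M + 1))
    (z : Space d × ℝ) :
    (h.formIntegrand π V W).2.2.2.2.2 i n z
      = (π.β z ^ (-(1 / 2) : ℝ) * (V i n).1 z.1 z.2) * (π.β z ^ (1 / 2 : ℝ) *
          inner ℝ (S.pow (1 / 2) ((W i n).2 z.1 z.2)) (outwardNormal S.Ω z.1))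
        + (π.β z ^ (1 / 2 : ℝ) *
          inner ℝ (S.pow (1 / 2) ((V i n).2 z.1 z.2)) (outwardNormal S.Ω z.1)) *
          (π.β z ^ (1 / 2 : ℝ) *
          inner ℝ (S.pow (1 / 2) ((W i n).2 z.1 z.2)) (outwardNormal S.Ω z.1)) := by
  simp only [formIntegrand]
  generalize inner ℝ (S.pow (1 / 2) ((W i n).2 z.1 z.2)) (outwardNormal S.Ω z.1) = y
  generalize inner ℝ (S.pow (1 / 2) ((V i n).2 z.1 z.2)) (outwardNormal S.Ω z.1) = x
  linear_combination (-((V i n).1 z.1 z.2 * y)) * rpow_neg_half_mul_rpow_half (π.β_pos z)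
    - (x * y) * rpow_half_mul_rpow_half (π.β_pos z)

theorem flux_neumann_eq (π : Parameters d) (i : Fin h.m) (n : Fin (h.M + 1))
    (z : Space d × ℝ) :
    (h.fluxIntegrand V W).2.2.2.2.2 i n z
      = (π.β z ^ (-(1 / 2) : ℝ) * (V i n).1 z.1 z.2) * (π.β z ^ (1 / 2 : ℝ) *
          inner ℝ (S.pow (1 / 2) ((W i n).2 z.1 z.2)) (outwardNormal S.Ω z.1))
        + (π.β z ^ (-(1 / 2) : ℝ) * (W i n).1 z.1 z.2) * (π.β z ^ (1 / 2 : ℝ) *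
          inner ℝ (S.pow (1 / 2) ((V i n).2 z.1 z.2)) (outwardNormal S.Ω z.1)) := by
  simp only [fluxIntegrand]
  generalize inner ℝ (S.pow (1 / 2) ((W i n).2 z.1 z.2)) (outwardNormal S.Ω z.1) = y
  generalize inner ℝ (S.pow (1 / 2) ((V i n).2 z.1 z.2)) (outwardNormal S.Ω z.1) = x
  linear_combination (-((V i n).1 z.1 z.2 * y + (W i n).1 z.1 z.2 * x))
    * rpow_neg_half_mul_rpow_half (π.β_pos z)

/-- Coercivity before integration. On space-like faces, w⁻·(w⁻ - w⁺) is ½|w⁻ - w⁺|² plus half the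
difference of |w⁻|² and |w⁺|². On lateral faces, the products without a stabilization parameter are
exactly half of the flux. At the bottom and the top, the flux accounts for the factors one half. -/
theorem dgIntegrand_eq (π : Parameters d) :
    h.dgIntegrand π W = h.formIntegrand π W W + (-(1 / 2) : ℝ) • h.fluxIntegrand W W := by
  refine Prod.ext ?_ (Prod.ext ?_ (Prod.ext ?_ (Prod.ext ?_ (Prod.ext ?_ ?_))))
  · funext i k x
    simp only [dgIntegrand, formIntegrand, fluxIntegrand, tJump, tJumpVec, below, belowVec,
      Prod.fst_add, Prod.smul_fst, Pi.add_apply, Pi.smul_apply, smul_eq_mul,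
      ← real_inner_self_eq_norm_sq, inner_sub_left, inner_sub_right]
    rw [real_inner_comm ((W i k.castSucc).2 x (h.level k)) ((W i k.succ).2 x (h.level k))]
    ring
  · funext i j n z
    have h1 := form_time_eq (V := W) (W := W) π i j n z
    have h2 := flux_time_eq (V := W) (W := W) π i j n z
    change (h.dgIntegrand π W).2.1 i j n z = (h.formIntegrand π W W).2.1 i j n z
      + (-(1 / 2) : ℝ) * (h.fluxIntegrand W W).2.1 i j n z
    rw [h1, h2]
    simp only [dgIntegrand, real_inner_self_eq_norm_sq]
    ring
  · funext i x
    simp only [dgIntegrand, formIntegrand, fluxIntegrand, Prod.fst_add, Prod.snd_add,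
      Prod.smul_fst, Prod.smul_snd, Pi.add_apply, Pi.smul_apply, smul_eq_mul,
      real_inner_self_eq_norm_sq]
    ring
  · funext i x
    simp only [dgIntegrand, formIntegrand, fluxIntegrand, Prod.fst_add, Prod.snd_add,
      Prod.smul_fst, Prod.smul_snd, Pi.add_apply, Pi.smul_apply, smul_eq_mul,
      real_inner_self_eq_norm_sq]
    ring
  · funext i n z
    have h1 := form_dirichlet_eq (V := W) (W := W) π i n z
    have h2 := flux_dirichlet_eq (V := W) (W := W) π i n z
    change (h.dgIntegrand π W).2.2.2.2.1 i n z = (h.formIntegrand π W W).2.2.2.2.1 i n z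
      + (-(1 / 2) : ℝ) * (h.fluxIntegrand W W).2.2.2.2.1 i n z
    rw [h1, h2]
    simp only [dgIntegrand, real_inner_self_eq_norm_sq]
    ring
  · funext i n z
    have h1 := form_neumann_eq (V := W) (W := W) π i n z
    have h2 := flux_neumann_eq (V := W) (W := W) π i n z
    change (h.dgIntegrand π W).2.2.2.2.2 i n z = (h.formIntegrand π W W).2.2.2.2.2 i n z
      + (-(1 / 2) : ℝ) * (h.fluxIntegrand W W).2.2.2.2.2 i n z
    rw [h1, h2]
    simp only [dgIntegrand]
    ring

/-- Young's inequality for each product of a trace, mean or jump of V with a jump or trace of W that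
the DG norm controls. -/
theorem formIntegrand_le (π : Parameters d) : h.formIntegrand π V W
    ≤ h.dgIntegrand π V + h.augmentIntegrand π V + h.dgIntegrand π W := by
  refine ⟨fun i k x => ?_, fun i j n z => ?_, fun i x => ?_, fun i x => ?_, fun i n z => ?_,
    fun i n z => ?_⟩
  · change (h.formIntegrand π V W).1 i k x ≤ (h.dgIntegrand π V).1 i k x
      + (h.augmentIntegrand π V).1 i k x + (h.dgIntegrand π W).1 i k x
    simp only [formIntegrand, dgIntegrand, augmentIntegrand, ← inv_pow]
    have h1 := inner_le_half_norm_sq (h.belowVec V i k x) (h.tJumpVec W i k x)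
    nlinarith [sq_nonneg (S.c⁻¹ * h.below V i k x - S.c⁻¹ * h.tJump W i k x),
      sq_nonneg (S.c⁻¹ * h.below V i k x), sq_nonneg (S.c⁻¹ * h.tJump V i k x),
      sq_nonneg ‖h.tJumpVec V i k x‖, sq_nonneg ‖h.belowVec V i k x‖]
  · change (h.formIntegrand π V W).2.1 i j n z ≤ (h.dgIntegrand π V).2.1 i j n z
      + (h.augmentIntegrand π V).2.1 i j n z + (h.dgIntegrand π W).2.1 i j n z
    rw [form_time_eq]
    simp only [dgIntegrand, augmentIntegrand]
    generalize π.α z ^ (-(1 / 2) : ℝ) • S.pow (1 / 4 - π.δ z / 2) (h.avgVec V i j n z) = a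
    generalize π.α z ^ (1 / 2 : ℝ) • S.pow (1 / 4 + π.δ z / 2) (h.nJump V i j n z) = p
    generalize π.α z ^ (1 / 2 : ℝ) • S.pow (1 / 4 + π.δ z / 2) (h.nJump W i j n z) = q
    generalize π.β z ^ (-(1 / 2) : ℝ) * h.avg V i j n z = a'
    generalize π.β z ^ (1 / 2 : ℝ) * h.nJumpVec V i j n z = p'
    generalize π.β z ^ (1 / 2 : ℝ) * h.nJumpVec W i j n z = q'
    have h1 := inner_le_half_norm_sq a q
    have h2 := inner_le_half_norm_sq p q
    linarith [sq_nonneg (a' - q'), sq_nonneg (p' - q'), sq_nonneg a', sq_nonneg p', sq_nonneg ‖a‖,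
      sq_nonneg ‖p‖]
  · change (0 : ℝ) ≤ (h.dgIntegrand π V).2.2.1 i x + 0 + (h.dgIntegrand π W).2.2.1 i x
    simp only [dgIntegrand]
    positivity
  · change (h.formIntegrand π V W).2.2.2.1 i x ≤ (h.dgIntegrand π V).2.2.2.1 i x
      + 0 + (h.dgIntegrand π W).2.2.2.1 i x
    simp only [formIntegrand, dgIntegrand, ← inv_pow]
    have h1 := inner_le_half_norm_sq ((V i (Fin.last h.M)).2 x S.T) ((W i (Fin.last h.M)).2 x S.T)
    nlinarith [sq_nonneg (S.c⁻¹ * (V i (Fin.last h.M)).1 x S.T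
      - S.c⁻¹ * (W i (Fin.last h.M)).1 x S.T)]
  · change (h.formIntegrand π V W).2.2.2.2.1 i n z ≤ (h.dgIntegrand π V).2.2.2.2.1 i n z
      + (h.augmentIntegrand π V).2.2.2.2.1 i n z + (h.dgIntegrand π W).2.2.2.2.1 i n z
    rw [form_dirichlet_eq]
    simp only [dgIntegrand, augmentIntegrand]
    generalize π.α z ^ (-(1 / 2) : ℝ) • S.pow (1 / 4 - π.δ z / 2) ((V i n).2 z.1 z.2) = a
    generalize (π.α z ^ (1 / 2 : ℝ) * (V i n).1 z.1 z.2) •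
      S.pow (1 / 4 + π.δ z / 2) (outwardNormal S.Ω z.1) = p
    generalize (π.α z ^ (1 / 2 : ℝ) * (W i n).1 z.1 z.2) •
      S.pow (1 / 4 + π.δ z / 2) (outwardNormal S.Ω z.1) = q
    have h1 := inner_le_half_norm_sq a q
    have h2 := inner_le_half_norm_sq p q
    linarith [sq_nonneg ‖a‖, sq_nonneg ‖p‖]
  · change (h.formIntegrand π V W).2.2.2.2.2 i n z ≤ (h.dgIntegrand π V).2.2.2.2.2 i n z
      + (h.augmentIntegrand π V).2.2.2.2.2 i n z + (h.dgIntegrand π W).2.2.2.2.2 i n z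
    rw [form_neumann_eq]
    simp only [dgIntegrand, augmentIntegrand]
    generalize π.β z ^ (-(1 / 2) : ℝ) * (V i n).1 z.1 z.2 = a'
    generalize π.β z ^ (1 / 2 : ℝ) *
      inner ℝ (S.pow (1 / 2) ((V i n).2 z.1 z.2)) (outwardNormal S.Ω z.1) = p'
    generalize π.β z ^ (1 / 2 : ℝ) *
      inner ℝ (S.pow (1 / 2) ((W i n).2 z.1 z.2)) (outwardNormal S.Ω z.1) = q'
    linarith [sq_nonneg (a' - q'), sq_nonneg (p' - q'), sq_nonneg a', sq_nonneg p']

/-- Subtracting the flux of (V, W) acts as an integration by parts: traces of V against jumps of W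
become jumps of V against traces of W. The added half of the flux of (W, W) provides the traces from
above on space-like faces, and is harmless elsewhere. Both have zero integral on the Trefftz space.
-/
theorem formIntegrand_le_flux (π : Parameters d) : h.formIntegrand π V W
    ≤ h.dgIntegrand π V + (h.dgIntegrand π W + h.augmentIntegrand π W)
      + (h.fluxIntegrand V W + (-(1 / 2) : ℝ) • h.fluxIntegrand W W) := by
  refine ⟨fun i k x => ?_, fun i j n z => ?_, fun i x => ?_, fun i x => ?_, fun i n z => ?_,
    fun i n z => ?_⟩
  · change (h.formIntegrand π V W).1 i k x ≤ (h.dgIntegrand π V).1 i k x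
      + ((h.dgIntegrand π W).1 i k x + (h.augmentIntegrand π W).1 i k x)
      + ((h.fluxIntegrand V W).1 i k x + (-(1 / 2) : ℝ) * (h.fluxIntegrand W W).1 i k x)
    simp only [formIntegrand, dgIntegrand, augmentIntegrand, fluxIntegrand, tJump, tJumpVec, below,
      belowVec, ← inv_pow]
    have h1 := inner_jump_le_norm_sq ((V i k.castSucc).2 x (h.level k))
      ((V i k.succ).2 x (h.level k)) ((W i k.castSucc).2 x (h.level k))
      ((W i k.succ).2 x (h.level k))
    have h2 := inner_jump_le_norm_sq (S.c⁻¹ * (V i k.castSucc).1 x (h.level k))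
      (S.c⁻¹ * (V i k.succ).1 x (h.level k)) (S.c⁻¹ * (W i k.castSucc).1 x (h.level k))
      (S.c⁻¹ * (W i k.succ).1 x (h.level k))
    simp only [← mul_sub, Real.norm_eq_abs, sq_abs, Real.inner_apply] at h2
    linarith
  · change (h.formIntegrand π V W).2.1 i j n z ≤ (h.dgIntegrand π V).2.1 i j n z
      + ((h.dgIntegrand π W).2.1 i j n z + (h.augmentIntegrand π W).2.1 i j n z)
      + ((h.fluxIntegrand V W).2.1 i j n z + (-(1 / 2) : ℝ) * (h.fluxIntegrand W W).2.1 i j n z)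
    rw [form_time_eq, flux_time_eq π, flux_time_eq π]
    simp only [dgIntegrand, augmentIntegrand]
    generalize π.α z ^ (-(1 / 2) : ℝ) • S.pow (1 / 4 - π.δ z / 2) (h.avgVec V i j n z) = b
    generalize π.α z ^ (-(1 / 2) : ℝ) • S.pow (1 / 4 - π.δ z / 2) (h.avgVec W i j n z) = a
    generalize π.α z ^ (1 / 2 : ℝ) • S.pow (1 / 4 + π.δ z / 2) (h.nJump V i j n z) = p
    generalize π.α z ^ (1 / 2 : ℝ) • S.pow (1 / 4 + π.δ z / 2) (h.nJump W i j n z) = q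
    generalize π.β z ^ (-(1 / 2) : ℝ) * h.avg V i j n z = b'
    generalize π.β z ^ (-(1 / 2) : ℝ) * h.avg W i j n z = a'
    generalize π.β z ^ (1 / 2 : ℝ) * h.nJumpVec V i j n z = p'
    generalize π.β z ^ (1 / 2 : ℝ) * h.nJumpVec W i j n z = q'
    have h1 := inner_sub_add_le_norm_sq a p q
    linarith [sq_nonneg (a' - q'), sq_nonneg (p' - q'), sq_nonneg (a' + p')]
  · change (0 : ℝ) ≤ (h.dgIntegrand π V).2.2.1 i x + ((h.dgIntegrand π W).2.2.1 i x + 0)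
      + ((h.fluxIntegrand V W).2.2.1 i x + (-(1 / 2) : ℝ) * (h.fluxIntegrand W W).2.2.1 i x)
    simp only [dgIntegrand, fluxIntegrand, real_inner_self_eq_norm_sq, ← inv_pow]
    have h1 := inner_le_half_norm_sq ((V i 0).2 x 0) ((W i 0).2 x 0)
    nlinarith [sq_nonneg (S.c⁻¹ * (V i 0).1 x 0 - S.c⁻¹ * (W i 0).1 x 0),
      sq_nonneg (S.c⁻¹ * (W i 0).1 x 0), sq_nonneg ‖(W i 0).2 x 0‖]
  · change (h.formIntegrand π V W).2.2.2.1 i x ≤ (h.dgIntegrand π V).2.2.2.1 i x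
      + ((h.dgIntegrand π W).2.2.2.1 i x + 0)
      + ((h.fluxIntegrand V W).2.2.2.1 i x + (-(1 / 2) : ℝ) * (h.fluxIntegrand W W).2.2.2.1 i x)
    simp only [formIntegrand, dgIntegrand, fluxIntegrand, real_inner_self_eq_norm_sq, ← inv_pow]
    nlinarith [sq_nonneg (S.c⁻¹ * (V i (Fin.last h.M)).1 x S.T),
      sq_nonneg ‖(V i (Fin.last h.M)).2 x S.T‖]
  · change (h.formIntegrand π V W).2.2.2.2.1 i n z ≤ (h.dgIntegrand π V).2.2.2.2.1 i n z
      + ((h.dgIntegrand π W).2.2.2.2.1 i n z + (h.augmentIntegrand π W).2.2.2.2.1 i n z)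
      + ((h.fluxIntegrand V W).2.2.2.2.1 i n z
        + (-(1 / 2) : ℝ) * (h.fluxIntegrand W W).2.2.2.2.1 i n z)
    rw [form_dirichlet_eq, flux_dirichlet_eq π, flux_dirichlet_eq π]
    simp only [dgIntegrand, augmentIntegrand]
    have h1 := inner_sub_add_le_norm_sq
      (π.α z ^ (-(1 / 2) : ℝ) • S.pow (1 / 4 - π.δ z / 2) ((W i n).2 z.1 z.2))
      ((π.α z ^ (1 / 2 : ℝ) * (V i n).1 z.1 z.2) •
        S.pow (1 / 4 + π.δ z / 2) (outwardNormal S.Ω z.1))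
      ((π.α z ^ (1 / 2 : ℝ) * (W i n).1 z.1 z.2) •
        S.pow (1 / 4 + π.δ z / 2) (outwardNormal S.Ω z.1))
    linarith
  · change (h.formIntegrand π V W).2.2.2.2.2 i n z ≤ (h.dgIntegrand π V).2.2.2.2.2 i n z
      + ((h.dgIntegrand π W).2.2.2.2.2 i n z + (h.augmentIntegrand π W).2.2.2.2.2 i n z)
      + ((h.fluxIntegrand V W).2.2.2.2.2 i n z
        + (-(1 / 2) : ℝ) * (h.fluxIntegrand W W).2.2.2.2.2 i n z)
    rw [form_neumann_eq, flux_neumann_eq π, flux_neumann_eq π]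
    simp only [dgIntegrand, augmentIntegrand]
    generalize π.β z ^ (-(1 / 2) : ℝ) * (V i n).1 z.1 z.2 = b'
    generalize π.β z ^ (-(1 / 2) : ℝ) * (W i n).1 z.1 z.2 = a'
    generalize π.β z ^ (1 / 2 : ℝ) *
      inner ℝ (S.pow (1 / 2) ((V i n).2 z.1 z.2)) (outwardNormal S.Ω z.1) = p'
    generalize π.β z ^ (1 / 2 : ℝ) *
      inner ℝ (S.pow (1 / 2) ((W i n).2 z.1 z.2)) (outwardNormal S.Ω z.1) = q'
    linarith [sq_nonneg (a' - q'), sq_nonneg (p' - q'), sq_nonneg (a' + p')]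

end Mesh

end TrefftzDG

namespace TrefftzDG

variable {d : ℕ}

/-! ### The energy identity -/

theorem finsetSum_prod {ι X Y : Type*} [MeasurableSpace X] [MeasurableSpace Y] (s : Finset ι)
    (μ : ι → Measure X) [∀ i, IsFiniteMeasure (μ i)] (ν : Measure Y) [IsFiniteMeasure ν] :
    (∑ i ∈ s, μ i).prod ν = ∑ i ∈ s, (μ i).prod ν := by
  classical
  induction s using Finset.induction_on with
  | empty => simp
  | insert i s hi ih =>
    rw [Finset.sum_insert hi, Finset.sum_insert hi, Measure.add_prod, ih]

/-- Each interior face is seen once from either side. -/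
theorem sum_sum_erase_eq {m : ℕ} (f : Fin m → Fin m → ℝ) :
    ∑ i, ∑ j ∈ Finset.univ.erase i, f i j = ∑ i, ∑ j ∈ Finset.Ioi i, (f i j + f j i) := by
  have h1 : ∀ i, ∑ j ∈ Finset.univ.erase i, f i j
      = ∑ j ∈ Finset.Ioi i, f i j + ∑ j ∈ Finset.Iio i, f i j := by
    intro i
    rw [← Finset.sum_union (Finset.disjoint_left.2 fun j hj hj' =>
      lt_asymm (Finset.mem_Ioi.1 hj) (Finset.mem_Iio.1 hj'))]
    refine Finset.sum_congr ?_ fun _ _ => rfl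
    ext j
    simp only [Finset.mem_erase, Finset.mem_univ, and_true, Finset.mem_union, Finset.mem_Ioi,
      Finset.mem_Iio, ne_iff_lt_or_gt]
    exact or_comm
  simp only [h1, Finset.sum_add_distrib]
  congr 1
  exact Finset.sum_comm' fun i j => by simp

namespace Mesh

variable {S : Model d} {h : Mesh S} {V W : h.Broken} {p : ℕ}

theorem timeMeasure_comm (h : Mesh S) (i j : Fin h.m) (n : Fin (h.M + 1)) :
    h.timeMeasure j i n = h.timeMeasure i j n := by
  rw [timeMeasure, timeMeasure, inter_comm]

theorem lateral_frontier_eq (h : Mesh S) (i : Fin h.m) (n : Fin (h.M + 1)) :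
    lateral (frontier (h.K i)) (h.time n.castSucc) (h.time n.succ)
      = ∑ j ∈ Finset.univ.erase i, h.timeMeasure i j n
        + h.bdryMeasure S.ΓD i n + h.bdryMeasure S.ΓN i n := by
  have hfin : ∀ F : Set (Space d), IsFiniteMeasure
      ((μHE[d - 1] : Measure (Space d)).restrict (frontier (h.K i) ∩ F)) := fun F =>
    isFiniteMeasure_restrict_frontier (h.polytope i) inter_subset_left
  have hfin' : IsFiniteMeasure (∑ j ∈ Finset.univ.erase i,
      (μHE[d - 1] : Measure (Space d)).restrict (frontier (h.K i) ∩ frontier (h.K j))) := by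
    infer_instance
  rw [lateral, h.restrict_frontier i, Measure.add_prod, Measure.add_prod, finsetSum_prod]
  rfl

/-- The energy flux of two fields through the lateral boundary of an element. -/
noncomputable def elementFlux (h : Mesh S) (V W : h.Broken) (i : Fin h.m) (n : Fin (h.M + 1))
    (z : Space d × ℝ) : ℝ :=
  (V i n).1 z.1 z.2 * inner ℝ (S.pow (1 / 2) ((W i n).2 z.1 z.2)) (outwardNormal (h.K i) z.1)
    + (W i n).1 z.1 z.2 * inner ℝ (S.pow (1 / 2) ((V i n).2 z.1 z.2)) (outwardNormal (h.K i) z.1)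

/-- The energy of two fields on an element at a given time. -/
noncomputable def energy (h : Mesh S) (V W : h.Broken) (i : Fin h.m) (n : Fin (h.M + 1))
    (t : ℝ) : ℝ :=
  ∫ x in h.K i, ((S.c ^ 2)⁻¹ * (V i n).1 x t * (W i n).1 x t
    + inner ℝ ((V i n).2 x t) ((W i n).2 x t))

theorem energy_sub_energy (hV : V ∈ h.trefftzSpace p) (hW : W ∈ h.trefftzSpace p) (i : Fin h.m)
    (n : Fin (h.M + 1)) :
    h.energy V W i n (h.time n.succ) - h.energy V W i n (h.time n.castSucc)
      = -∫ z, h.elementFlux V W i n z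
          ∂lateral (frontier (h.K i)) (h.time n.castSucc) (h.time n.succ) := by
  obtain ⟨b, hb, hVb⟩ := Model.mem_localTrefftz.1 (mem_trefftzSpace.1 hV i n)
  obtain ⟨b', hb', hWb⟩ := Model.mem_localTrefftz.1 (mem_trefftzSpace.1 hW i n)
  simp only [energy, elementFlux, hVb, hWb, S.energy_trefftzField, S.flux_trefftzField]
  rw [(h.polytope i).energy_balance S hb hb' (h.time_strictMono Fin.castSucc_lt_succ).le,
    integral_neg, neg_neg]

theorem integral_elementFlux (hV : h.IsContinuous V) (hW : h.IsContinuous W) (i : Fin h.m)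
    (n : Fin (h.M + 1)) :
    ∫ z, h.elementFlux V W i n z
        ∂lateral (frontier (h.K i)) (h.time n.castSucc) (h.time n.succ)
      = ∑ j ∈ Finset.univ.erase i, ∫ z, h.elementFlux V W i n z ∂h.timeMeasure i j n
        + ∫ z, h.elementFlux V W i n z ∂h.bdryMeasure S.ΓD i n
        + ∫ z, h.elementFlux V W i n z ∂h.bdryMeasure S.ΓN i n := by
  have hc := fun {E : Type} [NormedAddCommGroup E] {g : Space d × ℝ → E} (hg : Continuous g) =>
    memLp_top_lateral (h.polytope i) subset_rfl isClosed_frontier.measurableSet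
      (h.time n.castSucc) (h.time n.succ) hg
  have hn := memLp_top_outwardNormal (h.polytope i) subset_rfl (h.time n.castSucc) (h.time n.succ)
  have := isFiniteMeasure_lateral (h.polytope i) subset_rfl (h.time n.castSucc) (h.time n.succ)
  have hint : Integrable (h.elementFlux V W i n)
      (lateral (frontier (h.K i)) (h.time n.castSucc) (h.time n.succ)) :=
    MemLp.integrable le_top ((memLp_top_mul (hc (hV i n).1) (memLp_top_inner
      (S.memLp_top_pow_const _ (hc (hW i n).2)) hn)).add (memLp_top_mul (hc (hW i n).1)
        (memLp_top_inner (S.memLp_top_pow_const _ (hc (hV i n).2)) hn)))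
  rw [lateral_frontier_eq] at hint ⊢
  have h1 := hint.left_of_add_measure
  rw [integral_add_measure h1 hint.right_of_add_measure,
    integral_add_measure h1.left_of_add_measure h1.right_of_add_measure,
    integral_finsetSum_measure fun j hj =>
      (integrable_finsetSum_measure.1 h1.left_of_add_measure) j hj]

/-- Since the two normals are opposite, the fluxes out of the two elements add up to products of
means and jumps, as in ab - a'b' = {a}[b] + [a]{b}. -/
theorem ae_elementFlux_add (i j : Fin h.m) (hij : i ≠ j)
    (n : Fin (h.M + 1)) : ∀ᵐ z ∂h.timeMeasure i j n,
      h.elementFlux V W i n z + h.elementFlux V W j n z = (h.fluxIntegrand V W).2.1 i j n z := by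
  filter_upwards [ae_lateral_fst (h.polytope i) inter_subset_left _ _
    (h.ae_outwardNormal_eq_neg hij)] with z hz
  simp only [elementFlux, fluxIntegrand, avg, avgVec, nJump, nJumpVec, hz,
    map_add, map_smul, inner_add_left, inner_add_right, inner_neg_right,
    real_inner_smul_left, real_inner_smul_right, ← S.inner_pow_left]
  ring

theorem ae_elementFlux_bdry {Γ : Set (Space d)} (hΓ : MeasurableSet Γ) (hsub : Γ ⊆ frontier S.Ω)
    (i : Fin h.m) (n : Fin (h.M + 1)) : ∀ᵐ z ∂h.bdryMeasure Γ i n,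
      h.elementFlux V W i n z =
        (V i n).1 z.1 z.2 * inner ℝ (S.pow (1 / 2) ((W i n).2 z.1 z.2)) (outwardNormal S.Ω z.1)
        + (W i n).1 z.1 z.2 *
          inner ℝ (S.pow (1 / 2) ((V i n).2 z.1 z.2)) (outwardNormal S.Ω z.1) := by
  filter_upwards [ae_lateral_fst (h.polytope i) inter_subset_left _ _
    (h.ae_outwardNormal_eq i hΓ hsub)] with z hz
  rw [elementFlux, hz]

/-- Summation by parts in time: the two energies at an internal level combine into a jump, and the
outermost ones give the bottom and the top. -/
theorem sum_energy_sub_energy (hV : h.IsContinuous V) (hW : h.IsContinuous W) :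
    ∑ i, ∑ n : Fin (h.M + 1),
        (h.energy V W i n (h.time n.succ) - h.energy V W i n (h.time n.castSucc))
      = h.intSpace (h.fluxIntegrand V W).1 + h.intSlice (h.fluxIntegrand V W).2.2.1
        + h.intSlice (h.fluxIntegrand V W).2.2.2.1 := by
  have hint : ∀ i n t, Integrable (fun x => (S.c ^ 2)⁻¹ * (V i n).1 x t * (W i n).1 x t
      + inner ℝ ((V i n).2 x t) ((W i n).2 x t)) (volume.restrict (h.K i)) := fun i n t =>
    MemLp.integrable le_top
      ((memLp_top_mul ((hV.memLp_slice i n t).const_mul _) (hW.memLp_slice i n t)).add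
      (memLp_top_inner (hV.memLp_sliceVec i n t) (hW.memLp_sliceVec i n t)))
  simp only [intSpace, intSlice, ← Finset.sum_add_distrib]
  refine Finset.sum_congr rfl fun i _ => ?_
  have h1 : ∀ k, ∫ x in h.K i, (h.fluxIntegrand V W).1 i k x
      = h.energy V W i k.castSucc (h.level k) - h.energy V W i k.succ (h.level k) := fun k =>
    integral_sub (hint _ _ _) (hint _ _ _)
  have h2 : ∫ x in h.K i, (h.fluxIntegrand V W).2.2.1 i x = -h.energy V W i 0 0 :=
    integral_neg _
  have h3 : ∫ x in h.K i, (h.fluxIntegrand V W).2.2.2.1 i x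
      = h.energy V W i (Fin.last h.M) S.T := rfl
  -- The last slab is split off the sum over upper ends and the first slab off the sum over lower
  -- ends, after which both run over the internal levels.
  rw [h2, h3, Finset.sum_sub_distrib, Fin.sum_univ_castSucc,
    Fin.sum_univ_succ (fun n : Fin (h.M + 1) => h.energy V W i n (h.time n.castSucc))]
  simp only [h1, Finset.sum_sub_distrib, level, Fin.succ_last, h.time_last, Fin.castSucc_zero,
    h.time_zero, Fin.succ_castSucc]
  ring

/-- The energy identity on the whole mesh. -/
theorem total_fluxIntegrand (hV : V ∈ h.trefftzSpace p) (hW : W ∈ h.trefftzSpace p) :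
    h.total (h.fluxIntegrand V W) = 0 := by
  have hVc := isContinuous_of_mem hV
  have hWc := isContinuous_of_mem hW
  have hD : h.intBdry S.ΓD (h.fluxIntegrand V W).2.2.2.2.1
      = ∑ i, ∑ n, ∫ z, h.elementFlux V W i n z ∂h.bdryMeasure S.ΓD i n :=
    Finset.sum_congr rfl fun i _ => Finset.sum_congr rfl fun n _ => (integral_congr_ae
      (ae_elementFlux_bdry S.measurable_ΓD (ΓD_subset_frontier S) i n)).symm
  have hN : h.intBdry S.ΓN (h.fluxIntegrand V W).2.2.2.2.2
      = ∑ i, ∑ n, ∫ z, h.elementFlux V W i n z ∂h.bdryMeasure S.ΓN i n :=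
    Finset.sum_congr rfl fun i _ => Finset.sum_congr rfl fun n _ => (integral_congr_ae
      (ae_elementFlux_bdry S.measurable_ΓN (ΓN_subset_frontier S) i n)).symm
  have hleft : ∀ i j n, Integrable (h.elementFlux V W i n) (h.timeMeasure i j n) := fun i j n =>
    MemLp.integrable le_top ((memLp_top_mul (h.memLp_timeMeasure i j n (hVc i n).1)
      (memLp_top_inner (S.memLp_top_pow_const _ (h.memLp_timeMeasure i j n (hWc i n).2))
        (h.memLp_left_normal i j n))).add (memLp_top_mul (h.memLp_timeMeasure i j n (hWc i n).1)
      (memLp_top_inner (S.memLp_top_pow_const _ (h.memLp_timeMeasure i j n (hVc i n).2))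
        (h.memLp_left_normal i j n))))
  -- The sum over ordered pairs of neighbours is folded into one over i < j, where the two
  -- contributions live on the same face.
  have hT : h.intTime (h.fluxIntegrand V W).2.1
      = ∑ i, ∑ n, ∑ j ∈ Finset.univ.erase i, ∫ z, h.elementFlux V W i n z ∂h.timeMeasure i j n := by
    have h1 : ∀ i, ∑ n, ∑ j ∈ Finset.univ.erase i,
        ∫ z, h.elementFlux V W i n z ∂h.timeMeasure i j n
        = ∑ j ∈ Finset.univ.erase i, ∑ n, ∫ z, h.elementFlux V W i n z ∂h.timeMeasure i j n :=
      fun i => Finset.sum_comm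
    simp only [h1]
    rw [sum_sum_erase_eq]
    refine Finset.sum_congr rfl fun i _ => Finset.sum_congr rfl fun j hj => ?_
    rw [← Finset.sum_add_distrib]
    refine Finset.sum_congr rfl fun n _ => ?_
    rw [h.timeMeasure_comm i j n, ← integral_add (hleft i j n) (by
      rw [← h.timeMeasure_comm]
      exact hleft j i n)]
    exact (integral_congr_ae (ae_elementFlux_add i j (Finset.mem_Ioi.1 hj).ne n)).symm
  have hE : ∑ i, ∑ n : Fin (h.M + 1),
      (h.energy V W i n (h.time n.succ) - h.energy V W i n (h.time n.castSucc))
      = -(∑ i, ∑ n, ∑ j ∈ Finset.univ.erase i, ∫ z, h.elementFlux V W i n z ∂h.timeMeasure i j n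
        + ∑ i, ∑ n, ∫ z, h.elementFlux V W i n z ∂h.bdryMeasure S.ΓD i n
        + ∑ i, ∑ n, ∫ z, h.elementFlux V W i n z ∂h.bdryMeasure S.ΓN i n) := by
    simp only [energy_sub_energy hV hW, integral_elementFlux hVc hWc, Finset.sum_neg_distrib,
      Finset.sum_add_distrib]
  rw [sum_energy_sub_energy hVc hWc, ← hT, ← hD, ← hN] at hE
  rw [total]
  linarith

end Mesh

end TrefftzDG

namespace TrefftzDG

variable {d : ℕ}

/-! ### The main estimates -/

theorem eqOn_zero_of_setIntegral_eq_zero {K : Set (Space d)} (hK : IsPolytope K)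
    {f : Space d → ℝ} (hf : Continuous f) (h0 : ∀ x, 0 ≤ f x) (hint : ∫ x in K, f x = 0) :
    ∀ x ∈ K, f x = 0 := by
  have := hK.isFiniteMeasure_restrict
  rw [integral_eq_zero_iff_of_nonneg h0 ((memLp_top_volume hK hf).integrable le_top)] at hint
  exact Measure.eqOn_open_of_ae_eq hint hK.isOpen hf.continuousOn continuousOn_const

/-- The quadratic polynomial r²a - rx + b has no sign change, so its discriminant x² - 4ab is not
positive. This replaces a Cauchy–Schwarz inequality over all the terms of the norms. -/
theorem abs_le_two_mul_sqrt_mul_sqrt {x a b : ℝ} (ha : 0 ≤ a)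
    (h : ∀ r : ℝ, r * x ≤ r ^ 2 * a + b) : |x| ≤ 2 * √a * √b := by
  have h1 : discrim a (-x) b ≤ 0 := discrim_le_zero fun r => by linarith [h r]
  rw [discrim] at h1
  calc |x| ≤ √(4 * (a * b)) := Real.abs_le_sqrt (by linarith)
    _ = 2 * √a * √b := by
      rw [Real.sqrt_mul (by norm_num), Real.sqrt_mul ha, show (4 : ℝ) = 2 ^ 2 by norm_num,
        Real.sqrt_sq (by norm_num), mul_assoc]

theorem exists_eq_of_injective_dual {E : Type*} [AddCommGroup E] [Module ℝ E]
    [FiniteDimensional ℝ E] {B : E →ₗ[ℝ] Module.Dual ℝ E} (hB : Function.Injective B)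
    (l : Module.Dual ℝ E) : ∃ u, B u = l :=
  (LinearMap.injective_iff_surjective_of_finrank_eq_finrank
    Subspace.dual_finrank_eq.symm).1 hB l

namespace Mesh

variable {S : Model d} {h : Mesh S} {V W : h.Broken} {p : ℕ}

theorem intSpace_nonneg {f : Fin h.m → Fin h.M → Space d → ℝ} (hf : ∀ i k x, 0 ≤ f i k x) :
    0 ≤ h.intSpace f :=
  Finset.sum_nonneg fun i _ => Finset.sum_nonneg fun k _ => integral_nonneg (hf i k)

theorem intTime_nonneg {f : Fin h.m → Fin h.m → Fin (h.M + 1) → Space d × ℝ → ℝ}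
    (hf : ∀ i j n z, 0 ≤ f i j n z) : 0 ≤ h.intTime f :=
  Finset.sum_nonneg fun i _ => Finset.sum_nonneg fun j _ => Finset.sum_nonneg fun n _ =>
    integral_nonneg (hf i j n)

theorem intSlice_nonneg {f : Fin h.m → Space d → ℝ} (hf : ∀ i x, 0 ≤ f i x) :
    0 ≤ h.intSlice f :=
  Finset.sum_nonneg fun i _ => integral_nonneg (hf i)

theorem intBdry_nonneg {Γ : Set (Space d)} {f : Fin h.m → Fin (h.M + 1) → Space d × ℝ → ℝ}
    (hf : ∀ i n z, 0 ≤ f i n z) : 0 ≤ h.intBdry Γ f :=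
  Finset.sum_nonneg fun i _ => Finset.sum_nonneg fun n _ => integral_nonneg (hf i n)

/-- The jumps in time and the initial values are the only terms needed for definiteness. -/
theorem le_dgSq (h : Mesh S) (π : Parameters d) (W : h.Broken) :
    (1 / 2) * h.intSpace (fun i k x => (S.c⁻¹ * h.tJump W i k x) ^ 2)
      + (1 / 2) * h.intSpace (fun i k x => ‖h.tJumpVec W i k x‖ ^ 2)
      + (1 / 2) * h.intSlice (fun i x => (S.c⁻¹ * (W i 0).1 x 0) ^ 2)
      + (1 / 2) * h.intSlice (fun i x => ‖(W i 0).2 x 0‖ ^ 2) ≤ h.dgSq π W := by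
  have h1 : 0 ≤ h.intSlice (fun i x => (S.c⁻¹ * (W i (Fin.last h.M)).1 x S.T) ^ 2) :=
    intSlice_nonneg fun _ _ => sq_nonneg _
  have h2 : 0 ≤ h.intSlice (fun i x => ‖(W i (Fin.last h.M)).2 x S.T‖ ^ 2) :=
    intSlice_nonneg fun _ _ => sq_nonneg _
  have h3 : 0 ≤ h.intTime (fun i j n z =>
      ‖π.α z ^ (1 / 2 : ℝ) • S.pow (1 / 4 + π.δ z / 2) (h.nJump W i j n z)‖ ^ 2) :=
    intTime_nonneg fun _ _ _ _ => sq_nonneg _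
  have h4 : 0 ≤ h.intTime (fun i j n z => (π.β z ^ (1 / 2 : ℝ) * h.nJumpVec W i j n z) ^ 2) :=
    intTime_nonneg fun _ _ _ _ => sq_nonneg _
  have h5 : 0 ≤ h.intBdry S.ΓD (fun i n z => ‖(π.α z ^ (1 / 2 : ℝ) * (W i n).1 z.1 z.2) •
        S.pow (1 / 4 + π.δ z / 2) (outwardNormal S.Ω z.1)‖ ^ 2) :=
    intBdry_nonneg fun _ _ _ => sq_nonneg _
  have h6 : 0 ≤ h.intBdry S.ΓN (fun i n z => (π.β z ^ (1 / 2 : ℝ) *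
        inner ℝ (S.pow (1 / 2) ((W i n).2 z.1 z.2)) (outwardNormal S.Ω z.1)) ^ 2) :=
    intBdry_nonneg fun _ _ _ => sq_nonneg _
  rw [dgSq]
  linarith

theorem dgSq_nonneg (h : Mesh S) (π : Parameters d) (W : h.Broken) : 0 ≤ h.dgSq π W := by
  have h1 : 0 ≤ h.intSpace (fun i k x => (S.c⁻¹ * h.tJump W i k x) ^ 2) :=
    intSpace_nonneg fun _ _ _ => sq_nonneg _
  have h2 : 0 ≤ h.intSpace (fun i k x => ‖h.tJumpVec W i k x‖ ^ 2) :=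
    intSpace_nonneg fun _ _ _ => sq_nonneg _
  have h3 : 0 ≤ h.intSlice (fun i x => (S.c⁻¹ * (W i 0).1 x 0) ^ 2) :=
    intSlice_nonneg fun _ _ => sq_nonneg _
  have h4 : 0 ≤ h.intSlice (fun i x => ‖(W i 0).2 x 0‖ ^ 2) :=
    intSlice_nonneg fun _ _ => sq_nonneg _
  linarith [h.le_dgSq π W]

theorem dgSq_le_dgPlusSq (h : Mesh S) (π : Parameters d) (W : h.Broken) :
    h.dgSq π W ≤ h.dgPlusSq π W := by
  have h1 : 0 ≤ h.intSpace (fun i k x => (S.c⁻¹ * h.below W i k x) ^ 2) :=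
    intSpace_nonneg fun _ _ _ => sq_nonneg _
  have h2 : 0 ≤ h.intSpace (fun i k x => ‖h.belowVec W i k x‖ ^ 2) :=
    intSpace_nonneg fun _ _ _ => sq_nonneg _
  have h3 : 0 ≤ h.intTime (fun i j n z =>
      ‖π.α z ^ (-(1 / 2) : ℝ) • S.pow (1 / 4 - π.δ z / 2) (h.avgVec W i j n z)‖ ^ 2) :=
    intTime_nonneg fun _ _ _ _ => sq_nonneg _
  have h4 : 0 ≤ h.intBdry S.ΓD (fun i n z =>
      ‖π.α z ^ (-(1 / 2) : ℝ) • S.pow (1 / 4 - π.δ z / 2) ((W i n).2 z.1 z.2)‖ ^ 2) :=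
    intBdry_nonneg fun _ _ _ => sq_nonneg _
  have h5 : 0 ≤ h.intTime (fun i j n z => (π.β z ^ (-(1 / 2) : ℝ) * h.avg W i j n z) ^ 2) :=
    intTime_nonneg fun _ _ _ _ => sq_nonneg _
  have h6 : 0 ≤ h.intBdry S.ΓN (fun i n z =>
      (π.β z ^ (-(1 / 2) : ℝ) * (W i n).1 z.1 z.2) ^ 2) :=
    intBdry_nonneg fun _ _ _ => sq_nonneg _
  rw [dgPlusSq]
  linarith

/-- Coercivity: on the Trefftz space the DG norm is the energy norm of the bilinear form. -/
theorem dgSq_eq_form (π : Parameters d) (hW : W ∈ h.trefftzSpace p) :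
    h.dgSq π W = h.form π W W := by
  have hc := isContinuous_of_mem hW
  rw [dgSq_eq_total π hc, dgIntegrand_eq, h.total_add (isIntegrable_formIntegrand π hc hc)
    ((isIntegrable_fluxIntegrand hc hc).smul _), total_smul, total_fluxIntegrand hW hW,
    ← form_eq_total, mul_zero, add_zero]

theorem form_le_dgPlusSq_add_dgSq (π : Parameters d) (hV : h.IsContinuous V)
    (hW : h.IsContinuous W) : h.form π V W ≤ h.dgPlusSq π V + h.dgSq π W := by
  have h1 := (isIntegrable_dgIntegrand π hV).add (isIntegrable_augmentIntegrand π hV)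
  rw [form_eq_total, dgPlusSq_eq_total π hV, dgSq_eq_total π hV, dgSq_eq_total π hW,
    ← h.total_add (isIntegrable_dgIntegrand π hV) (isIntegrable_augmentIntegrand π hV),
    ← h.total_add h1 (isIntegrable_dgIntegrand π hW)]
  exact h.total_mono (isIntegrable_formIntegrand π hV hW)
    (h1.add (isIntegrable_dgIntegrand π hW)) (formIntegrand_le π)

/-- The flux terms integrate to zero by the energy identity; this is why the Trefftz property is
required here, while the companion bound holds for all continuous broken fields. -/
theorem form_le_dgSq_add_dgPlusSq (π : Parameters d) (hV : V ∈ h.trefftzSpace p)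
    (hW : W ∈ h.trefftzSpace p) : h.form π V W ≤ h.dgSq π V + h.dgPlusSq π W := by
  have hVc := isContinuous_of_mem hV
  have hWc := isContinuous_of_mem hW
  have h1 := isIntegrable_dgIntegrand π hVc
  have h2 := isIntegrable_dgIntegrand π hWc
  have h3 := isIntegrable_augmentIntegrand π hWc
  have h4 := isIntegrable_fluxIntegrand hVc hWc
  have h5 := (isIntegrable_fluxIntegrand hWc hWc).smul (-(1 / 2))
  have h6 := h.total_mono (isIntegrable_formIntegrand π hVc hWc)
    ((h1.add (h2.add h3)).add (h4.add h5)) (formIntegrand_le_flux π)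
  rw [h.total_add (h1.add (h2.add h3)) (h4.add h5), h.total_add h1 (h2.add h3), h.total_add h2 h3,
    h.total_add h4 h5, total_smul, total_fluxIntegrand hV hW, total_fluxIntegrand hW hW] at h6
  rw [form_eq_total, dgPlusSq_eq_total π hWc, dgSq_eq_total π hVc, dgSq_eq_total π hWc]
  linarith

theorem abs_form_le_dgPlusNorm_mul_dgNorm (π : Parameters d) (hV : h.IsContinuous V)
    (hW : h.IsContinuous W) : |h.form π V W| ≤ 2 * h.dgPlusNorm π V * h.dgNorm π W := by
  refine abs_le_two_mul_sqrt_mul_sqrt ((h.dgSq_nonneg π V).trans (h.dgSq_le_dgPlusSq π V))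
    fun r => ?_
  -- The scalar r is absorbed into V: the form is linear and the squared norm quadratic in V.
  rw [← form_smul_left, ← dgPlusSq_smul π hV]
  exact form_le_dgPlusSq_add_dgSq π (hV.smul r) hW

theorem abs_form_le_dgNorm_mul_dgPlusNorm (π : Parameters d) (hV : V ∈ h.trefftzSpace p)
    (hW : W ∈ h.trefftzSpace p) : |h.form π V W| ≤ 2 * h.dgNorm π V * h.dgPlusNorm π W := by
  refine abs_le_two_mul_sqrt_mul_sqrt (h.dgSq_nonneg π V) fun r => ?_
  rw [← form_smul_left, ← dgSq_smul π (isContinuous_of_mem hV)]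
  exact form_le_dgSq_add_dgPlusSq π (Submodule.smul_mem _ r hV) hW

/-- Induction over the slabs: vanishing initial values annihilate the first slab by Cauchy
uniqueness, and vanishing time jumps pass zero on as initial values of the next one. -/
theorem eq_zero_of_dgSq_eq_zero (π : Parameters d) (hW : W ∈ h.trefftzSpace p)
    (h0 : h.dgSq π W = 0) : W = 0 := by
  have hc := isContinuous_of_mem hW
  have h1 : 0 ≤ h.intSpace (fun i k x => (S.c⁻¹ * h.tJump W i k x) ^ 2) :=
    intSpace_nonneg fun _ _ _ => sq_nonneg _
  have h2 : 0 ≤ h.intSpace (fun i k x => ‖h.tJumpVec W i k x‖ ^ 2) :=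
    intSpace_nonneg fun _ _ _ => sq_nonneg _
  have h3 : 0 ≤ h.intSlice (fun i x => (S.c⁻¹ * (W i 0).1 x 0) ^ 2) :=
    intSlice_nonneg fun _ _ => sq_nonneg _
  have h4 : 0 ≤ h.intSlice (fun i x => ‖(W i 0).2 x 0‖ ^ 2) :=
    intSlice_nonneg fun _ _ => sq_nonneg _
  have h5 := h.le_dgSq π W
  have hspace : ∀ {f : Fin h.m → Fin h.M → Space d → ℝ}, (∀ i k, Continuous (f i k)) →
      (∀ i k x, 0 ≤ f i k x) → h.intSpace f = 0 → ∀ i k, ∀ x ∈ h.K i, f i k x = 0 := by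
    intro f hf hf0 hint i k
    have e1 := (Finset.sum_eq_zero_iff_of_nonneg fun i _ => Finset.sum_nonneg fun k _ =>
      integral_nonneg (hf0 i k)).1 hint i (Finset.mem_univ i)
    exact eqOn_zero_of_setIntegral_eq_zero (h.polytope i) (hf i k) (hf0 i k)
      ((Finset.sum_eq_zero_iff_of_nonneg fun k _ => integral_nonneg (hf0 i k)).1 e1 k
        (Finset.mem_univ k))
  have hslice : ∀ {f : Fin h.m → Space d → ℝ}, (∀ i, Continuous (f i)) →
      (∀ i x, 0 ≤ f i x) → h.intSlice f = 0 → ∀ i, ∀ x ∈ h.K i, f i x = 0 := by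
    intro f hf hf0 hint i
    exact eqOn_zero_of_setIntegral_eq_zero (h.polytope i) (hf i) (hf0 i)
      ((Finset.sum_eq_zero_iff_of_nonneg fun i _ => integral_nonneg (hf0 i)).1 hint i
        (Finset.mem_univ i))
  have e1 := hspace (fun i k => (((hc.slice i k.castSucc _).1.sub
    (hc.slice i k.succ _).1).const_mul _).pow 2) (fun _ _ _ => sq_nonneg _)
    (by linarith : h.intSpace (fun i k x => (S.c⁻¹ * h.tJump W i k x) ^ 2) = 0)
  have e2 := hspace (fun i k => (((hc.slice i k.castSucc _).2.sub
    (hc.slice i k.succ _).2).norm).pow 2) (fun _ _ _ => sq_nonneg _)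
    (by linarith : h.intSpace (fun i k x => ‖h.tJumpVec W i k x‖ ^ 2) = 0)
  have e3 := hslice (fun i => ((hc.slice i 0 0).1.const_mul _).pow 2) (fun _ _ => sq_nonneg _)
    (by linarith : h.intSlice (fun i x => (S.c⁻¹ * (W i 0).1 x 0) ^ 2) = 0)
  have e4 := hslice (fun i => ((hc.slice i 0 0).2.norm).pow 2) (fun _ _ => sq_nonneg _)
    (by linarith : h.intSlice (fun i x => ‖(W i 0).2 x 0‖ ^ 2) = 0)
  have hci : S.c⁻¹ ≠ 0 := inv_ne_zero S.c_pos.ne'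
  have hzero : ∀ (n : Fin (h.M + 1)) (i : Fin h.m), W i n = 0 := by
    intro n
    induction n using Fin.induction with
    | zero =>
      intro i
      refine Model.eq_zero_of_mem_localTrefftz (mem_trefftzSpace.1 hW i 0) (h.polytope i).isOpen
        (h.polytope i).nonempty (t₀ := 0) (fun x hx => ?_) (fun x hx => ?_)
      · exact (mul_eq_zero.1 (pow_eq_zero_iff two_ne_zero |>.1 (e3 i x hx))).resolve_left hci
      · exact norm_eq_zero.1 (pow_eq_zero_iff two_ne_zero |>.1 (e4 i x hx))
    | succ k ih =>
      intro i
      refine Model.eq_zero_of_mem_localTrefftz (mem_trefftzSpace.1 hW i k.succ)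
        (h.polytope i).isOpen (h.polytope i).nonempty (t₀ := h.level k) (fun x hx => ?_)
        (fun x hx => ?_)
      · have e5 := (mul_eq_zero.1 (pow_eq_zero_iff two_ne_zero |>.1 (e1 i k x hx))).resolve_left hci
        simpa [tJump, ih i] using e5
      · have e5 := norm_eq_zero.1 (pow_eq_zero_iff two_ne_zero |>.1 (e2 i k x hx))
        simpa [tJumpVec, ih i] using e5
  exact funext fun i => funext fun n => hzero n i

/-! ### Well-posedness -/

/-- The bilinear form on the Trefftz space. -/
noncomputable def trefftzForm (h : Mesh S) (π : Parameters d) (p : ℕ) :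
    h.trefftzSpace p →ₗ[ℝ] Module.Dual ℝ (h.trefftzSpace p) :=
  LinearMap.mk₂ ℝ (fun V W => h.form π V W)
    (fun V V' W => form_add_left π (isContinuous_of_mem V.2) (isContinuous_of_mem V'.2)
      (isContinuous_of_mem W.2))
    (fun r _ _ => form_smul_left π r)
    (fun V W W' => form_add_right π (isContinuous_of_mem V.2) (isContinuous_of_mem W.2)
      (isContinuous_of_mem W'.2))
    (fun r _ _ => form_smul_right π r)

/-- The linear functional on the Trefftz space. -/
noncomputable def trefftzLoad (h : Mesh S) (π : Parameters d) (g : Data S) (p : ℕ) :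
    Module.Dual ℝ (h.trefftzSpace p) where
  toFun W := h.load π g W
  map_add' W W' := load_add π g (isContinuous_of_mem W.2) (isContinuous_of_mem W'.2)
  map_smul' r W := load_smul π g (isContinuous_of_mem W.2) r

theorem trefftzForm_apply (h : Mesh S) (π : Parameters d) (p : ℕ) (V W : h.trefftzSpace p) :
    h.trefftzForm π p V W = h.form π V.1 W.1 := rfl

theorem trefftzLoad_apply (h : Mesh S) (π : Parameters d) (g : Data S) (p : ℕ)
    (W : h.trefftzSpace p) : h.trefftzLoad π g p W = h.load π g W.1 := rfl

/-- Testing with the field itself reduces this to definiteness of the DG norm. -/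
theorem trefftzForm_injective (h : Mesh S) (π : Parameters d) (p : ℕ) :
    Function.Injective (h.trefftzForm π p) := by
  rw [injective_iff_map_eq_zero]
  intro V hV
  have h1 : h.trefftzForm π p V V = 0 := by rw [hV, LinearMap.zero_apply]
  rw [trefftzForm_apply, ← dgSq_eq_form π V.2] at h1
  exact Subtype.ext (eq_zero_of_dgSq_eq_zero π V.2 h1)

theorem isDiscreteSolution_iff (h : Mesh S) (π : Parameters d) (g : Data S) (p : ℕ)
    (U : h.trefftzSpace p) :
    h.IsDiscreteSolution π g p U.1 ↔ h.trefftzForm π p U = h.trefftzLoad π g p := by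
  rw [LinearMap.ext_iff]
  simp only [trefftzForm_apply, trefftzLoad_apply]
  exact ⟨fun hU W => hU.2 W.1 W.2, fun hU => ⟨U.2, fun W hW => hU ⟨W, hW⟩⟩⟩

theorem existsUnique_isDiscreteSolution (h : Mesh S) (π : Parameters d) (g : Data S) (p : ℕ) :
    ∃! U : h.Broken, h.IsDiscreteSolution π g p U := by
  have := h.finiteDimensional_trefftzSpace p
  have hinj := h.trefftzForm_injective π p
  obtain ⟨U, hU⟩ := exists_eq_of_injective_dual hinj (h.trefftzLoad π g p)
  refine ⟨U.1, (h.isDiscreteSolution_iff π g p U).2 hU, fun U' hU' => ?_⟩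
  have h1 := (h.isDiscreteSolution_iff π g p ⟨U', hU'.1⟩).1 hU'
  exact congrArg Subtype.val (hinj (h1.trans hU.symm))

end Mesh

end TrefftzDG

/-! ### The theorem -/

theorem mainTheorem4 {d : ℕ} (hd : 1 ≤ d) (S : TrefftzDG.Model d) (h : TrefftzDG.Mesh S)
    (π : TrefftzDG.Parameters d) (g : TrefftzDG.Data S) (p : ℕ) :
    (∃! U : h.Broken, h.IsDiscreteSolution π g p U) ∧
      ∀ V ∈ h.trefftzSpace p, ∀ W ∈ h.trefftzSpace p,
        h.dgNorm π W ^ 2 = h.form π W W ∧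
        |h.form π V W| ≤ 2 * h.dgPlusNorm π V * h.dgNorm π W ∧
        |h.form π V W| ≤ 2 * h.dgNorm π V * h.dgPlusNorm π W := by
  refine ⟨h.existsUnique_isDiscreteSolution π g p, fun V hV W hW => ⟨?_, ?_, ?_⟩⟩
  · rw [TrefftzDG.Mesh.dgNorm, Real.sq_sqrt (h.dgSq_nonneg π W)]
    exact TrefftzDG.Mesh.dgSq_eq_form π hW
  · exact TrefftzDG.Mesh.abs_form_le_dgPlusNorm_mul_dgNorm π
      (TrefftzDG.Mesh.isContinuous_of_mem hV) (TrefftzDG.Mesh.isContinuous_of_mem hW)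
  · exact TrefftzDG.Mesh.abs_form_le_dgNorm_mul_dgPlusNorm π hV hW
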